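/- Let $\theta\in[0,1)$ be an irrational number of bounded density, i.e. if $\theta=1/(a_1+1/(a_2+\cdots))$ is its continued fraction expansion, then $\limsup_{n\to\infty}\frac1n\sum_{i=1}^n a_i<\infty$. Let $\lambda\in\mathbb R$, $\lambda\neq0$, and for $\rho\in[0,1)$ let $H_{\lambda,\theta,\rho}$ be the Sturmian operator on $\ell^2(\mathbb Z)$, $$(H_{\lambda,\theta,\rho}\psi)(n)=\psi(n+1)+\psi(n-1)+V(n)\psi(n),\qquad V(n)=\lambda\,\chi_{[1-\theta,1)}(n\theta+\rho \bmod 1).$$ For $u:\mathbb Z\to\mathbb C$ and $L>0$ put $\|u\|_L=\big[\sum_{n=1}^{\lfloor L\rfloor}|u(n)|^2+(L-\lfloor L\rfloor)|u(\lfloor L\rfloor+1)|^2\big]^{1/2}$. Call $(\gamma_1,\gamma_2)$, with $\gamma_1,\gamma_2>0$, power-law exponents for $H_{\lambda,\theta,\rho}$ if for every $E\in\sigma(H_{\lambda,\theta,\rho})$ there are constants $C_1,C_2>0$ such that every solution $u$ of the difference equation $H_{\lambda,\theta,\rho}u=Eu$ with $|u(0)|^2+|u(1)|^2=1$ satisfies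 $$C_1L^{\gamma_1}\le\|u\|_L\le C_2L^{\gamma_2}\qquad\text{for all sufficiently large } L.$$ Then: (a) there are $\gamma_1,\gamma_2>0$, depending only on $\theta$ and $\lambda$, such that $(\gamma_1,\gamma_2)$ are power-law exponents for $H_{\lambda,\theta,\rho}$ for every $\rho\in[0,1)$; (b) for every $\rho\in[0,1)$, all power-law exponents $(\gamma_1,\gamma_2)$ for $H_{\lambda,\theta,\rho}$, every real $p>3\gamma_2-\gamma_1$ and every bounded $P:\mathbb Z\to\mathbb R$ such that, for some $C>0$, $|P(n)|\le C(1+n)^{-p}$ for all integers $n\ge0$ (in particular, for every $P$ with $|P(n)|\le C(1+|n|)^{-p}$ for all $n\in\mathbb Z$), the operator $H_{\lambda,\theta,\rho}+P$ on $\ell^2(\mathbb Z)$ has no eigenvalue in $\sigma(H_{\lambda,\theta,\rho})$. -/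

import Mathlib

open Filter
open scoped ENNReal

noncomputable section

namespace Sturmian

/-- The complex Hilbert space `ℓ²(ℤ)`. -/
abbrev L2Z : Type := lp (fun _ : ℤ => ℂ) 2

/-- The space `ℓ^∞(ℤ; ℝ)` of bounded real sequences on `ℤ` (potentials and perturbations). -/
abbrev BddSeq : Type := lp (fun _ : ℤ => ℝ) ∞

theorem memlp_shift (k : ℤ) (ψ : L2Z) : Memℓp (fun n : ℤ => ψ (n + k)) 2 := by
  have h2 : 0 < (2 : ℝ≥0∞).toReal := by norm_num
  refine memℓp_gen ?_
  exact (Equiv.addRight k).summable_iff.mpr ((lp.memℓp ψ).summable h2)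

theorem memlp_mul (V : BddSeq) (ψ : L2Z) : Memℓp (fun n : ℤ => (V n : ℂ) * ψ n) 2 := by
  have h2 : 0 < (2 : ℝ≥0∞).toReal := by norm_num
  refine memℓp_gen ?_
  refine Summable.of_nonneg_of_le (fun n => by positivity) (fun n => ?_)
    ((lp.memℓp (((‖V‖ : ℝ) : ℂ) • ψ)).summable h2)
  have hV : ‖V n‖ ≤ ‖V‖ := lp.norm_apply_le_norm ENNReal.top_ne_zero V n
  have : ‖(V n : ℂ) * ψ n‖ ≤ ‖(((‖V‖ : ℝ) : ℂ) • ψ) n‖ := by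
    simp only [lp.coeFn_smul, Pi.smul_apply, smul_eq_mul, norm_mul, Complex.norm_real, norm_norm]
    gcongr
  gcongr

/-- The linear map `(Hψ)(n) = ψ(n+1) + ψ(n-1) + V(n) ψ(n)` on `ℓ²(ℤ)`. -/
def schrodingerLM (V : BddSeq) : L2Z →ₗ[ℂ] L2Z where
  toFun ψ := ⟨fun n : ℤ => ψ (n + 1) + ψ (n + (-1)) + (V n : ℂ) * ψ n,
    ((memlp_shift 1 ψ).add (memlp_shift (-1) ψ)).add (memlp_mul V ψ)⟩
  map_add' ψ φ := by
    ext n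
    simp only [lp.coeFn_add, Pi.add_apply]
    ring
  map_smul' c ψ := by
    ext n
    simp only [lp.coeFn_smul, Pi.smul_apply, smul_eq_mul, RingHom.id_apply]
    ring

theorem schrodingerLM_continuous (V : BddSeq) :
    ∀ (u : ℕ → L2Z) (x y : L2Z), Tendsto u atTop (nhds x) →
      Tendsto (schrodingerLM V ∘ u) atTop (nhds y) → y = schrodingerLM V x := by
  intro u x y hu hy
  ext n
  have ev : ∀ (v : ℕ → L2Z) (z : L2Z) (m : ℤ), Tendsto v atTop (nhds z) →
      Tendsto (fun j => v j m) atTop (nhds (z m)) := fun v z m hv =>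
    ((lp.evalCLM ℂ (fun _ : ℤ => ℂ) 2 m).continuous.tendsto z).comp hv
  refine tendsto_nhds_unique (ev _ y n hy) ?_
  exact ((ev u x (n + 1) hu).add (ev u x (n + (-1)) hu)).add
    ((ev u x n hu).const_mul (V n : ℂ))

/-- The discrete Schrödinger operator `(Hψ)(n) = ψ(n+1) + ψ(n-1) + V(n) ψ(n)`, as a bounded
operator on `ℓ²(ℤ)`; continuity comes from the closed graph theorem. -/
def schrodinger (V : BddSeq) : L2Z →L[ℂ] L2Z :=
  ContinuousLinearMap.ofSeqClosedGraph (schrodingerLM_continuous V)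

theorem schrodinger_apply (V : BddSeq) (ψ : L2Z) (n : ℤ) :
    schrodinger V ψ n = ψ (n + 1) + ψ (n - 1) + (V n : ℂ) * ψ n := rfl

/-- The values `λ χ_{[1-θ,1)}(nθ + ρ mod 1)` of the Sturmian potential. -/
def sturmianFun (lam θ ρ : ℝ) (n : ℤ) : ℝ :=
  lam * (Set.Ico (1 - θ) 1).indicator (fun _ => (1 : ℝ)) (Int.fract (n * θ + ρ))

theorem memlp_sturmianFun (lam θ ρ : ℝ) : Memℓp (sturmianFun lam θ ρ) ∞ := by
  refine memℓp_infty ⟨|lam|, ?_⟩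
  rintro _ ⟨n, rfl⟩
  simp only [sturmianFun, norm_mul, Real.norm_eq_abs]
  refine mul_le_of_le_one_right (abs_nonneg _) ?_
  by_cases h : Int.fract ((n : ℝ) * θ + ρ) ∈ Set.Ico (1 - θ) 1 <;> simp [h]

/-- The Sturmian potential `V_{λ,θ,ρ}` as a bounded sequence. -/
def sturmianPotential (lam θ ρ : ℝ) : BddSeq := ⟨sturmianFun lam θ ρ, memlp_sturmianFun lam θ ρ⟩

/-- The Sturmian operator `H_{λ,θ,ρ}`. -/
def sturmianOp (lam θ ρ : ℝ) : L2Z →L[ℂ] L2Z := schrodinger (sturmianPotential lam θ ρ)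

/-- The perturbed operator `H_{λ,θ,ρ} + P`. -/
def perturbedOp (lam θ ρ : ℝ) (P : BddSeq) : L2Z →L[ℂ] L2Z :=
  schrodinger (sturmianPotential lam θ ρ + P)

/-- The `n`-th partial quotient (`n ≥ 1`) `a_n` of the continued fraction
`θ = a_0 + 1 / (a_1 + 1 / (a_2 + ⋯))`; the expansion of an irrational number never terminates,
so the default value `0` is not used there. -/
def partialQuotient (θ : ℝ) (n : ℕ) : ℝ :=
  ((GenContFract.of θ).partDens.get? (n - 1)).getD 0

/-- Bounded density: `limsup_n (1/n) ∑_{i=1}^n a_i < ∞`. -/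
def BoundedDensity (θ : ℝ) : Prop :=
  limsup (fun n : ℕ => (((∑ i ∈ Finset.Icc 1 n, partialQuotient θ i) / n : ℝ) : EReal)) atTop < ⊤

/-- `u : ℤ → ℂ` is a (not necessarily square summable) solution of
`u(n+1) + u(n-1) + V(n) u(n) = E u(n)`, `n ∈ ℤ`. -/
def IsSolution (V : BddSeq) (E : ℂ) (u : ℤ → ℂ) : Prop :=
  ∀ n : ℤ, u (n + 1) + u (n - 1) + (V n : ℂ) * u n = E * u n

/-- The truncated norm
`‖u‖_L = (∑_{n=1}^{⌊L⌋} |u(n)|² + (L - ⌊L⌋) |u(⌊L⌋+1)|²)^{1/2}`, for `L > 0`. -/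
def truncNorm (u : ℤ → ℂ) (L : ℝ) : ℝ :=
  Real.sqrt ((∑ n ∈ Finset.Icc 1 ⌊L⌋₊, ‖u (n : ℤ)‖ ^ 2)
    + (L - (⌊L⌋₊ : ℝ)) * ‖u ((⌊L⌋₊ : ℤ) + 1)‖ ^ 2)

/-- `γ₁, γ₂ > 0` are power-law exponents for `H_{λ,θ,ρ}`: for each energy `E` in the spectrum
there are `C₁, C₂ > 0` such that every solution of `H u = E u` normalized by
`|u(0)|² + |u(1)|² = 1` obeys `C₁ L^{γ₁} ≤ ‖u‖_L ≤ C₂ L^{γ₂}` for all sufficiently large `L`. -/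
def HasPowerLawBounds (lam θ ρ γ₁ γ₂ : ℝ) : Prop :=
  0 < γ₁ ∧ 0 < γ₂ ∧
    ∀ E ∈ spectrum ℂ (sturmianOp lam θ ρ), ∃ C₁ > 0, ∃ C₂ > 0,
      ∀ u : ℤ → ℂ, IsSolution (sturmianPotential lam θ ρ) E u → ‖u 0‖ ^ 2 + ‖u 1‖ ^ 2 = 1 →
        ∀ᶠ L : ℝ in atTop, C₁ * L ^ γ₁ ≤ truncNorm u L ∧ truncNorm u L ≤ C₂ * L ^ γ₂

end Sturmian

end

/-!
The increments of `⌊n θ + ρ⌋` carry the Sturmian potential. The integer sequences that stay within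
distance `1` of a line of slope `θ` (`IsStaircase`) are stable under the Gauss map: the indices at
which such a sequence jumps form, after subtraction of a linear term, a staircase of the next slope
(`SlopeChain.isStaircase_stair`). Iterating, the line is tiled at each level `n` by two words `A`
and `B`, the next ones being `A ^ b B` and `A ^ b B A`, where `b + 1` is the partial quotient; this
works for every phase `ρ` at once. Two facts about the words are used: tiles of equal type carry
equal words, and all tile starts share the following `|A| + |B| - 2` letters
(`SlopeChain.increment_eq`).

The traces of the transfer matrices of the tiles form an orbit of the trace map. If they satisfy an
open escape condition, all later traces have modulus larger than `2`. For a real energy with this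
property, the operators of the periodic approximants of `θ` are bounded below, by the
Cayley–Hamilton theorem (`bounded_below_of_periodic`), uniformly because they are self-adjoint with
a common spectral gap; hence the energy is not in the spectrum. So energies in the spectrum do not
escape (`not_escapes_of_mem_spectrum`), and the invariant of the trace map bounds all the traces
(`trace_le_of_not_escapes`).

Upper bound: the size of a matrix `Y` on the basis `1, A, B, A B` is multiplied by at most a
constant when `Y` is multiplied by `A` or `B`, as only traces of these matrices enter. Running
through the levels, a transfer matrix is at most exponential in the sum of the partial quotients
(`entrySum_transferTo_le`), which by bounded density is linear in the number of levels, while the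
lengths of the tiles grow exponentially in it.

Lower bound: around every site, on one of three consecutive levels, a square of a cyclic shift of a
tile follows (`SlopeChain.exists_square`). The two-block Gordon argument controls the solution at
the site by its values one and two periods further on (`exists_norm_le`). Summing over the sites of
an interval, the mass of a solution gains a fixed factor over a bounded number of levels
(`mass_reproduction`), and by bounded density the tile lengths grow at most exponentially.

Decaying perturbations: let `w = |u| + |v|` for two fundamental solutions. The upper power law makes
`|P| w ^ 2` summable, with a tail of order `n ^ (γ₁ - γ₂ - ε)`. By variation of constants an
eigenvector of the perturbed operator differs from a nontrivial solution of the unperturbed equation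
by at most that tail times `w`, which contributes only `N ^ (2 γ₁ - ε)` to the mass
(`exists_asymptotic_solution`). The unperturbed solution has a mass of order `N ^ (2 γ₁)` at
least, so the eigenvector is not square summable (`eq_zero_of_isSolution_add`).
-/

noncomputable section

namespace Sturmian

/-! ### Staircases and their renormalization -/

/-- An integer sequence staying within bounded distance of a line of slope `θ`, in the sharp sense
that `|F j - F k - (j - k) θ| < 1` for all `j, k`; the inequality is stated one-sidedly, the other
side being the same inequality with `j` and `k` exchanged. The increments of such a sequence form a
(possibly periodic) Sturmian word of slope `θ`. -/
def IsStaircase (θ : ℝ) (F : ℤ → ℤ) : Prop :=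
  ∀ j k : ℤ, (F j : ℝ) - F k < (j - k) * θ + 1

theorem isStaircase_floor (θ ρ : ℝ) : IsStaircase θ (fun m : ℤ => ⌊(m : ℝ) * θ + ρ⌋) := by
  intro j k
  have h1 := Int.floor_le ((j : ℝ) * θ + ρ)
  have h2 := Int.lt_floor_add_one ((k : ℝ) * θ + ρ)
  linarith

theorem IsStaircase.succ_eq_or {θ : ℝ} {F : ℤ → ℤ} (hF : IsStaircase θ F) (h0 : 0 ≤ θ)
    (h1 : θ ≤ 1) (k : ℤ) : F (k + 1) = F k ∨ F (k + 1) = F k + 1 := by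
  have h2 := hF (k + 1) k
  have h3 := hF k (k + 1)
  push_cast at h2 h3
  have h4 : F (k + 1) < F k + 2 := by
    have : (F (k + 1) : ℝ) < F k + 2 := by linarith
    exact_mod_cast this
  have h5 : F k < F (k + 1) + 1 := by
    have : (F k : ℝ) < F (k + 1) + 1 := by linarith
    exact_mod_cast this
  omega

theorem IsStaircase.exists_jump {θ : ℝ} {F : ℤ → ℤ} (hF : IsStaircase θ F) (h0 : 0 < θ)
    (h1 : θ ≤ 1) (k : ℤ) : ∃ n, F n = k ∧ F (n - 1) = k - 1 := by
  obtain ⟨N, hN⟩ := exists_nat_gt ((|(k : ℝ) - F 0| + 1) / θ)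
  rw [div_lt_iff₀ h0] at hN
  have hbig : k ≤ F N := by
    have := hF 0 N
    have h3 := le_abs_self ((k : ℝ) - F 0)
    push_cast at this
    have : (k : ℝ) < F N := by linarith
    exact_mod_cast this.le
  have hsmall : ∀ z : ℤ, k ≤ F z → -(N : ℤ) ≤ z := by
    intro z hz
    by_contra hlt
    push Not at hlt
    have := hF z 0
    have h3 := neg_abs_le ((k : ℝ) - F 0)
    have hzr : (z : ℝ) < -N := by exact_mod_cast hlt
    have hzk : (k : ℝ) ≤ F z := by exact_mod_cast hz
    push_cast at this
    nlinarith
  obtain ⟨n, hn, hmin⟩ := Int.exists_least_of_bdd (P := fun z => k ≤ F z) ⟨_, hsmall⟩ ⟨N, hbig⟩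
  refine ⟨n, ?_⟩
  have h2 : ¬ k ≤ F (n - 1) := fun h => by have := hmin _ h; omega
  have h3 := hF.succ_eq_or h0.le h1 (n - 1)
  rw [sub_add_cancel] at h3
  omega

theorem IsStaircase.mono {θ : ℝ} {F : ℤ → ℤ} (hF : IsStaircase θ F) (h0 : 0 ≤ θ)
    (h1 : θ ≤ 1) : Monotone F :=
  monotone_int_of_le_succ fun k => by have := hF.succ_eq_or h0 h1 k; omega

/-- The index at which the staircase `F` climbs from `k - 1` to `k`. -/
def jumpIndex (F : ℤ → ℤ) (k : ℤ) : ℤ :=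
  Classical.epsilon fun n => F n = k ∧ F (n - 1) = k - 1

theorem IsStaircase.jumpIndex_spec {θ : ℝ} {F : ℤ → ℤ} (hF : IsStaircase θ F) (h0 : 0 < θ)
    (h1 : θ ≤ 1) (k : ℤ) : F (jumpIndex F k) = k ∧ F (jumpIndex F k - 1) = k - 1 :=
  Classical.epsilon_spec (hF.exists_jump h0 h1 k)

/-- Renormalized staircases. The partial quotients are `b n + 1`; the jump indices of a staircase
of slope `θ = 1 / (b + 1 + θ')` form, up to the linear term `k (b + 1)`, a staircase of
slope `θ'`. -/
def stair (b : ℕ → ℕ) (F : ℤ → ℤ) : ℕ → ℤ → ℤ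
  | 0 => F
  | n + 1 => fun k => jumpIndex (stair b F n) k - k * (b n + 1)

/-- The index, among the tiles of level `n`, of the first tile composing the `k`-th tile of level
`n + 1`. -/
def tileIndex (b : ℕ → ℕ) (F : ℤ → ℤ) (n : ℕ) (k : ℤ) : ℤ :=
  jumpIndex (stair b F n) k - (b n + 1)

/-- The left end point of the `k`-th tile of level `n`. -/
def tileStart (b : ℕ → ℕ) (F : ℤ → ℤ) : ℕ → ℤ → ℤ
  | 0 => fun k => k
  | n + 1 => fun k => tileStart b F n (tileIndex b F n k)

/-- The lengths of the two tiles `A` and `B` of level `n`; the tiles of level `n + 1` are the words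
`A ^ b B` and `A ^ b B A`. -/
def tileLen (b : ℕ → ℕ) : ℕ → ℕ × ℕ
  | 0 => (1, 1)
  | n + 1 => (b n * (tileLen b n).1 + (tileLen b n).2,
      b n * (tileLen b n).1 + (tileLen b n).2 + (tileLen b n).1)

/-- `θ 0, …, θ n` are the first iterates of the Gauss map, with partial quotients `b i + 1`. -/
structure SlopeChain (b : ℕ → ℕ) (θ : ℕ → ℝ) (n : ℕ) : Prop where
  nonneg : ∀ i ≤ n, 0 ≤ θ i
  le_one : ∀ i ≤ n, θ i ≤ 1
  mul_eq : ∀ i < n, θ i * (b i + 1 + θ (i + 1)) = 1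

theorem SlopeChain.mono {b : ℕ → ℕ} {θ : ℕ → ℝ} {n m : ℕ} (h : SlopeChain b θ n) (hm : m ≤ n) :
    SlopeChain b θ m :=
  ⟨fun i hi => h.nonneg i (hi.trans hm), fun i hi => h.le_one i (hi.trans hm),
    fun i hi => h.mul_eq i (hi.trans_le hm)⟩

theorem SlopeChain.pos {b : ℕ → ℕ} {θ : ℕ → ℝ} {n i : ℕ} (h : SlopeChain b θ n) (hi : i < n) :
    0 < θ i := by
  refine lt_of_le_of_ne (h.nonneg i hi.le) fun h0 => ?_
  have := h.mul_eq i hi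
  rw [← h0, zero_mul] at this
  exact zero_ne_one this

theorem SlopeChain.isStaircase_stair {b : ℕ → ℕ} {θ : ℕ → ℝ} {n : ℕ} (h : SlopeChain b θ n)
    {F : ℤ → ℤ} (hF : IsStaircase (θ 0) F) : IsStaircase (θ n) (stair b F n) := by
  induction n with
  | zero => exact hF
  | succ n ih =>
    have ihn := ih (h.mono n.le_succ)
    have hpos := h.pos n.lt_succ_self
    have hspec := ihn.jumpIndex_spec hpos (h.le_one n n.le_succ)
    intro j k
    have h1 := ihn (jumpIndex (stair b F n) k) (jumpIndex (stair b F n) j - 1)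
    rw [(hspec k).1, (hspec j).2] at h1
    push_cast at h1
    have hm := h.mul_eq n n.lt_succ_self
    simp only [stair]
    push_cast
    refine lt_of_mul_lt_mul_left ?_ hpos.le
    linear_combination h1 + (k - j : ℝ) * hm

variable {b : ℕ → ℕ} {θ : ℕ → ℝ} {n : ℕ} {F : ℤ → ℤ}

theorem SlopeChain.stair_succ_eq_or (h : SlopeChain b θ n) (hF : IsStaircase (θ 0) F) (k : ℤ) :
    stair b F n (k + 1) = stair b F n k ∨ stair b F n (k + 1) = stair b F n k + 1 :=
  (h.isStaircase_stair hF).succ_eq_or (h.nonneg n le_rfl) (h.le_one n le_rfl) k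

theorem tileIndex_succ (k : ℤ) : tileIndex b F n (k + 1) =
    tileIndex b F n k + (b n + 1) + (stair b F (n + 1) (k + 1) - stair b F (n + 1) k) := by
  simp only [tileIndex, stair]
  ring

/-- Up to the jump, the letters inside a tile of the next level are `0 ^ b 1`. -/
theorem SlopeChain.stair_tileIndex_add (h : SlopeChain b θ (n + 1)) (hF : IsStaircase (θ 0) F)
    (k i : ℤ) (h0 : 0 ≤ i) (hi : i ≤ b n) : stair b F n (tileIndex b F n k + i) = k - 1 := by
  have hn := h.mono n.le_succ
  have hst := hn.isStaircase_stair hF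
  have hm := hst.mono (hn.nonneg n le_rfl) (hn.le_one n le_rfl)
  have hspec := hst.jumpIndex_spec (h.pos n.lt_succ_self) (hn.le_one n le_rfl)
  have hk := hspec k
  have hk' := hspec (k - 1)
  have hs := h.stair_succ_eq_or hF (k - 1)
  have ht := tileIndex_succ (b := b) (F := F) (n := n) (k - 1)
  rw [sub_add_cancel] at hs ht
  have h1 : jumpIndex (stair b F n) (k - 1) ≤ tileIndex b F n k + i := by
    simp only [tileIndex] at ht ⊢
    omega
  have h2 : tileIndex b F n k + i ≤ jumpIndex (stair b F n) k - 1 := by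
    simp only [tileIndex]
    omega
  have h3 := hm h1
  have h4 := hm h2
  omega

theorem SlopeChain.stair_tileIndex_jump (h : SlopeChain b θ (n + 1)) (hF : IsStaircase (θ 0) F)
    (k : ℤ) : stair b F n (tileIndex b F n k + b n + 1) = k := by
  have hn := h.mono n.le_succ
  have hspec := (hn.isStaircase_stair hF).jumpIndex_spec (h.pos n.lt_succ_self)
    (hn.le_one n le_rfl) k
  have : tileIndex b F n k + b n + 1 = jumpIndex (stair b F n) k := by
    simp only [tileIndex]
    ring
  rw [this, hspec.1]

/-- After the jump, the letters of the tile and of its successor are `0`, for another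
`b + 1` (long tile) or `b` (short tile) steps. -/
theorem SlopeChain.stair_tileIndex_after (h : SlopeChain b θ (n + 1)) (hF : IsStaircase (θ 0) F)
    (k i : ℤ) (h0 : 0 ≤ i)
    (hi : i ≤ b n + (stair b F (n + 1) (k + 1) - stair b F (n + 1) k)) :
    stair b F n (tileIndex b F n k + b n + 1 + i) = k := by
  rcases h.stair_succ_eq_or hF k with hs | hs
  · have := h.stair_tileIndex_add hF (k + 1) i h0 (by omega)
    rw [tileIndex_succ, hs] at this
    rw [show tileIndex b F n k + b n + 1 + i
      = tileIndex b F n k + (b n + 1) + (stair b F (n + 1) k - stair b F (n + 1) k) + i by ring,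
      this]
    ring
  · rcases h0.eq_or_lt with rfl | hpos
    · rw [add_zero, h.stair_tileIndex_jump hF]
    · have := h.stair_tileIndex_add hF (k + 1) (i - 1) (by omega) (by omega)
      rw [tileIndex_succ, hs] at this
      rw [show tileIndex b F n k + b n + 1 + i = tileIndex b F n k + (b n + 1)
        + (stair b F (n + 1) k + 1 - stair b F (n + 1) k) + (i - 1) by ring, this]
      ring

/-- The type of the `k`-th tile of level `n`: `0` for `A`, `1` for `B`. -/
def tileType (b : ℕ → ℕ) (F : ℤ → ℤ) (n : ℕ) (k : ℤ) : ℤ := stair b F n (k + 1) - stair b F n k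

theorem SlopeChain.tileType_eq_or (h : SlopeChain b θ n) (hF : IsStaircase (θ 0) F) (k : ℤ) :
    tileType b F n k = 0 ∨ tileType b F n k = 1 := by
  have := h.stair_succ_eq_or hF k
  simp only [tileType]
  omega

theorem tileIndex_succ' (k : ℤ) : tileIndex b F n (k + 1) =
    tileIndex b F n k + (b n + 1) + tileType b F (n + 1) k := tileIndex_succ k

theorem SlopeChain.tileType_tileIndex_add (h : SlopeChain b θ (n + 1))
    (hF : IsStaircase (θ 0) F) (k i : ℤ) (h0 : 0 ≤ i) (hi : i < b n) :
    tileType b F n (tileIndex b F n k + i) = 0 := by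
  rw [tileType, add_assoc, h.stair_tileIndex_add hF k (i + 1) (by omega) (by omega),
    h.stair_tileIndex_add hF k i h0 (by omega), sub_self]

theorem SlopeChain.tileType_tileIndex_jump (h : SlopeChain b θ (n + 1))
    (hF : IsStaircase (θ 0) F) (k : ℤ) : tileType b F n (tileIndex b F n k + b n) = 1 := by
  rw [tileType, h.stair_tileIndex_jump hF k,
    h.stair_tileIndex_add hF k (b n) (by omega) (by omega)]
  ring

theorem SlopeChain.tileType_tileIndex_after (h : SlopeChain b θ (n + 1))
    (hF : IsStaircase (θ 0) F) (k i : ℤ) (h0 : 0 ≤ i) (hi : i < b n + tileType b F (n + 1) k) :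
    tileType b F n (tileIndex b F n k + b n + 1 + i) = 0 := by
  unfold tileType at hi
  rw [tileType, add_assoc _ i 1, h.stair_tileIndex_after hF k (i + 1) (by omega) (by omega),
    h.stair_tileIndex_after hF k i h0 (by omega), sub_self]

theorem SlopeChain.tileIndex_strictMono (h : SlopeChain b θ (n + 1)) (hF : IsStaircase (θ 0) F) :
    StrictMono (tileIndex b F n) :=
  strictMono_int_of_lt_succ fun k => by
    have := h.tileType_eq_or hF k
    have := tileIndex_succ' (b := b) (F := F) (n := n) k
    omega

theorem tileLen_pos (b : ℕ → ℕ) (n : ℕ) :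
    0 < (tileLen b n).1 ∧ (tileLen b n).1 ≤ (tileLen b n).2 := by
  induction n with
  | zero => simp [tileLen]
  | succ n ih =>
    simp only [tileLen]
    constructor <;> nlinarith [Nat.zero_le (b n * (tileLen b n).1)]

theorem tileLen_lt (b : ℕ → ℕ) (n : ℕ) : (tileLen b (n + 1)).1 < (tileLen b (n + 1)).2 := by
  have := tileLen_pos b n
  simp only [tileLen]; omega

theorem tileStart_add_of_tileType (b : ℕ → ℕ) (F : ℤ → ℤ) (n : ℕ) (K : ℤ) (m : ℕ)
    (hs : ∀ k, tileStart b F n (k + 1) = tileStart b F n k + (tileLen b n).1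
      + tileType b F n k * ((tileLen b n).2 - (tileLen b n).1))
    (h0 : ∀ i : ℤ, 0 ≤ i → i < m → tileType b F n (K + i) = 0) :
    tileStart b F n (K + m) = tileStart b F n K + m * (tileLen b n).1 := by
  induction m with
  | zero => simp
  | succ m ih =>
    push_cast at h0 ⊢
    rw [← add_assoc, hs, ih fun i hi hm => h0 i hi (by omega), h0 m (by omega) (by omega)]
    ring

theorem SlopeChain.tileStart_succ (h : SlopeChain b θ n) (hF : IsStaircase (θ 0) F) (k : ℤ) :
    tileStart b F n (k + 1) = tileStart b F n k + (tileLen b n).1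
      + tileType b F n k * ((tileLen b n).2 - (tileLen b n).1) := by
  induction n generalizing k with
  | zero => simp [tileStart, tileLen]
  | succ n ih =>
    have ihn := ih (h.mono n.le_succ)
    simp only [tileStart]
    have h1 := tileStart_add_of_tileType b F n (tileIndex b F n k) (b n) ihn
      fun i h0 hi => h.tileType_tileIndex_add hF k i h0 hi
    have h2 := ihn (tileIndex b F n k + b n)
    rw [h.tileType_tileIndex_jump hF, h1] at h2
    rcases h.tileType_eq_or hF k with hk | hk
    · rw [tileIndex_succ', hk, add_zero, ← add_assoc, h2]
      simp only [tileLen]; push_cast; ring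
    · have h3 := h.tileType_tileIndex_after hF k 0 le_rfl (by omega)
      have h4 := ihn (tileIndex b F n k + b n + 1)
      rw [add_zero] at h3
      rw [h3, h2] at h4
      rw [tileIndex_succ', hk, ← add_assoc, h4]
      simp only [tileLen]; push_cast; ring

theorem SlopeChain.tileStart_strictMono (h : SlopeChain b θ n) (hF : IsStaircase (θ 0) F) :
    StrictMono (tileStart b F n) :=
  strictMono_int_of_lt_succ fun k => by
    have h1 := h.tileStart_succ hF k
    have h2 := tileLen_pos b n
    rcases h.tileType_eq_or hF k with hk | hk <;> rw [hk] at h1 <;> omega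

theorem exists_mem_step {g : ℤ → ℤ} (hg : StrictMono g) (p : ℤ) : ∃ k, g k ≤ p ∧ p < g (k + 1) := by
  have hub : ∀ k : ℕ, g 0 + k ≤ g k ∧ g (-k) ≤ g 0 - k := by
    intro k
    induction k with
    | zero => simp
    | succ k ih =>
      have h1 := hg (show (k : ℤ) < k + 1 by omega)
      have h2 := hg (show -((k : ℤ) + 1) < -k by omega)
      push_cast
      omega
  obtain ⟨k, hk, hmax⟩ := Int.exists_greatest_of_bdd (P := fun k => g k ≤ p)
    ⟨(p - g 0).toNat + 1, fun z hz => by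
      by_contra hlt
      push Not at hlt
      have h1 := (hub ((p - g 0).toNat + 1)).1
      push_cast at h1
      have h2 := hg hlt
      omega⟩
    ⟨-((g 0 - p).toNat : ℤ), by have h1 := (hub (g 0 - p).toNat).2; omega⟩
  exact ⟨k, hk, by by_contra hlt; have := hmax (k + 1) (by omega); omega⟩

/-! ### The words carried by the tiles -/

/-- The content of a run of `m` tiles is determined by their types; if all tile starts are
followed by the same `c` letters, these may be appended. -/
theorem SlopeChain.increment_eq_of_tileType (h : SlopeChain b θ n) (hF : IsStaircase (θ 0) F)
    {c : ℤ}
    (hsame : ∀ k k', tileType b F n k = tileType b F n k' → ∀ r : ℤ, 0 ≤ r →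
      r < tileStart b F n (k + 1) - tileStart b F n k →
      tileType b F 0 (tileStart b F n k + r) = tileType b F 0 (tileStart b F n k' + r))
    (hpre : ∀ k k', ∀ r : ℤ, 0 ≤ r → r < c →
      tileType b F 0 (tileStart b F n k + r) = tileType b F 0 (tileStart b F n k' + r))
    (m : ℕ) (K K' : ℤ)
    (ht : ∀ i : ℤ, 0 ≤ i → i < m → tileType b F n (K + i) = tileType b F n (K' + i)) :
    ∀ r : ℤ, 0 ≤ r → r < tileStart b F n (K + m) - tileStart b F n K + c →
      tileType b F 0 (tileStart b F n K + r) = tileType b F 0 (tileStart b F n K' + r) := by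
  induction m generalizing K K' with
  | zero =>
    intro r h0 hr
    simp only [Nat.cast_zero, add_zero, sub_self, zero_add] at hr
    exact hpre K K' r h0 hr
  | succ m ih =>
    intro r h0 hr
    have h1 := h.tileStart_succ hF K
    have h2 := h.tileStart_succ hF K'
    have h00 := ht 0 le_rfl (by omega)
    simp only [add_zero] at h00
    rw [← h00] at h2
    by_cases hlt : r < tileStart b F n (K + 1) - tileStart b F n K
    · exact hsame K K' h00 r h0 hlt
    · have := ih (K + 1) (K' + 1) (fun i hi him => by
        have := ht (1 + i) (by omega) (by push_cast; omega)
        rwa [← add_assoc, ← add_assoc] at this)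
        (r - (tileStart b F n (K + 1) - tileStart b F n K)) (by omega) (by
          push_cast at hr
          rw [show K + 1 + (m : ℤ) = K + (m + 1) by ring]
          omega)
      convert this using 2 <;> omega

/-- Tiles of the same type carry the same word, and any two tile starts of level `n` are followed
by the same `|A| + |B| - 2` letters. -/
theorem SlopeChain.increment_eq (h : SlopeChain b θ n) (hF : IsStaircase (θ 0) F) :
    (∀ k k', tileType b F n k = tileType b F n k' → ∀ r : ℤ, 0 ≤ r →
      r < tileStart b F n (k + 1) - tileStart b F n k →
      tileType b F 0 (tileStart b F n k + r) = tileType b F 0 (tileStart b F n k' + r)) ∧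
    (∀ k k', ∀ r : ℤ, 0 ≤ r → r < (tileLen b n).1 + (tileLen b n).2 - 2 →
      tileType b F 0 (tileStart b F n k + r) = tileType b F 0 (tileStart b F n k' + r)) := by
  induction n with
  | zero =>
    refine ⟨fun k k' hk r h0 hr => ?_, fun k k' r h0 hr => ?_⟩
    · have : r = 0 := by simp only [tileStart] at hr; omega
      simpa [this, tileStart] using hk
    · simp only [tileLen] at hr; omega
  | succ n ih =>
    have hn := h.mono n.le_succ
    have ihn := ih hn
    have key := fun (c : ℤ) => hn.increment_eq_of_tileType hF (c := c) ihn.1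
    -- the first `2 b + 1` letters after the start of a tile are `0 ^ b 1 0 ^ b`
    have htypes : ∀ k k' i : ℤ, 0 ≤ i → i < 2 * b n + 1 →
        tileType b F n (tileIndex b F n k + i) = tileType b F n (tileIndex b F n k' + i) := by
      have : ∀ k i : ℤ, 0 ≤ i → i < 2 * b n + 1 →
          tileType b F n (tileIndex b F n k + i) = if i = b n then 1 else 0 := by
        intro k i h0 hi
        split_ifs with hib
        · rw [hib, h.tileType_tileIndex_jump hF]
        · by_cases hlt : i < b n
          · exact h.tileType_tileIndex_add hF k i h0 hlt
          · have := h.tileType_tileIndex_after hF k (i - b n - 1) (by omega)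
              (by have := h.tileType_eq_or hF k; omega)
            rwa [show tileIndex b F n k + b n + 1 + (i - b n - 1) = tileIndex b F n k + i by ring]
              at this
      intro k k' i h0 hi
      rw [this k i h0 hi, this k' i h0 hi]
    refine ⟨fun k k' hk r h0 hr => ?_, fun k k' r h0 hr => ?_⟩
    · have ht := h.tileType_eq_or hF k
      refine key 0 (fun _ _ r h0 hr => by omega)
        (b n + 1 + (tileType b F (n + 1) k).toNat) (tileIndex b F n k) (tileIndex b F n k')
        (fun i h0 hi => ?_) r h0 ?_
      · push_cast at hi
        by_cases hib : i ≤ b n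
        · exact htypes k k' i h0 (by omega)
        · have hi' : i = b n + 1 := by omega
          have h1 := h.tileType_tileIndex_after hF k 0 le_rfl (by omega)
          have h2 := h.tileType_tileIndex_after hF k' 0 le_rfl (by omega)
          rw [hi', ← add_assoc, ← add_assoc, ← add_zero (_ + 1),
            ← add_zero (tileIndex b F n k' + _ + 1),
            h1, h2]
      · simp only [tileStart] at hr
        rw [tileIndex_succ'] at hr
        push_cast
        rw [add_zero, show ((tileType b F (n + 1) k).toNat : ℤ) = tileType b F (n + 1) k by omega,
          ← add_assoc (tileIndex b F n k)]
        exact hr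
    · refine key _ ihn.2 (2 * b n + 1) (tileIndex b F n k) (tileIndex b F n k')
        (fun i h0 hi => htypes k k' i h0 (by push_cast at hi; omega)) r h0 ?_
      have hs := hn.tileStart_succ hF
      have h1 := tileStart_add_of_tileType b F n (tileIndex b F n k) (b n) hs
        fun i h0 hi => h.tileType_tileIndex_add hF k i h0 hi
      have h2 := hs (tileIndex b F n k + b n)
      rw [h.tileType_tileIndex_jump hF, h1] at h2
      have h3 := tileStart_add_of_tileType b F n (tileIndex b F n k + b n + 1) (b n) hs
        fun i h0 hi => h.tileType_tileIndex_after hF k i h0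
          (by have := h.tileType_eq_or hF k; omega)
      rw [h2] at h3
      rw [show tileIndex b F n k + ((2 * b n + 1 : ℕ) : ℤ) = tileIndex b F n k + b n + 1 + b n by
        push_cast; ring, h3]
      simp only [tileLen] at hr
      push_cast at hr
      linarith

/-- Around every site, on one of any three consecutive levels, the word after the site begins with
the square of a cyclic shift of a tile: the site lies in a tile at offset `i` small enough for the
common prefix of the tile starts to cover it. -/
theorem SlopeChain.exists_square (h : SlopeChain b θ (n + 3)) (hF : IsStaircase (θ 0) F) (j : ℤ) :
    ∃ m, n + 1 ≤ m ∧ m ≤ n + 3 ∧ ∃ k, tileStart b F m k ≤ j ∧ j < tileStart b F m (k + 1) ∧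
      (j - tileStart b F m k) + (tileStart b F m (k + 1) - tileStart b F m k)
        ≤ (tileLen b m).1 + (tileLen b m).2 - 2 := by
  by_contra hcon
  push Not at hcon
  -- a failure forces a long tile and an offset of at least `|A| - 1`
  have fail : ∀ m, n + 1 ≤ m → m ≤ n + 3 → ∀ k, tileStart b F m k ≤ j →
      j < tileStart b F m (k + 1) →
      tileType b F m k = 1 ∧ (tileLen b m).1 - 1 ≤ j - tileStart b F m k := by
    intro m h1 h2 k hk hk'
    have hc := hcon m h1 h2 k hk hk'
    have hs := (h.mono h2).tileStart_succ hF k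
    obtain ⟨m', rfl⟩ : ∃ m', m = m' + 1 := ⟨m - 1, by omega⟩
    have hl := tileLen_lt b m'
    rcases (h.mono h2).tileType_eq_or hF k with ht | ht
    · rw [ht] at hs
      omega
    · rw [ht] at hs
      exact ⟨ht, by omega⟩
  -- going up one level, a long tile is the tile of index `b` inside its parent
  have up : ∀ m, m + 1 ≤ n + 3 → ∀ k, tileStart b F m k ≤ j → j < tileStart b F m (k + 1) →
      tileType b F m k = 1 → ∃ k', tileStart b F (m + 1) k' ≤ j ∧
        j < tileStart b F (m + 1) (k' + 1) ∧
        j - tileStart b F (m + 1) k' = b m * (tileLen b m).1 + (j - tileStart b F m k) := by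
    intro m hm k hk hk' ht
    have hm1 := h.mono hm
    have hm0 := hm1.mono m.le_succ
    obtain ⟨k', hle, hlt⟩ := exists_mem_step (hm1.tileIndex_strictMono hF) k
    have hk'b : k = tileIndex b F m k' + b m := by
      rw [tileIndex_succ'] at hlt
      have h1 := hm1.tileType_eq_or hF k'
      by_contra hne
      by_cases hlt' : k - tileIndex b F m k' < b m
      · have := hm1.tileType_tileIndex_add hF k' (k - tileIndex b F m k') (by omega) hlt'
        rw [add_sub_cancel] at this
        omega
      · have := hm1.tileType_tileIndex_after hF k' 0 le_rfl (by omega)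
        rw [add_zero, show tileIndex b F m k' + b m + 1 = k by omega] at this
        omega
    have h1 := tileStart_add_of_tileType b F m (tileIndex b F m k') (b m)
      (hm0.tileStart_succ hF) fun i h0 hi => hm1.tileType_tileIndex_add hF k' i h0 hi
    refine ⟨k', ?_, ?_, ?_⟩
    · exact ((hm0.tileStart_strictMono hF).monotone hle).trans hk
    · exact hk'.trans_le ((hm0.tileStart_strictMono hF).monotone (by omega))
    · rw [hk'b, h1]
      simp only [tileStart]
      ring
  obtain ⟨k, hk, hk'⟩ := exists_mem_step
    ((h.mono (show n + 1 ≤ n + 3 by omega)).tileStart_strictMono hF) j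
  have f0 := fail (n + 1) le_rfl (by omega) k hk hk'
  obtain ⟨k1, hk1, hk1', e1⟩ := up (n + 1) (by omega) k hk hk' f0.1
  have f1 := fail (n + 2) (by omega) (by omega) k1 hk1 hk1'
  obtain ⟨k2, hk2, hk2', e2⟩ := up (n + 2) (by omega) k1 hk1 hk1' f1.1
  have f2 := fail (n + 3) (by omega) (by omega) k2 hk2 hk2'
  have hs := (h.mono (show n + 1 ≤ n + 3 by omega)).tileStart_succ hF k
  rw [f0.1] at hs
  have hp := tileLen_pos b (n + 1)
  have e3 : (tileLen b (n + 2)).1 = b (n + 1) * (tileLen b (n + 1)).1 + (tileLen b (n + 1)).2 := rfl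
  have e4 : (tileLen b (n + 2)).2 = (tileLen b (n + 2)).1 + (tileLen b (n + 1)).1 := rfl
  have e5 : (tileLen b (n + 3)).1 = b (n + 2) * (tileLen b (n + 2)).1 + (tileLen b (n + 2)).2 := rfl
  have f12 := f1.2
  have f22 := f2.2
  zify at e3 e4 e5 hp
  rw [e1, e3] at f12
  rw [e2, e1, e5, e4] at f22
  linarith

/-! ### Transfer matrices of the tiles -/

/-- The `ℓ`-step transfer matrix from the site `i`: it maps `(u i, u (i - 1))` to
`(u (i + ℓ), u (i + ℓ - 1))` for the solutions `u` of `u (m + 1) + u (m - 1) + V m u m = E u m`. -/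
def transfer (V : ℤ → ℂ) (E : ℂ) (i : ℤ) : ℕ → Matrix (Fin 2) (Fin 2) ℂ
  | 0 => 1
  | l + 1 => !![E - V (i + l), -1; 1, 0] * transfer V E i l

theorem transfer_add (V : ℤ → ℂ) (E : ℂ) (i : ℤ) (l m : ℕ) :
    transfer V E i (l + m) = transfer V E (i + l) m * transfer V E i l := by
  induction m with
  | zero => simp [transfer]
  | succ m ih =>
    rw [← add_assoc, transfer, ih, transfer, Matrix.mul_assoc]
    push_cast
    rw [add_assoc]

theorem transfer_congr {V V' : ℤ → ℂ} {E : ℂ} {i i' : ℤ} {l : ℕ}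
    (h : ∀ r : ℤ, 0 ≤ r → r < l → V (i + r) = V' (i' + r)) :
    transfer V E i l = transfer V' E i' l := by
  induction l with
  | zero => rfl
  | succ l ih =>
    rw [transfer, transfer, ih fun r h0 hr => h r h0 (by push_cast; omega),
      h l (by omega) (by push_cast; omega)]

theorem det_transfer (V : ℤ → ℂ) (E : ℂ) (i : ℤ) (l : ℕ) : (transfer V E i l).det = 1 := by
  induction l with
  | zero => simp [transfer]
  | succ l ih => rw [transfer, Matrix.det_mul, ih]; simp [Matrix.det_fin_two]

/-- The matrices `(A n, C n)` at the energy `E` and coupling `lam`: `A n` and `C n * A n` are the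
transfer matrices of the two tiles of level `n`. -/
def tileMat (b : ℕ → ℕ) (lam E : ℂ) : ℕ → Matrix (Fin 2) (Fin 2) ℂ × Matrix (Fin 2) (Fin 2) ℂ
  | 0 => (!![E, -1; 1, 0], !![1, -lam; 0, 1])
  | n + 1 => ((tileMat b lam E n).2 * (tileMat b lam E n).1 ^ (b n + 1), (tileMat b lam E n).1)

/-- The potential `lam * (F (m + 1) - F m)` of a staircase. -/
def stairPotential (lam : ℂ) (F : ℤ → ℤ) (m : ℤ) : ℂ := lam * ((F (m + 1) - F m : ℤ) : ℂ)

theorem det_tileMat (b : ℕ → ℕ) (lam E : ℂ) (n : ℕ) :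
    (tileMat b lam E n).1.det = 1 ∧ (tileMat b lam E n).2.det = 1 := by
  induction n with
  | zero => simp [tileMat, Matrix.det_fin_two]
  | succ n ih => simp [tileMat, Matrix.det_mul, Matrix.det_pow, ih]

variable {b : ℕ → ℕ} {θ : ℕ → ℝ} {n : ℕ} {F : ℤ → ℤ}

theorem transfer_tiles_of_tileType (V : ℤ → ℂ) (E : ℂ) (A : Matrix (Fin 2) (Fin 2) ℂ)
    (K : ℤ) (m : ℕ)
    (hs : ∀ k, tileStart b F n (k + 1) = tileStart b F n k + (tileLen b n).1
      + tileType b F n k * ((tileLen b n).2 - (tileLen b n).1))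
    (h0 : ∀ i : ℤ, 0 ≤ i → i < m → tileType b F n (K + i) = 0)
    (hA : ∀ k, tileType b F n k = 0 →
      transfer V E (tileStart b F n k) (tileLen b n).1 = A) :
    transfer V E (tileStart b F n K) (m * (tileLen b n).1) = A ^ m := by
  induction m with
  | zero => simp [transfer]
  | succ m ih =>
    have h0' : ∀ i : ℤ, 0 ≤ i → i < m → tileType b F n (K + i) = 0 :=
      fun i hi him => h0 i hi (by push_cast; omega)
    have hst := tileStart_add_of_tileType b F n K m hs h0'
    rw [add_mul, one_mul, transfer_add, ih h0', pow_succ']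
    push_cast
    rw [← hst, hA _ (h0 m (by omega) (by push_cast; omega))]

theorem SlopeChain.transfer_tile (h : SlopeChain b θ n) (hF : IsStaircase (θ 0) F) (lam E : ℂ)
    (k : ℤ) :
    (tileType b F n k = 0 → transfer (stairPotential lam F) E (tileStart b F n k) (tileLen b n).1
      = (tileMat b lam E n).1) ∧
    (tileType b F n k = 1 → transfer (stairPotential lam F) E (tileStart b F n k) (tileLen b n).2
      = (tileMat b lam E n).2 * (tileMat b lam E n).1) := by
  induction n generalizing k with
  | zero =>
    simp only [tileType, stair]
    constructor <;> intro hk <;>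
      simp [tileStart, tileLen, transfer, tileMat, stairPotential, hk, sub_eq_add_neg]
  | succ n ih =>
    have hn := h.mono n.le_succ
    have ihn := ih hn
    have hs := hn.tileStart_succ hF
    have h0 : ∀ i : ℤ, 0 ≤ i → i < b n → tileType b F n (tileIndex b F n k + i) = 0 :=
      fun i h0 hi => h.tileType_tileIndex_add hF k i h0 hi
    have h1 := tileStart_add_of_tileType b F n (tileIndex b F n k) (b n) hs h0
    have h2 := hs (tileIndex b F n k + b n)
    rw [h.tileType_tileIndex_jump hF, h1] at h2
    have p1 := transfer_tiles_of_tileType (stairPotential lam F) E (tileMat b lam E n).1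
      (tileIndex b F n k) (b n) hs h0 fun k hk => (ihn k).1 hk
    have p2 := (ihn (tileIndex b F n k + b n)).2 (h.tileType_tileIndex_jump hF k)
    rw [h1] at p2
    have p3 : transfer (stairPotential lam F) E (tileStart b F n (tileIndex b F n k))
        (tileLen b (n + 1)).1 = (tileMat b lam E (n + 1)).1 := by
      simp only [tileLen, tileMat]
      rw [transfer_add, p1]
      push_cast
      rw [p2, pow_succ', Matrix.mul_assoc]
    refine ⟨fun _ => p3, fun hk => ?_⟩
    have h3 := h.tileType_tileIndex_after hF k 0 le_rfl (by omega)
    rw [add_zero] at h3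
    have p4 := (ihn _).1 h3
    have e1 : tileStart b F n (tileIndex b F n k + b n + 1)
        = tileStart b F n (tileIndex b F n k) + (tileLen b (n + 1)).1 := by
      rw [h2]; simp only [tileLen]; push_cast; ring
    rw [show (tileLen b (n + 1)).2 = (tileLen b (n + 1)).1 + (tileLen b n).1 from rfl, transfer_add]
    simp only [tileStart]
    rw [p3, ← e1, p4]
    rfl

/-! ### The trace map -/

theorem mul_self_of_det_eq_one {A : Matrix (Fin 2) (Fin 2) ℂ} (hA : A.det = 1) :
    A * A = A.trace • A - 1 := by
  rw [Matrix.det_fin_two] at hA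
  ext i j
  fin_cases i <;> fin_cases j <;>
    simp [Matrix.mul_apply, Fin.sum_univ_two, Matrix.trace_fin_two] <;>
    first | ring1 | linear_combination -hA

/-- The traces `tr (C n * A n ^ k)`. -/
def trC (b : ℕ → ℕ) (lam E : ℂ) (n k : ℕ) : ℂ :=
  ((tileMat b lam E n).2 * (tileMat b lam E n).1 ^ k).trace

/-- The traces `tr (A n)`. -/
def trA (b : ℕ → ℕ) (lam E : ℂ) (n : ℕ) : ℂ := (tileMat b lam E n).1.trace

variable (b) (lam E : ℂ) (n : ℕ)

theorem trC_add_two (k : ℕ) :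
    trC b lam E n (k + 2) = trA b lam E n * trC b lam E n (k + 1) - trC b lam E n k := by
  simp only [trC, trA]
  rw [pow_add, pow_two, mul_self_of_det_eq_one (det_tileMat b lam E n).1, pow_succ]
  simp [mul_sub, Matrix.trace_sub, Matrix.trace_smul]

theorem trA_succ : trA b lam E (n + 1) = trC b lam E n (b n + 1) := rfl

theorem trC_succ_zero : trC b lam E (n + 1) 0 = trA b lam E n := by
  simp [trC, trA, tileMat]

theorem trC_succ_one : trC b lam E (n + 1) 1 = trC b lam E n (b n + 2) := by
  simp only [trC, tileMat, pow_one]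
  rw [Matrix.trace_mul_comm, Matrix.mul_assoc, ← pow_succ]

/-- The Fricke–Vogt invariant of the trace map. -/
theorem trace_invariant (k : ℕ) :
    trA b lam E n ^ 2 + trC b lam E n k ^ 2 + trC b lam E n (k + 1) ^ 2
      - trA b lam E n * trC b lam E n k * trC b lam E n (k + 1) = 4 + lam ^ 2 := by
  have step : ∀ n, (trA b lam E n ^ 2 + trC b lam E n 0 ^ 2 + trC b lam E n 1 ^ 2
      - trA b lam E n * trC b lam E n 0 * trC b lam E n 1 = 4 + lam ^ 2) → ∀ k,
      trA b lam E n ^ 2 + trC b lam E n k ^ 2 + trC b lam E n (k + 1) ^ 2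
      - trA b lam E n * trC b lam E n k * trC b lam E n (k + 1) = 4 + lam ^ 2 := by
    intro n h0 k
    induction k with
    | zero => exact h0
    | succ k ih => rw [trC_add_two]; linear_combination ih
  refine step n ?_ k
  induction n with
  | zero =>
    simp [trA, trC, tileMat, Matrix.trace_fin_two]
    ring
  | succ n ih =>
    have := step n ih (b n + 1)
    rw [trC_succ_zero, trC_succ_one, trA_succ]
    linear_combination this

/-- The escape condition of the trace map. Once it holds, it holds at every later level, so that all
the traces `tr (A m)`, `m ≥ n`, have modulus larger than `2` (`Escapes.two_lt_trA`). -/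
def Escapes (k : ℕ) : Prop :=
  k ≤ b n ∧ 2 < ‖trA b lam E n‖ ∧ 2 < ‖trC b lam E n (k + 1)‖ ∧
    ‖trC b lam E n k‖ < ‖trC b lam E n (k + 1)‖

variable {b lam E n}

theorem norm_trC_add_two_ge (k : ℕ) :
    ‖trA b lam E n‖ * ‖trC b lam E n (k + 1)‖ - ‖trC b lam E n k‖ ≤ ‖trC b lam E n (k + 2)‖ := by
  rw [trC_add_two, ← norm_mul]
  exact norm_sub_norm_le _ _

theorem Escapes.trC_lt {k : ℕ} (h : Escapes b lam E n k) (j : ℕ) :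
    ‖trC b lam E n (k + j)‖ < ‖trC b lam E n (k + j + 1)‖ := by
  induction j with
  | zero => exact h.2.2.2
  | succ j ih =>
    have h1 := norm_trC_add_two_ge (b := b) (lam := lam) (E := E) (n := n) (k + j)
    have h2 := h.2.1
    have h3 := norm_nonneg (trC b lam E n (k + j))
    rw [show k + (j + 1) = k + j + 1 by ring]
    change _ < ‖trC b lam E n (k + j + 2)‖
    nlinarith

theorem Escapes.succ {k : ℕ} (h : Escapes b lam E n k) : Escapes b lam E (n + 1) 0 := by
  have hx := h.2.1
  obtain ⟨d, hd⟩ := Nat.exists_eq_add_of_le h.1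
  have hlt := h.trC_lt d
  rw [← hd] at hlt
  have h2 : 2 < ‖trC b lam E n (b n + 1)‖ := by
    have hmono : ∀ j, 2 < ‖trC b lam E n (k + j + 1)‖ := by
      intro j
      induction j with
      | zero => exact h.2.2.1
      | succ j ih => exact ih.trans (h.trC_lt (j + 1))
    rw [hd]
    exact hmono d
  have h3 := norm_trC_add_two_ge (b := b) (lam := lam) (E := E) (n := n) (b n)
  have h4 : ‖trA b lam E n‖ < ‖trC b lam E n (b n + 2)‖ := by nlinarith
  refine ⟨Nat.zero_le _, ?_, ?_, ?_⟩
  · rwa [trA_succ]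
  · rw [zero_add, trC_succ_one]; exact hx.trans h4
  · rwa [zero_add, trC_succ_one, trC_succ_zero]

theorem Escapes.two_lt_trA {k : ℕ} (h : Escapes b lam E n k) (m : ℕ) :
    2 < ‖trA b lam E (n + m)‖ := by
  suffices ∃ k, Escapes b lam E (n + m) k by
    obtain ⟨k, hk⟩ := this
    exact hk.2.1
  induction m with
  | zero => exact ⟨k, h⟩
  | succ m ih => exact ⟨0, ih.choose_spec.succ⟩

/-- Without escape, a trace `tr (A n)` outside the disc of radius `2` has all the neighbouring
traces inside it. -/
theorem trC_le_two_of_not_escapes (h : ∀ n k, ¬ Escapes b lam E n k) (n : ℕ)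
    (hx : 2 < ‖trA b lam E n‖) : ∀ k ≤ b n + 1, ‖trC b lam E n k‖ ≤ 2 := by
  have step : ∀ n, 2 < ‖trA b lam E n‖ → ‖trC b lam E n 0‖ ≤ 2 →
      ∀ k ≤ b n + 1, ‖trC b lam E n k‖ ≤ 2 := by
    intro n hx h0 k hk
    induction k with
    | zero => exact h0
    | succ k ih =>
      by_contra hlt
      push Not at hlt
      exact h n k ⟨by omega, hx, hlt, (ih (by omega)).trans_lt hlt⟩
  induction n with
  | zero => exact step 0 hx (by simp [trC, tileMat, Matrix.trace_fin_two]; norm_num)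
  | succ n ih =>
    refine step (n + 1) hx ?_
    rw [trC_succ_zero]
    by_contra hlt
    push Not at hlt
    have := ih hlt (b n + 1) le_rfl
    rw [← trA_succ] at this
    exact absurd hx this.not_gt

/-- A bound for the traces of bounded orbits of the trace map. -/
def traceBound (r : ℝ) : ℝ := 5 * (7 + r) ^ 3

/-- Without escape the traces are bounded: when `tr (A n)` is large, `tr (C n)` and
`tr (C n * A n)` have modulus at most `2`, and then the invariant bounds `tr (A n)`; the other
traces follow from the invariant and the recursion. -/
theorem trace_le_of_not_escapes (h : ∀ n k, ¬ Escapes b lam E n k) (n : ℕ) :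
    ‖trA b lam E n‖ ≤ traceBound ‖lam‖ ∧ ‖trC b lam E n 1‖ ≤ traceBound ‖lam‖ ∧
      ‖trC b lam E n 2‖ ≤ traceBound ‖lam‖ := by
  have hr := norm_nonneg lam
  set r := ‖lam‖ with hrdef
  have hA : ∀ n, ‖trA b lam E n‖ ≤ 7 + r := by
    intro n
    by_contra hlt
    push Not at hlt
    have h0 := trC_le_two_of_not_escapes h n (by linarith) 0 (by omega)
    have h1 := trC_le_two_of_not_escapes h n (by linarith) 1 (by omega)
    have hinv := trace_invariant b lam E n 0
    have hnorm : ‖trA b lam E n‖ ^ 2 ≤ 4 + r ^ 2 + ‖trA b lam E n‖ * 2 * 2 + 2 ^ 2 + 2 ^ 2 := by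
      calc ‖trA b lam E n‖ ^ 2 = ‖4 + lam ^ 2 + trA b lam E n * trC b lam E n 0 * trC b lam E n 1
            - trC b lam E n 0 ^ 2 - trC b lam E n 1 ^ 2‖ := by
            rw [← norm_pow]; congr 1; linear_combination hinv
        _ ≤ ‖(4 : ℂ)‖ + ‖lam ^ 2‖ + ‖trA b lam E n * trC b lam E n 0 * trC b lam E n 1‖
            + ‖trC b lam E n 0 ^ 2‖ + ‖trC b lam E n 1 ^ 2‖ :=
            (norm_sub_le _ _).trans (add_le_add_left ((norm_sub_le _ _).trans (add_le_add_left
              ((norm_add_le _ _).trans (add_le_add_left (norm_add_le _ _) _)) _)) _)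
        _ ≤ _ := by
            rw [show ‖(4 : ℂ)‖ = 4 by simp]
            simp only [norm_mul, norm_pow]
            gcongr
    nlinarith
  have hC0 : ‖trC b lam E n 0‖ ≤ 7 + r := by
    cases n with
    | zero => simp [trC, tileMat, Matrix.trace_fin_two]; norm_num; linarith
    | succ n => rw [trC_succ_zero]; exact hA n
  have hAn := hA n
  have hC1 : ‖trC b lam E n 1‖ ≤ 4 * (7 + r) ^ 2 := by
    by_contra hlt
    push Not at hlt
    have hinv := trace_invariant b lam E n 0
    have hnorm : ‖trC b lam E n 1‖ ^ 2 ≤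
        4 + r ^ 2 + (7 + r) * (7 + r) * ‖trC b lam E n 1‖ + (7 + r) ^ 2 + (7 + r) ^ 2 := by
      calc ‖trC b lam E n 1‖ ^ 2 = ‖4 + lam ^ 2 + trA b lam E n * trC b lam E n 0 * trC b lam E n 1
            - trC b lam E n 0 ^ 2 - trA b lam E n ^ 2‖ := by
            rw [← norm_pow]; congr 1; linear_combination hinv
        _ ≤ ‖(4 : ℂ)‖ + ‖lam ^ 2‖ + ‖trA b lam E n * trC b lam E n 0 * trC b lam E n 1‖
            + ‖trC b lam E n 0 ^ 2‖ + ‖trA b lam E n ^ 2‖ :=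
            (norm_sub_le _ _).trans (add_le_add_left ((norm_sub_le _ _).trans (add_le_add_left
              ((norm_add_le _ _).trans (add_le_add_left (norm_add_le _ _) _)) _)) _)
        _ ≤ _ := by
            rw [show ‖(4 : ℂ)‖ = 4 by simp]
            simp only [norm_mul, norm_pow]
            gcongr
    nlinarith [mul_nonneg hr hr, mul_pos (show (0 : ℝ) < 7 + r by linarith)
      (show (0 : ℝ) < 7 + r by linarith)]
  have hC2 : ‖trC b lam E n 2‖ ≤ (7 + r) * (4 * (7 + r) ^ 2) + (7 + r) := by
    rw [trC_add_two]
    refine (norm_sub_le _ _).trans ?_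
    rw [norm_mul, zero_add]
    gcongr
  unfold traceBound
  refine ⟨hAn.trans ?_, hC1.trans ?_, hC2.trans ?_⟩ <;>
    nlinarith [mul_nonneg hr hr, pow_nonneg hr 3]

/-! ### Self-adjoint operators and bounds from below -/

section SelfAdjoint

variable {H : Type*} [NormedAddCommGroup H] [InnerProductSpace ℂ H] [CompleteSpace H]
  {T : H →L[ℂ] H}

theorem isSelfAdjoint_sub_real (hT : IsSelfAdjoint T) (E : ℝ) :
    IsSelfAdjoint (T - algebraMap ℂ (H →L[ℂ] H) E) := by
  refine hT.sub ?_
  rw [isSelfAdjoint_iff, ← algebraMap_star_comm]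
  simp

theorem notMem_spectrum_of_bounded_below (hT : IsSelfAdjoint T) {E c : ℝ} (hc : 0 < c)
    (h : ∀ ψ, c * ‖ψ‖ ≤ ‖T ψ - (E : ℂ) • ψ‖) : (E : ℂ) ∉ spectrum ℂ T := by
  have hS := isSelfAdjoint_sub_real hT E
  have happ : ∀ ψ, (T - algebraMap ℂ (H →L[ℂ] H) E) ψ = T ψ - (E : ℂ) • ψ := fun ψ => by
    simp [Algebra.algebraMap_eq_smul_one]
  set S := T - algebraMap ℂ (H →L[ℂ] H) E with hSdef
  have hanti : AntilipschitzWith (Real.toNNReal c)⁻¹ S := by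
    refine S.antilipschitz_of_bound fun x => ?_
    rw [NNReal.coe_inv, Real.coe_toNNReal c hc.le, inv_mul_eq_div, le_div_iff₀ hc, mul_comm, happ]
    exact h x
  rw [spectrum.notMem_iff, IsUnit.sub_iff, ← hSdef, ContinuousLinearMap.isUnit_iff_bijective,
    ContinuousLinearMap.bijective_iff_dense_range_and_antilipschitz]
  refine ⟨?_, _, hanti⟩
  rw [Submodule.topologicalClosure_eq_top_iff, ContinuousLinearMap.orthogonal_range,
    hS.adjoint_eq]
  exact LinearMap.ker_eq_bot.2 hanti.injective

/-- A spectral gap of radius `δ` around `E` bounds `T - E` from below by `δ`, the inverse being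
self-adjoint with spectral radius at most `1 / δ`. -/
theorem le_norm_of_ball_disjoint_spectrum (hT : IsSelfAdjoint T) {E δ : ℝ} (hδ : 0 < δ)
    (h : ∀ x : ℝ, |x - E| < δ → (x : ℂ) ∉ spectrum ℂ T) (ψ : H) :
    δ * ‖ψ‖ ≤ ‖T ψ - (E : ℂ) • ψ‖ := by
  have hS := isSelfAdjoint_sub_real hT E
  have hE := h E (by simpa using hδ)
  rw [spectrum.notMem_iff, IsUnit.sub_iff] at hE
  obtain ⟨u, hu⟩ := hE
  have hinv : IsSelfAdjoint ((u⁻¹ : (H →L[ℂ] H)ˣ) : H →L[ℂ] H) := by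
    have hus : star u = u := by ext1; rw [Units.coe_star, hu, hS.star_eq]
    rw [isSelfAdjoint_iff, ← Units.coe_star, star_inv, hus]
  have hrad : spectralRadius ℂ ((u⁻¹ : (H →L[ℂ] H)ˣ) : H →L[ℂ] H)
      ≤ ((Real.toNNReal δ)⁻¹ : NNReal) := by
    refine iSup₂_le fun k hk => ?_
    have hk0 : k ≠ 0 := fun h0 => spectrum.zero_notMem ℂ (u⁻¹).isUnit (h0 ▸ hk)
    have hk' : k⁻¹ ∈ spectrum ℂ (u : H →L[ℂ] H) := by
      rwa [← spectrum.inv₀_mem_inv_iff, inv_inv]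
    have hreal := IsSelfAdjoint.mem_spectrum_eq_re (hu ▸ hS) hk'
    rw [hu] at hk'
    have hmem : (((k⁻¹).re + E : ℝ) : ℂ) ∈ spectrum ℂ T := by
      rw [Complex.ofReal_add, ← hreal]
      have := spectrum.add_mem_add_iff (R := ℂ) (r := k⁻¹) (s := (E : ℂ))
        (a := T - algebraMap ℂ (H →L[ℂ] H) E)
      rw [add_sub_cancel] at this
      exact this.2 hk'
    have hge : δ ≤ |(k⁻¹).re| := by
      by_contra hlt
      push Not at hlt
      exact h _ (by simpa using hlt) hmem
    have hnorm : ‖k⁻¹‖ = |(k⁻¹).re| := by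
      conv_lhs => rw [hreal, Complex.norm_real, Real.norm_eq_abs]
    rw [ENNReal.coe_le_coe, ← NNReal.coe_le_coe, NNReal.coe_inv, Real.coe_toNNReal δ hδ.le,
      coe_nnnorm, le_inv_comm₀ (norm_pos_iff.2 hk0) hδ, ← norm_inv, hnorm]
    exact hge
  rw [hinv.spectralRadius_eq_nnnorm, ENNReal.coe_le_coe, ← NNReal.coe_le_coe, NNReal.coe_inv,
    Real.coe_toNNReal δ hδ.le, coe_nnnorm] at hrad
  have happ : (u : H →L[ℂ] H) ψ = T ψ - (E : ℂ) • ψ := by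
    rw [hu]; simp [Algebra.algebraMap_eq_smul_one]
  have h1 : ((u⁻¹ : (H →L[ℂ] H)ˣ) : H →L[ℂ] H) ((u : H →L[ℂ] H) ψ) = ψ := by
    rw [← mul_apply_eq_comp, Units.inv_mul]; rfl
  have h2 := ContinuousLinearMap.le_opNorm ((u⁻¹ : (H →L[ℂ] H)ˣ) : H →L[ℂ] H) ((u : H →L[ℂ] H) ψ)
  rw [h1] at h2
  rw [← happ, mul_comm, ← le_div_iff₀ hδ, div_eq_inv_mul]
  exact h2.trans (by gcongr)

end SelfAdjoint

/-! ### Discrete Schrödinger operators -/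

/-- Translation of an `ℓ²` sequence. -/
def shiftL2 (k : ℤ) (ψ : L2Z) : L2Z := ⟨fun n => ψ (n + k), memlp_shift k ψ⟩

theorem norm_shiftL2 (k : ℤ) (ψ : L2Z) : ‖shiftL2 k ψ‖ = ‖ψ‖ := by
  have h2 : 0 < (2 : ℝ≥0∞).toReal := by norm_num
  rw [lp.norm_eq_tsum_rpow h2, lp.norm_eq_tsum_rpow h2]
  congr 1
  exact (Equiv.addRight k).tsum_eq fun n => ‖ψ n‖ ^ (2 : ℝ≥0∞).toReal

theorem hasSum_of_eq {f g : ℤ → ℂ} {a : ℂ} (h : ∀ n, f n = g n) (hf : HasSum f a) : HasSum g a :=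
  funext h ▸ hf

theorem inner_schrodinger (V : BddSeq) (ψ φ : L2Z) :
    inner ℂ (schrodinger V ψ) φ = inner ℂ ψ (schrodinger V φ) := by
  have hsh : ∀ (k : ℤ) (ψ φ : L2Z),
      HasSum (fun n => inner ℂ (ψ (n + k)) (φ n)) (inner ℂ ψ (shiftL2 (-k) φ)) := by
    intro k ψ φ
    have := lp.hasSum_inner (𝕜 := ℂ) ψ (shiftL2 (-k) φ)
    rw [← (Equiv.addRight k).hasSum_iff] at this
    refine hasSum_of_eq (fun n => ?_) this
    change inner ℂ (ψ (n + k)) (φ (n + k + -k)) = _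
    rw [add_neg_cancel_right]
  have hmul : HasSum (fun n => inner ℂ ((V n : ℂ) * ψ n) (φ n))
      (inner ℂ ψ (⟨_, memlp_mul V φ⟩ : L2Z)) := by
    refine hasSum_of_eq (fun n => ?_)
      (lp.hasSum_inner (𝕜 := ℂ) ψ (⟨_, memlp_mul V φ⟩ : L2Z))
    change inner ℂ (ψ n) ((V n : ℂ) * φ n) = _
    rw [← smul_eq_mul, ← smul_eq_mul, inner_smul_left, inner_smul_right, Complex.conj_ofReal]
  have hsplit : schrodinger V φ
      = shiftL2 (-1) φ + shiftL2 (- -1) φ + (⟨_, memlp_mul V φ⟩ : L2Z) := by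
    ext n
    change φ (n + 1) + φ (n - 1) + (V n : ℂ) * φ n
      = φ (n + -1) + φ (n + - -1) + (V n : ℂ) * φ n
    rw [neg_neg, ← sub_eq_add_neg, add_comm (φ (n + 1))]
  rw [hsplit, inner_add_right, inner_add_right]
  refine (lp.hasSum_inner (𝕜 := ℂ) (schrodinger V ψ) φ).unique ?_
  refine hasSum_of_eq (fun n => ?_) (((hsh 1 ψ φ).add (hsh (-1) ψ φ)).add hmul)
  rw [schrodinger_apply, inner_add_left, inner_add_left, sub_eq_add_neg]

theorem isSelfAdjoint_schrodinger (V : BddSeq) : IsSelfAdjoint (schrodinger V) := by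
  rw [ContinuousLinearMap.isSelfAdjoint_iff_isSymmetric]
  exact fun ψ φ => inner_schrodinger V ψ φ

/-- Deviation of a sequence from the solution with the same data at `j`. -/
theorem norm_sub_transfer_le {V f ψ : ℤ → ℂ} {E : ℂ} {C : ℝ} (hV : ∀ n, ‖E - V n‖ + 1 ≤ C)
    (hf : ∀ n, ψ (n + 1) + ψ (n - 1) + V n * ψ n - E * ψ n = f n) (j : ℤ) (l : ℕ) :
    ‖![ψ (j + l), ψ (j + l - 1)] - (transfer V E j l).mulVec ![ψ j, ψ (j - 1)]‖
      ≤ C ^ l * ∑ i ∈ Finset.range l, ‖f (j + i)‖ := by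
  have hC : 1 ≤ C := by linarith [hV 0, norm_nonneg (E - V 0)]
  induction l with
  | zero => simp [transfer]
  | succ l ih =>
    have hstep : ∀ v : Fin 2 → ℂ, ‖(!![E - V (j + l), -1; 1, 0] : Matrix _ _ ℂ).mulVec v‖
        ≤ C * ‖v‖ := by
      intro v
      have h0 := norm_le_pi_norm v 0
      have h1 := norm_le_pi_norm v 1
      refine (pi_norm_le_iff_of_nonneg (by positivity)).2 fun i => ?_
      fin_cases i
      · simp only [Matrix.mulVec, dotProduct, Fin.sum_univ_two]
        simp
        have := norm_add_le ((E - V (j + l)) * v 0) (-v 1)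
        rw [norm_mul, norm_neg] at this
        have h2 := hV (j + l)
        have h3 := norm_nonneg (E - V (j + l))
        have h4 := norm_nonneg v
        nlinarith
      · simp only [Matrix.mulVec, dotProduct, Fin.sum_univ_two]
        simp
        nlinarith [norm_nonneg v]
    have hrec : (![ψ (j + (l + 1 : ℕ)), ψ (j + (l + 1 : ℕ) - 1)] : Fin 2 → ℂ)
        = (!![E - V (j + l), -1; 1, 0] : Matrix _ _ ℂ).mulVec ![ψ (j + l), ψ (j + l - 1)]
          + ![f (j + l), 0] := by
      have := hf (j + l)
      push_cast
      rw [← add_assoc, add_sub_cancel_right]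
      ext i
      fin_cases i
      · simp
        linear_combination this
      · simp
    rw [hrec, transfer, ← Matrix.mulVec_mulVec, add_sub_right_comm, ← Matrix.mulVec_sub,
      Finset.sum_range_succ]
    have h5 : ‖(![f (j + l), 0] : Fin 2 → ℂ)‖ ≤ ‖f (j + l)‖ :=
      (pi_norm_le_iff_of_nonneg (norm_nonneg _)).2 fun i => by fin_cases i <;> simp
    calc _ ≤ C * (C ^ l * ∑ i ∈ Finset.range l, ‖f (j + i)‖) + ‖f (j + l)‖ :=
          (norm_add_le _ _).trans (add_le_add ((hstep _).trans (by gcongr)) h5)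
      _ ≤ C * (C ^ l * ∑ i ∈ Finset.range l, ‖f (j + i)‖) + C ^ (l + 1) * ‖f (j + l)‖ := by
          gcongr
          exact le_mul_of_one_le_left (norm_nonneg _) (one_le_pow₀ hC)
      _ = _ := by ring

/-- Operators with a `q`-periodic potential are bounded below where the discriminant has modulus
larger than `2`: by the Cayley–Hamilton theorem, `t ψ j - ψ (j + q) - ψ (j - q)` is controlled
by `(H - E) ψ`. -/
theorem bounded_below_of_periodic (V : BddSeq) (E t : ℂ) (q : ℕ)
    (hper : ∀ n, V (n + q) = V n)
    (ht : ∀ j, (transfer (fun n => (V n : ℂ)) E j q).trace = t) (h2 : 2 < ‖t‖) :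
    ∃ c > 0, ∀ ψ : L2Z, c * ‖ψ‖ ≤ ‖schrodinger V ψ - E • ψ‖ := by
  set W : ℤ → ℂ := fun n => (V n : ℂ) with hW
  set C : ℝ := ‖E‖ + ‖V‖ + 1 with hCdef
  have hC : ∀ n, ‖E - W n‖ + 1 ≤ C := by
    intro n
    have h1 := norm_sub_le E (W n)
    have h3 : ‖W n‖ ≤ ‖V‖ := by
      rw [hW, Complex.norm_real]; exact lp.norm_apply_le_norm ENNReal.top_ne_zero V n
    linarith
  have hC1 : 1 ≤ C := by linarith [hC 0, norm_nonneg (E - W 0)]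
  -- the modulus of an entry, as a sequence in `ℓ²`
  have habs : ∀ f : L2Z, Memℓp (fun n => ((‖f n‖ : ℝ) : ℂ)) 2 := fun f =>
    (lp.memℓp f).mono' fun n => by simp
  set D : ℝ := (2 * C ^ q + ‖t‖ + 1) * C ^ q with hD
  have hDpos : 0 < D := by positivity
  have hop : ∀ j (v : Fin 2 → ℂ), ‖(transfer W E j q).mulVec v‖ ≤ C ^ q * ‖v‖ := by
    intro j v
    suffices ∀ l : ℕ, ‖(transfer W E j l).mulVec v‖ ≤ C ^ l * ‖v‖ from this q
    intro l
    induction l with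
    | zero => simp [transfer]
    | succ l ih =>
      rw [transfer, ← Matrix.mulVec_mulVec, pow_succ', mul_assoc]
      refine le_trans ?_ (mul_le_mul_of_nonneg_left ih (by positivity))
      set w := (transfer W E j l).mulVec v
      have h0 := norm_le_pi_norm w 0
      have h1 := norm_le_pi_norm w 1
      refine (pi_norm_le_iff_of_nonneg (by positivity)).2 fun i => ?_
      fin_cases i
      · simp only [Matrix.mulVec, dotProduct, Fin.sum_univ_two]
        simp
        have := norm_add_le ((E - W (j + l)) * w 0) (-w 1)
        rw [norm_mul, norm_neg] at this
        have h2 := hC (j + l)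
        have h3 := norm_nonneg (E - W (j + l))
        have h4 := norm_nonneg w
        nlinarith
      · simp only [Matrix.mulVec, dotProduct, Fin.sum_univ_two]
        simp
        nlinarith [norm_nonneg w]
  have key : ∀ ψ : L2Z, ∀ j : ℤ, ‖t * ψ j - ψ (j + q) - ψ (j - q)‖ ≤
      D * ∑ i ∈ Finset.range (2 * q), ‖(schrodinger V ψ - E • ψ) (j - q + i)‖ := by
    intro ψ j
    set f : ℤ → ℂ := fun n => (schrodinger V ψ - E • ψ) n with hfdef
    have hf : ∀ n, ψ (n + 1) + ψ (n - 1) + W n * ψ n - E * ψ n = f n := fun n => by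
      rw [hfdef]
      simp only [lp.coeFn_sub, lp.coeFn_smul, Pi.sub_apply, Pi.smul_apply, smul_eq_mul,
        schrodinger_apply, hW]
    have e1 := norm_sub_transfer_le hC hf (j - q) q
    have e2 := norm_sub_transfer_le hC hf j q
    rw [sub_add_cancel] at e1
    have hM : transfer W E (j - q) q = transfer W E j q :=
      transfer_congr fun r _ _ => by
        rw [hW]
        simp only
        rw [← hper (j - q + r), show j - (q : ℤ) + r + q = j + r by ring]
    rw [hM] at e1
    set M := transfer W E j q with hMdef
    set v0 : Fin 2 → ℂ := ![ψ (j - q), ψ (j - q - 1)]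
    set v1 : Fin 2 → ℂ := ![ψ j, ψ (j - 1)]
    set v2 : Fin 2 → ℂ := ![ψ (j + q), ψ (j + q - 1)]
    set d1 := v1 - M.mulVec v0
    set d2 := v2 - M.mulVec v1
    have hCH : t • v1 - v2 - v0 = t • d1 - M.mulVec d1 - d2 := by
      have h1 : M.mulVec v1 = M.mulVec d1 + (M * M).mulVec v0 := by
        rw [← Matrix.mulVec_mulVec, ← Matrix.mulVec_add, sub_add_cancel]
      have h2 : (M * M).mulVec v0 = t • M.mulVec v0 - v0 := by
        rw [mul_self_of_det_eq_one (det_transfer W E j q), ht j, Matrix.sub_mulVec,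
          Matrix.smul_mulVec, Matrix.one_mulVec]
      have h3 : v2 = d2 + M.mulVec v1 := (sub_add_cancel _ _).symm
      have h4 : v1 = d1 + M.mulVec v0 := (sub_add_cancel _ _).symm
      rw [h3, h1, h2]
      nth_rewrite 1 [h4]
      rw [smul_add]
      abel
    have hle : ‖t * ψ j - ψ (j + q) - ψ (j - q)‖ ≤ ‖t • v1 - v2 - v0‖ := by
      have := norm_le_pi_norm (t • v1 - v2 - v0) 0
      simpa [v0, v1, v2] using this
    refine hle.trans ?_
    rw [hCH]
    have hsum : ∑ i ∈ Finset.range (2 * q), ‖f (j - q + i)‖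
        = ∑ i ∈ Finset.range q, ‖f (j - q + i)‖ + ∑ i ∈ Finset.range q, ‖f (j + i)‖ := by
      rw [two_mul, Finset.sum_range_add]
      congr 1
      refine Finset.sum_congr rfl fun i _ => ?_
      congr 2; push_cast; ring
    rw [hsum]
    set s1 := ∑ i ∈ Finset.range q, ‖f (j - q + i)‖ with hs1
    set s2 := ∑ i ∈ Finset.range q, ‖f (j + i)‖ with hs2
    have hs1' : 0 ≤ s1 := Finset.sum_nonneg fun _ _ => norm_nonneg _
    have hs2' : 0 ≤ s2 := Finset.sum_nonneg fun _ _ => norm_nonneg _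
    have hCq : 1 ≤ C ^ q := one_le_pow₀ hC1
    calc _ ≤ ‖t‖ * ‖d1‖ + C ^ q * ‖d1‖ + ‖d2‖ := by
          refine (norm_sub_le _ _).trans (add_le_add_left ((norm_sub_le _ _).trans ?_) _)
          rw [norm_smul]
          exact add_le_add_right (hop j d1) _
      _ ≤ ‖t‖ * (C ^ q * s1) + C ^ q * (C ^ q * s1) + C ^ q * s2 := by gcongr
      _ ≤ D * (s1 + s2) := by
          rw [hD]
          have h1 : 0 ≤ C ^ q * s1 := by positivity
          have h3 : 0 ≤ C ^ q * s2 := by positivity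
          nlinarith [mul_nonneg (norm_nonneg t) h3, mul_nonneg (norm_nonneg t) h1,
            mul_nonneg (zero_le_one.trans hCq) h1, mul_nonneg (zero_le_one.trans hCq) h3]
  refine ⟨(‖t‖ - 2) / (D * (2 * q + 1)), by have := sub_pos.2 h2; positivity, fun ψ => ?_⟩
  set f : L2Z := schrodinger V ψ - E • ψ with hfdef
  set g : L2Z := ∑ i ∈ Finset.range (2 * q),
    shiftL2 (i - q : ℤ) (⟨_, habs f⟩ : L2Z) with hg
  have hgn : ‖g‖ ≤ 2 * q * ‖f‖ := by
    refine (norm_sum_le _ _).trans ?_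
    refine (Finset.sum_le_card_nsmul _ _ ‖f‖ fun i _ => ?_).trans (by simp)
    rw [norm_shiftL2]
    exact lp.norm_mono (by norm_num) fun n => by simp
  have hgapp : ∀ n, g n = ((∑ i ∈ Finset.range (2 * q), ‖f (n - q + i)‖ : ℝ) : ℂ) := by
    intro n
    rw [hg, lp.coeFn_sum, Finset.sum_apply]
    push_cast
    refine Finset.sum_congr rfl fun i _ => ?_
    simp only [shiftL2]
    rw [show n + ((i : ℤ) - q) = n - q + i by ring]
  have hmain : ‖t • ψ - shiftL2 q ψ - shiftL2 (-q) ψ‖ ≤ ‖(D : ℂ) • g‖ := by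
    refine lp.norm_mono (by norm_num) fun n => ?_
    have h1 := key ψ n
    simp only [lp.coeFn_sub, lp.coeFn_smul, Pi.sub_apply, Pi.smul_apply, smul_eq_mul, hgapp,
      shiftL2]
    rw [norm_mul, Complex.norm_real, Complex.norm_real, Real.norm_of_nonneg hDpos.le,
      Real.norm_of_nonneg (Finset.sum_nonneg fun _ _ => norm_nonneg _)]
    exact h1
  have hlow : (‖t‖ - 2) * ‖ψ‖ ≤ ‖t • ψ - shiftL2 q ψ - shiftL2 (-q) ψ‖ := by
    have h1 := norm_sub_norm_le (t • ψ - shiftL2 q ψ) (shiftL2 (-q) ψ)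
    have h3 := norm_sub_norm_le (t • ψ) (shiftL2 q ψ)
    rw [norm_smul] at h3
    rw [norm_shiftL2] at h1 h3
    linarith
  rw [norm_smul, Complex.norm_real, Real.norm_of_nonneg hDpos.le] at hmain
  rw [div_mul_eq_mul_div, div_le_iff₀ (by positivity)]
  have h5 := norm_nonneg f
  nlinarith [mul_le_mul_of_nonneg_left hgn hDpos.le, mul_nonneg hDpos.le h5]

theorem bounded_below_of_finite_support (T : L2Z →L[ℂ] L2Z) (c : ℝ)
    (h : ∀ s : Finset ℤ, ∀ ψ : L2Z, (∀ n ∉ s, ψ n = 0) → c * ‖ψ‖ ≤ ‖T ψ‖) (ψ : L2Z) :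
    c * ‖ψ‖ ≤ ‖T ψ‖ := by
  have hlim := lp.hasSum_single (p := 2) (by norm_num) ψ
  refine le_of_tendsto_of_tendsto' (hlim.norm.const_mul c)
    ((T.continuous.tendsto ψ).comp hlim).norm fun s => ?_
  refine h s _ fun n hn => ?_
  rw [lp.coeFn_sum, Finset.sum_apply]
  refine Finset.sum_eq_zero fun i hi => ?_
  rw [lp.single_apply_ne]
  rintro rfl
  exact hn hi

/-! ### Rational approximation and the spectrum -/

theorem sturmianFun_eq {θ : ℝ} (h0 : 0 ≤ θ) (h1 : θ ≤ 1) (lam ρ : ℝ) (m : ℤ) :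
    (sturmianFun lam θ ρ m : ℂ) = stairPotential lam (fun m : ℤ => ⌊(m : ℝ) * θ + ρ⌋) m := by
  have hfl : ⌊((m + 1 : ℤ) : ℝ) * θ + ρ⌋ - ⌊(m : ℝ) * θ + ρ⌋
      = if 1 - θ ≤ Int.fract ((m : ℝ) * θ + ρ) then 1 else 0 := by
    have e : ((m + 1 : ℤ) : ℝ) * θ + ρ = ⌊(m : ℝ) * θ + ρ⌋
        + (Int.fract ((m : ℝ) * θ + ρ) + θ) := by
      have := Int.floor_add_fract ((m : ℝ) * θ + ρ)
      push_cast
      linear_combination -this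
    rw [e, Int.floor_intCast_add, add_sub_cancel_left]
    have h2 := Int.fract_nonneg ((m : ℝ) * θ + ρ)
    have h3 := Int.fract_lt_one ((m : ℝ) * θ + ρ)
    split_ifs with h
    · rw [Int.floor_eq_iff]
      push_cast
      constructor <;> linarith
    · rw [Int.floor_eq_iff]
      push_cast
      constructor <;> linarith
  rw [stairPotential, hfl, sturmianFun]
  have h3 := Int.fract_lt_one ((m : ℝ) * θ + ρ)
  by_cases h : 1 - θ ≤ Int.fract ((m : ℝ) * θ + ρ)
  · rw [Set.indicator_of_mem (Set.mem_Ico.2 ⟨h, h3⟩), if_pos h]; simp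
  · rw [Set.indicator_of_notMem (fun hh => h hh.1), if_neg h]; simp

/-- On a finite window, a staircase of slope `θ` is also the floor staircase of every slope close
to `θ`: the finitely many inequalities involved are strict. -/
theorem IsStaircase.eventually_exists_floor {θ : ℝ} {F : ℤ → ℤ} (hF : IsStaircase θ F)
    (s : Finset ℤ) (hs : s.Nonempty) : ∀ᶠ θ' in nhds θ, ∃ ρ : ℝ, ∀ m ∈ s,
      ⌊(m : ℝ) * θ' + ρ⌋ = F m := by
  have hev : ∀ᶠ θ' in nhds θ, ∀ j ∈ s, ∀ k ∈ s, (F j : ℝ) - F k < (j - k) * θ' + 1 := by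
    refine (Finset.eventually_all s).2 fun j _ => (Finset.eventually_all s).2 fun k _ => ?_
    exact (continuous_const.mul continuous_id |>.add continuous_const).continuousAt.eventually
      (lt_mem_nhds (hF j k))
  filter_upwards [hev] with θ' h
  obtain ⟨k, hk, hmax⟩ := s.exists_max_image (fun m => (F m : ℝ) - m * θ') hs
  refine ⟨F k - k * θ', fun m hm => ?_⟩
  rw [Int.floor_eq_iff]
  have h1 := hmax m hm
  have h2 := h k hk m hm
  constructor <;> linarith

/-- The finite continued fraction `[0; b i + 1, …, b (i + s - 1) + 1]`. -/
def finiteCF (b : ℕ → ℕ) : ℕ → ℕ → ℝ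
  | 0, _ => 0
  | s + 1, i => 1 / (b i + 1 + finiteCF b s (i + 1))

theorem finiteCF_nonneg (b : ℕ → ℕ) (s i : ℕ) : 0 ≤ finiteCF b s i := by
  induction s generalizing i with
  | zero => exact le_rfl
  | succ s ih => have := ih (i + 1); simp only [finiteCF]; positivity

theorem finiteCF_le_one (b : ℕ → ℕ) (s i : ℕ) : finiteCF b s i ≤ 1 := by
  cases s with
  | zero => exact zero_le_one
  | succ s =>
    have := finiteCF_nonneg b s (i + 1)
    have hb : (0 : ℝ) ≤ b i := Nat.cast_nonneg _
    simp only [finiteCF]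
    rw [div_le_one (by positivity)]
    linarith

theorem slopeChain_finiteCF (b : ℕ → ℕ) (m : ℕ) :
    SlopeChain b (fun i => finiteCF b (m - i) i) m := by
  refine ⟨fun i _ => finiteCF_nonneg _ _ _, fun i _ => finiteCF_le_one _ _ _, fun i hi => ?_⟩
  obtain ⟨s, hs⟩ : ∃ s, m - i = s + 1 := ⟨m - i - 1, by omega⟩
  have := finiteCF_nonneg b s (i + 1)
  simp only [hs, show m - (i + 1) = s by omega, finiteCF]
  rw [one_div, inv_mul_cancel₀ (by positivity)]

theorem tendsto_finiteCF {b : ℕ → ℕ} {θ : ℕ → ℝ} (h : ∀ n, SlopeChain b θ n) :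
    Tendsto (fun s => finiteCF b s 0) atTop (nhds (θ 0)) := by
  -- one step multiplies the error by `θ i * finiteCF b (s + 1) i`, hence two steps halve it
  have hpos : ∀ i, 0 < θ i := fun i => (h (i + 1)).pos i.lt_succ_self
  have hle : ∀ i, θ i ≤ 1 := fun i => (h i).le_one i le_rfl
  have hmul : ∀ i, θ i * (b i + 1 + θ (i + 1)) = 1 := fun i => (h (i + 1)).mul_eq i i.lt_succ_self
  have hone : ∀ s i, |θ i - finiteCF b (s + 1) i|
      ≤ θ i * |θ (i + 1) - finiteCF b s (i + 1)| := by
    intro s i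
    have hf := finiteCF_nonneg b s (i + 1)
    have hf1 := finiteCF_le_one b (s + 1) i
    have hf0 := finiteCF_nonneg b (s + 1) i
    have he : finiteCF b (s + 1) i * (b i + 1 + finiteCF b s (i + 1)) = 1 := by
      simp only [finiteCF]; rw [one_div, inv_mul_cancel₀ (by positivity)]
    have : θ i - finiteCF b (s + 1) i
        = -(θ i * finiteCF b (s + 1) i) * (θ (i + 1) - finiteCF b s (i + 1)) := by
      linear_combination finiteCF b (s + 1) i * hmul i - θ i * he
    rw [this, abs_mul, abs_neg, abs_mul, abs_of_pos (hpos i), abs_of_nonneg hf0]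
    have := mul_le_of_le_one_right (hpos i).le hf1
    gcongr
  have htwo : ∀ s i, |θ i - finiteCF b (s + 2) i|
      ≤ 1 / 2 * |θ (i + 2) - finiteCF b s (i + 2)| := by
    intro s i
    have h1 := hone (s + 1) i
    have h2 := hone s (i + 1)
    have h3 : θ i * θ (i + 1) ≤ 1 / 2 := by
      have hb : (0 : ℝ) ≤ b i := Nat.cast_nonneg _
      nlinarith [hmul i, hpos i, hpos (i + 1), hle i, hle (i + 1), mul_nonneg (hpos i).le hb]
    calc _ ≤ θ i * (θ (i + 1) * |θ (i + 2) - finiteCF b s (i + 2)|) :=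
          h1.trans (mul_le_mul_of_nonneg_left h2 (hpos i).le)
      _ ≤ _ := by rw [← mul_assoc]; gcongr
  have hall : ∀ t s i, t ≤ s / 2 → |θ i - finiteCF b s i| ≤ (1 / 2) ^ t := by
    intro t
    induction t with
    | zero =>
      intro s i _
      rw [pow_zero, abs_le]
      constructor <;> linarith [hpos i, hle i, finiteCF_nonneg b s i, finiteCF_le_one b s i]
    | succ t ih =>
      intro s i hs
      obtain ⟨s, rfl⟩ : ∃ s', s = s' + 2 := ⟨s - 2, by omega⟩
      refine (htwo s i).trans ?_
      rw [pow_succ']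
      have := ih s (i + 2) (by omega)
      gcongr
  rw [tendsto_iff_norm_sub_tendsto_zero]
  refine squeeze_zero (fun _ => norm_nonneg _) (fun s => ?_)
    ((tendsto_pow_atTop_nhds_zero_of_lt_one (show (0 : ℝ) ≤ 1 / 2 by norm_num)
      (by norm_num)).comp (Nat.tendsto_div_const_atTop (show 2 ≠ 0 by norm_num)))
  rw [Real.norm_eq_abs, abs_sub_comm]
  exact hall _ s 0 le_rfl

/-- If the word read from `s` on repeats with period `l` for `i` letters, the transfer matrix over
the period starting at `s + i` is conjugate to the one starting at `s`. -/
theorem trace_transfer_add {V : ℤ → ℂ} {E : ℂ} {s : ℤ} {l i : ℕ} (hi : i ≤ l)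
    (h : ∀ r : ℤ, 0 ≤ r → r < i → V (s + r) = V (s + l + r)) :
    (transfer V E (s + i) l).trace = (transfer V E s l).trace := by
  obtain ⟨d, rfl⟩ := Nat.exists_eq_add_of_le hi
  have h1 : transfer V E (s + i) (i + d)
      = transfer V E (s + (i + d : ℕ)) i * transfer V E (s + i) d := by
    rw [add_comm i d, transfer_add]
    push_cast
    rw [add_assoc, add_comm (i : ℤ) d]
  rw [h1, transfer_add, ← transfer_congr h, Matrix.trace_mul_comm]

theorem continuous_tileMat (b : ℕ → ℕ) (lam : ℂ) (n : ℕ) :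
    Continuous fun E : ℂ => tileMat b lam E n := by
  induction n with
  | zero =>
    refine Continuous.prodMk ?_ continuous_const
    refine continuous_matrix fun i j => ?_
    fin_cases i <;> fin_cases j <;> simp <;> fun_prop
  | succ n ih =>
    simp only [tileMat]
    exact (ih.snd.mul (ih.fst.pow _)).prodMk ih.fst

theorem continuous_trA (b : ℕ → ℕ) (lam : ℂ) (n : ℕ) : Continuous fun E : ℂ => trA b lam E n :=
  (continuous_tileMat b lam n).fst.matrix_trace

theorem continuous_trC (b : ℕ → ℕ) (lam : ℂ) (n k : ℕ) :
    Continuous fun E : ℂ => trC b lam E n k :=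
  ((continuous_tileMat b lam n).snd.mul ((continuous_tileMat b lam n).fst.pow k)).matrix_trace

theorem eventually_escapes {b : ℕ → ℕ} {lam E : ℂ} {n k : ℕ} (h : Escapes b lam E n k) :
    ∀ᶠ E' in nhds E, Escapes b lam E' n k := by
  obtain ⟨h0, h1, h2, h3⟩ := h
  have e1 := (continuous_trA b lam n).norm.continuousAt.eventually (lt_mem_nhds h1)
  have e2 := (continuous_trC b lam n (k + 1)).norm.continuousAt.eventually (lt_mem_nhds h2)
  have e3 := ((continuous_trC b lam n k).norm.tendsto E).eventually_lt
    ((continuous_trC b lam n (k + 1)).norm.tendsto E) h3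
  filter_upwards [e1, e2, e3] with E' a1 a2 a3
  exact ⟨h0, a1, a2, a3⟩

/-- Real energies with `|tr (A m)| > 2` lie outside the spectrum of the periodic approximant of
level `m`, whose tiles of level `m` are all of the type `A`. -/
theorem notMem_spectrum_periodic (b : ℕ → ℕ) (lam ρ : ℝ) (m : ℕ) (E : ℝ)
    (h : 2 < ‖trA b lam E m‖) : (E : ℂ) ∉ spectrum ℂ (sturmianOp lam (finiteCF b m 0) ρ) := by
  set F : ℤ → ℤ := fun j => ⌊(j : ℝ) * finiteCF b m 0 + ρ⌋ with hFdef
  have hF : IsStaircase (finiteCF b m 0) F := isStaircase_floor _ _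
  have hch := slopeChain_finiteCF b m
  have hst := hch.isStaircase_stair hF
  have htype : ∀ k, tileType b F m k = 0 := by
    intro k
    simp only [Nat.sub_self, finiteCF] at hst
    have h1 := hst (k + 1) k
    have h2 := hst k (k + 1)
    simp only [mul_zero, zero_add] at h1 h2
    have h3 : stair b F m (k + 1) < stair b F m k + 1 := by
      have : (stair b F m (k + 1) : ℝ) < stair b F m k + 1 := by linarith
      exact_mod_cast this
    have h4 : stair b F m k < stair b F m (k + 1) + 1 := by
      have : (stair b F m k : ℝ) < stair b F m (k + 1) + 1 := by linarith
      exact_mod_cast this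
    simp only [tileType]
    omega
  set q := (tileLen b m).1 with hq
  have hstart : ∀ k, tileStart b F m (k + 1) = tileStart b F m k + q := fun k => by
    rw [hch.tileStart_succ hF, htype, zero_mul, add_zero]
  have hV : ∀ n : ℤ, ((sturmianPotential lam (finiteCF b m 0) ρ n : ℝ) : ℂ)
      = stairPotential lam F n := fun n =>
    sturmianFun_eq (finiteCF_nonneg b m 0) (finiteCF_le_one b m 0) lam ρ n
  have hper : ∀ n : ℤ, stairPotential lam F (n + q) = stairPotential lam F n := by
    intro n
    obtain ⟨k, hk, hk'⟩ := exists_mem_step (hch.tileStart_strictMono hF) n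
    have := (hch.increment_eq hF).1 (k + 1) k (by rw [htype, htype])
      (n - tileStart b F m k) (by omega) (by have := hstart (k + 1); have := hstart k; omega)
    rw [hstart, show tileStart b F m k + q + (n - tileStart b F m k) = n + q by ring,
      add_sub_cancel] at this
    simp only [stairPotential]
    simp only [tileType, stair] at this
    rw [this]
  obtain ⟨c, hc, hbd⟩ := bounded_below_of_periodic (sturmianPotential lam (finiteCF b m 0) ρ) E
    (trA b lam E m) q (fun n => by
      have := hper n
      rw [← hV, ← hV] at this
      exact_mod_cast this) (fun j => by
      simp_rw [hV]
      obtain ⟨k, hk, hk'⟩ := exists_mem_step (hch.tileStart_strictMono hF) j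
      rw [hstart] at hk'
      obtain ⟨i, hi⟩ : ∃ i : ℕ, j = tileStart b F m k + i :=
        ⟨(j - tileStart b F m k).toNat, by omega⟩
      rw [hi, trace_transfer_add (by omega) fun r _ _ => by rw [← hper]; congr 1; ring]
      rw [(hch.transfer_tile hF lam E k).1 (htype k)]
      rfl) h
  exact notMem_spectrum_of_bounded_below (isSelfAdjoint_schrodinger _) hc hbd

/-- Energies in the spectrum of a Sturmian operator do not escape under the trace map: escape is an
open condition that persists to all later levels, so it keeps a fixed neighbourhood of the energy
out of the spectra of all good periodic approximants, and the resulting bound from below passes to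
the limit. -/
theorem not_escapes_of_mem_spectrum {b : ℕ → ℕ} {θ : ℕ → ℝ} (h : ∀ n, SlopeChain b θ n)
    (lam ρ : ℝ) {E : ℂ} (hE : E ∈ spectrum ℂ (sturmianOp lam (θ 0) ρ)) (n k : ℕ) :
    ¬ Escapes b lam E n k := by
  intro hesc
  have hreal := IsSelfAdjoint.mem_spectrum_eq_re (isSelfAdjoint_schrodinger _) hE
  obtain ⟨E, rfl⟩ : ∃ x : ℝ, E = x := ⟨_, hreal⟩
  obtain ⟨δ, hδ, hball⟩ := Metric.eventually_nhds_iff.1 (eventually_escapes hesc)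
  refine notMem_spectrum_of_bounded_below (isSelfAdjoint_schrodinger _) hδ (fun ψ => ?_) hE
  have hbelow := bounded_below_of_finite_support
    (schrodinger (sturmianPotential lam (θ 0) ρ) - (E : ℂ) • ContinuousLinearMap.id ℂ L2Z) δ ?_ ψ
  · exact hbelow
  intro s ψ hψ
  -- a finitely supported `ψ` does not distinguish the operator from a good approximant
  set w : Finset ℤ := insert 0 (s ∪ s.image (· + 1)) with hw
  have hF : IsStaircase (θ 0) (fun m : ℤ => ⌊(m : ℝ) * θ 0 + ρ⌋) := isStaircase_floor _ _
  obtain ⟨m, ⟨ρ', hρ'⟩, hm⟩ := (((tendsto_finiteCF h).eventually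
    (hF.eventually_exists_floor w ⟨0, by simp [hw]⟩)).and (eventually_ge_atTop n)).exists
  obtain ⟨d, rfl⟩ := Nat.exists_eq_add_of_le hm
  have hgap := le_norm_of_ball_disjoint_spectrum
    (isSelfAdjoint_schrodinger (sturmianPotential lam (finiteCF b (n + d) 0) ρ')) hδ (E := E)
    (fun x hx => notMem_spectrum_periodic b lam ρ' (n + d) x
      ((hball (by rwa [dist_eq_norm, ← Complex.ofReal_sub, Complex.norm_real])).two_lt_trA d)) ψ
  refine hgap.trans_eq (congrArg norm ?_)
  ext j
  have h0 := (h 0).nonneg 0 le_rfl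
  have h1 := (h 0).le_one 0 le_rfl
  change schrodinger (sturmianPotential lam (finiteCF b (n + d) 0) ρ') ψ j - (E : ℂ) * ψ j
    = schrodinger (sturmianPotential lam (θ 0) ρ) ψ j - (E : ℂ) * ψ j
  rw [schrodinger_apply, schrodinger_apply]
  congr 2
  by_cases hj : j ∈ s
  · change (sturmianFun lam (finiteCF b (n + d) 0) ρ' j : ℂ) * _
      = (sturmianFun lam (θ 0) ρ j : ℂ) * _
    rw [sturmianFun_eq h0 h1, sturmianFun_eq (finiteCF_nonneg _ _ _) (finiteCF_le_one _ _ _)]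
    simp only [stairPotential]
    rw [hρ' j (by simp [hw, hj]), hρ' (j + 1) (by simp [hw, hj])]
  · rw [hψ j hj, mul_zero, mul_zero]

/-! ### Upper bounds for transfer matrices -/

/-- The sum of the moduli of the entries of a `2 × 2` matrix: a submultiplicative norm that is
invariant under inversion on `SL(2)`. -/
def entrySum (M : Matrix (Fin 2) (Fin 2) ℂ) : ℝ := ‖M 0 0‖ + ‖M 0 1‖ + ‖M 1 0‖ + ‖M 1 1‖

theorem entrySum_nonneg (M : Matrix (Fin 2) (Fin 2) ℂ) : 0 ≤ entrySum M := by
  unfold entrySum; positivity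

theorem entrySum_add (M N : Matrix (Fin 2) (Fin 2) ℂ) :
    entrySum (M + N) ≤ entrySum M + entrySum N := by
  simp only [entrySum, Matrix.add_apply]
  linarith [norm_add_le (M 0 0) (N 0 0), norm_add_le (M 0 1) (N 0 1), norm_add_le (M 1 0) (N 1 0),
    norm_add_le (M 1 1) (N 1 1)]

theorem entrySum_smul (c : ℂ) (M : Matrix (Fin 2) (Fin 2) ℂ) :
    entrySum (c • M) = ‖c‖ * entrySum M := by
  simp only [entrySum, Matrix.smul_apply, smul_eq_mul, norm_mul]
  ring

theorem entrySum_sub (M N : Matrix (Fin 2) (Fin 2) ℂ) :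
    entrySum (M - N) ≤ entrySum M + entrySum N := by
  have := entrySum_add M ((-1 : ℂ) • N)
  rw [entrySum_smul] at this
  simpa [sub_eq_add_neg] using this

theorem entrySum_mul (M N : Matrix (Fin 2) (Fin 2) ℂ) :
    entrySum (M * N) ≤ entrySum M * entrySum N := by
  have h : ∀ i j, ‖(M * N) i j‖ ≤ ‖M i 0‖ * ‖N 0 j‖ + ‖M i 1‖ * ‖N 1 j‖ := fun i j => by
    rw [Matrix.mul_apply, Fin.sum_univ_two, ← norm_mul, ← norm_mul]
    exact norm_add_le _ _
  have h00 := h 0 0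
  have h01 := h 0 1
  have h10 := h 1 0
  have h11 := h 1 1
  simp only [entrySum]
  have p : ∀ i j k l, 0 ≤ ‖M i j‖ * ‖N k l‖ := fun i j k l => by positivity
  nlinarith [p 0 0 1 0, p 0 0 1 1, p 0 1 0 0, p 0 1 0 1, p 1 0 1 0, p 1 0 1 1, p 1 1 0 0, p 1 1 0 1]

theorem entrySum_adjugate (M : Matrix (Fin 2) (Fin 2) ℂ) :
    entrySum M.adjugate = entrySum M := by
  simp [entrySum, Matrix.adjugate_fin_two]
  ring

/-- The size of `Y` on the basis `1, A, B, A B` of the matrix algebra. Right multiplication by `A`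
and `B` is bounded for this gauge in terms of the traces of `A`, `B`, `A B` alone. -/
def tileGauge (A B Y : Matrix (Fin 2) (Fin 2) ℂ) : ℝ :=
  entrySum Y + entrySum (Y * A) + entrySum (Y * B) + entrySum (Y * (A * B))

theorem entrySum_le_tileGauge (A B Y : Matrix (Fin 2) (Fin 2) ℂ) :
    entrySum Y ≤ tileGauge A B Y := by
  unfold tileGauge
  linarith [entrySum_nonneg (Y * A), entrySum_nonneg (Y * B), entrySum_nonneg (Y * (A * B))]

section Gauge

variable {A B : Matrix (Fin 2) (Fin 2) ℂ} {K : ℝ}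

theorem tileGauge_mul_left_le (hA : A.det = 1) (hK : 1 ≤ K) (hx : ‖A.trace‖ ≤ K)
    (Y : Matrix (Fin 2) (Fin 2) ℂ) : tileGauge A B (Y * A) ≤ (1 + K) ^ 2 * tileGauge A B Y := by
  have e1 : Y * A * A = A.trace • (Y * A) - Y := by
    rw [Matrix.mul_assoc, mul_self_of_det_eq_one hA, mul_sub, Matrix.mul_smul, mul_one]
  have e2 : Y * A * (A * B) = A.trace • (Y * (A * B)) - Y * B := by
    rw [← Matrix.mul_assoc, e1, sub_mul, Matrix.smul_mul, Matrix.mul_assoc]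
  have h1 := entrySum_sub (A.trace • (Y * A)) Y
  have h2 := entrySum_sub (A.trace • (Y * (A * B))) (Y * B)
  rw [entrySum_smul] at h1 h2
  unfold tileGauge
  rw [e1, e2, Matrix.mul_assoc Y A B]
  have p0 := entrySum_nonneg Y
  have p1 := entrySum_nonneg (Y * A)
  have p2 := entrySum_nonneg (Y * B)
  have p3 := entrySum_nonneg (Y * (A * B))
  have q1 := mul_le_mul_of_nonneg_right hx p1
  have q3 := mul_le_mul_of_nonneg_right hx p3
  have r : ∀ a : ℝ, 0 ≤ a → (1 + K) * a ≤ (1 + K) ^ 2 * a := fun a ha => by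
    have : 1 + K ≤ (1 + K) ^ 2 := by nlinarith
    gcongr
  have r' : ∀ a : ℝ, 0 ≤ a → 1 * a ≤ (1 + K) ^ 2 * a := fun a ha => by
    have : 1 ≤ (1 + K) ^ 2 := by nlinarith
    gcongr
  linarith [r _ p1, r _ p3, r' _ p0, r' _ p2]

theorem tileGauge_mul_right_le (hB : B.det = 1) (hK : 1 ≤ K)
    (hx : ‖A.trace‖ ≤ K) (hy : ‖B.trace‖ ≤ K) (hz : ‖(A * B).trace‖ ≤ K)
    (Y : Matrix (Fin 2) (Fin 2) ℂ) : tileGauge A B (Y * B) ≤ (1 + K) ^ 2 * tileGauge A B Y := by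
  have hBA : B * A = A.trace • B + B.trace • A
      + ((A * B).trace - A.trace * B.trace) • (1 : Matrix (Fin 2) (Fin 2) ℂ) - A * B := by
    ext i j
    fin_cases i <;> fin_cases j <;>
      simp [Matrix.mul_apply, Fin.sum_univ_two, Matrix.trace_fin_two] <;> ring
  have hBAB : B * (A * B) = (A * B).trace • B + A - A.trace • (1 : Matrix (Fin 2) (Fin 2) ℂ) := by
    rw [← Matrix.mul_assoc, hBA]
    simp only [sub_mul, add_mul, Matrix.smul_mul, one_mul, Matrix.mul_assoc,
      mul_self_of_det_eq_one hB, mul_sub, Matrix.mul_smul, mul_one]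
    module
  have e1 : Y * B * A = A.trace • (Y * B) + B.trace • (Y * A)
      + ((A * B).trace - A.trace * B.trace) • Y - Y * (A * B) := by
    rw [Matrix.mul_assoc, hBA]
    simp only [mul_sub, mul_add, Matrix.mul_smul, mul_one]
  have e2 : Y * B * B = B.trace • (Y * B) - Y := by
    rw [Matrix.mul_assoc, mul_self_of_det_eq_one hB, mul_sub, Matrix.mul_smul, mul_one]
  have e3 : Y * B * (A * B) = (A * B).trace • (Y * B) + Y * A - A.trace • Y := by
    rw [Matrix.mul_assoc, hBAB]
    simp only [mul_sub, mul_add, Matrix.mul_smul, mul_one]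
  have h1 : entrySum (Y * B * A) ≤ ‖A.trace‖ * entrySum (Y * B) + ‖B.trace‖ * entrySum (Y * A)
      + ‖(A * B).trace - A.trace * B.trace‖ * entrySum Y + entrySum (Y * (A * B)) := by
    rw [e1, ← entrySum_smul, ← entrySum_smul, ← entrySum_smul]
    exact (entrySum_sub _ _).trans (add_le_add_left
      ((entrySum_add _ _).trans (add_le_add_left (entrySum_add _ _) _)) _)
  have h2 : entrySum (Y * B * B) ≤ ‖B.trace‖ * entrySum (Y * B) + entrySum Y := by
    rw [e2, ← entrySum_smul]; exact entrySum_sub _ _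
  have h3 : entrySum (Y * B * (A * B)) ≤ ‖(A * B).trace‖ * entrySum (Y * B) + entrySum (Y * A)
      + ‖A.trace‖ * entrySum Y := by
    rw [e3, ← entrySum_smul, ← entrySum_smul]
    exact (entrySum_sub _ _).trans (add_le_add_left (entrySum_add _ _) _)
  have hw : ‖(A * B).trace - A.trace * B.trace‖ ≤ K + K * K := by
    refine (norm_sub_le _ _).trans ?_
    rw [norm_mul]
    gcongr
  unfold tileGauge
  have p0 := entrySum_nonneg Y
  have p1 := entrySum_nonneg (Y * A)
  have p2 := entrySum_nonneg (Y * B)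
  have p3 := entrySum_nonneg (Y * (A * B))
  have a1 := mul_le_mul_of_nonneg_right hx p2
  have a2 := mul_le_mul_of_nonneg_right hy p1
  have a3 := mul_le_mul_of_nonneg_right hw p0
  have a4 := mul_le_mul_of_nonneg_right hy p2
  have a5 := mul_le_mul_of_nonneg_right hz p2
  have a6 := mul_le_mul_of_nonneg_right hx p0
  have r1 : (1 + 3 * K) * entrySum (Y * B) ≤ (1 + K) ^ 2 * entrySum (Y * B) := by
    have : 1 + 3 * K ≤ (1 + K) ^ 2 := by nlinarith
    gcongr
  have r2 : (1 + K) * entrySum (Y * A) ≤ (1 + K) ^ 2 * entrySum (Y * A) := by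
    have : 1 + K ≤ (1 + K) ^ 2 := by nlinarith
    gcongr
  have r3 : 1 * entrySum (Y * (A * B)) ≤ (1 + K) ^ 2 * entrySum (Y * (A * B)) := by
    have : 1 ≤ (1 + K) ^ 2 := by nlinarith
    gcongr
  linarith

/-- Passing to the next pair of tiles costs at most as many factors as the longest word involved
has letters. -/
theorem tileGauge_renormalize_le {κ : ℝ} (hκ : 1 ≤ κ)
    (hA : ∀ Y, tileGauge A B (Y * A) ≤ κ * tileGauge A B Y)
    (hB : ∀ Y, tileGauge A B (Y * B) ≤ κ * tileGauge A B Y) (i : ℕ)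
    (Y : Matrix (Fin 2) (Fin 2) ℂ) : tileGauge (B * A ^ i) (A * (B * A ^ i)) Y
      ≤ 4 * κ ^ (2 * i + 3) * tileGauge A B Y := by
  have hκ0 : 0 ≤ κ := zero_le_one.trans hκ
  have w0 : 0 ≤ tileGauge A B Y := (entrySum_nonneg Y).trans (entrySum_le_tileGauge _ _ Y)
  have wpow : ∀ Z (j : ℕ), tileGauge A B (Z * A ^ j) ≤ κ ^ j * tileGauge A B Z := by
    intro Z j
    induction j with
    | zero => simp
    | succ j ih =>
      rw [pow_succ, ← Matrix.mul_assoc, pow_succ', mul_assoc κ]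
      exact (hA (Z * A ^ j)).trans (mul_le_mul_of_nonneg_left ih hκ0)
  have wA : ∀ Z, tileGauge A B (Z * (B * A ^ i)) ≤ κ ^ (i + 1) * tileGauge A B Z := by
    intro Z
    rw [← Matrix.mul_assoc, pow_succ, mul_assoc (κ ^ i)]
    exact (wpow (Z * B) i).trans (mul_le_mul_of_nonneg_left (hB Z) (by positivity))
  have wB : ∀ Z, tileGauge A B (Z * (A * (B * A ^ i))) ≤ κ ^ (i + 2) * tileGauge A B Z := by
    intro Z
    rw [← Matrix.mul_assoc, show i + 2 = i + 1 + 1 by ring, pow_succ κ (i + 1),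
      mul_assoc (κ ^ (i + 1))]
    exact (wA (Z * A)).trans (mul_le_mul_of_nonneg_left (hA Z) (by positivity))
  have up : ∀ j ≤ 2 * i + 3, κ ^ j * tileGauge A B Y ≤ κ ^ (2 * i + 3) * tileGauge A B Y :=
    fun j hj => mul_le_mul_of_nonneg_right (pow_le_pow_right₀ hκ hj) w0
  have g0 : entrySum Y ≤ κ ^ (2 * i + 3) * tileGauge A B Y := by
    refine (entrySum_le_tileGauge A B Y).trans ?_
    simpa using up 0 (Nat.zero_le _)
  have g1 : entrySum (Y * (B * A ^ i)) ≤ κ ^ (2 * i + 3) * tileGauge A B Y :=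
    (entrySum_le_tileGauge A B _).trans ((wA Y).trans (up (i + 1) (by omega)))
  have g2 : entrySum (Y * (A * (B * A ^ i))) ≤ κ ^ (2 * i + 3) * tileGauge A B Y :=
    (entrySum_le_tileGauge A B _).trans ((wB Y).trans (up (i + 2) (by omega)))
  have g3 : entrySum (Y * (B * A ^ i * (A * (B * A ^ i))))
      ≤ κ ^ (2 * i + 3) * tileGauge A B Y := by
    rw [← Matrix.mul_assoc Y]
    refine (entrySum_le_tileGauge A B _).trans ((wB (Y * (B * A ^ i))).trans ?_)
    rw [show 2 * i + 3 = (i + 2) + (i + 1) by ring, pow_add κ (i + 2), mul_assoc]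
    exact mul_le_mul_of_nonneg_left (wA Y) (by positivity)
  rw [tileGauge]
  linarith

end Gauge

/-- The gauge attached to the tiles of level `n`. -/
def levelGauge (b : ℕ → ℕ) (lam E : ℂ) (n : ℕ) (Y : Matrix (Fin 2) (Fin 2) ℂ) : ℝ :=
  tileGauge (tileMat b lam E n).1 ((tileMat b lam E n).2 * (tileMat b lam E n).1) Y

/-- The growth factor of the gauge under multiplication by one tile. -/
def tileFactor (r : ℝ) : ℝ := (1 + traceBound r) ^ 2

theorem one_le_traceBound {r : ℝ} (hr : 0 ≤ r) : 1 ≤ traceBound r := by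
  unfold traceBound
  nlinarith [pow_le_pow_left₀ (by norm_num) (show (7 : ℝ) ≤ 7 + r by linarith) 3]

theorem one_le_tileFactor {r : ℝ} (hr : 0 ≤ r) : 1 ≤ tileFactor r := by
  have := one_le_traceBound hr
  unfold tileFactor
  nlinarith

section Level

variable {b : ℕ → ℕ} {lam E : ℂ}

theorem levelGauge_nonneg (n : ℕ) (Y : Matrix (Fin 2) (Fin 2) ℂ) : 0 ≤ levelGauge b lam E n Y :=
  (entrySum_nonneg Y).trans (entrySum_le_tileGauge _ _ Y)

theorem levelGauge_mul_A (h : ∀ n k, ¬ Escapes b lam E n k) (n : ℕ)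
    (Y : Matrix (Fin 2) (Fin 2) ℂ) : levelGauge b lam E n (Y * (tileMat b lam E n).1)
      ≤ tileFactor ‖lam‖ * levelGauge b lam E n Y :=
  tileGauge_mul_left_le (det_tileMat b lam E n).1 (one_le_traceBound (norm_nonneg _))
    (trace_le_of_not_escapes h n).1 Y

theorem levelGauge_mul_B (h : ∀ n k, ¬ Escapes b lam E n k) (n : ℕ)
    (Y : Matrix (Fin 2) (Fin 2) ℂ) :
    levelGauge b lam E n (Y * ((tileMat b lam E n).2 * (tileMat b lam E n).1))
      ≤ tileFactor ‖lam‖ * levelGauge b lam E n Y := by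
  have ht := trace_le_of_not_escapes h n
  refine tileGauge_mul_right_le ?_
    (one_le_traceBound (norm_nonneg _)) ht.1 ?_ ?_ Y
  · rw [Matrix.det_mul, (det_tileMat b lam E n).1, (det_tileMat b lam E n).2, mul_one]
  · have := ht.2.1
    rwa [trC, pow_one] at this
  · have := ht.2.2
    rwa [trC, pow_two, ← Matrix.mul_assoc, Matrix.trace_mul_comm] at this

theorem levelGauge_succ_le (h : ∀ n k, ¬ Escapes b lam E n k) (n : ℕ)
    (Y : Matrix (Fin 2) (Fin 2) ℂ) : levelGauge b lam E (n + 1) Y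
      ≤ 4 * tileFactor ‖lam‖ ^ (2 * b n + 3) * levelGauge b lam E n Y := by
  have hren := tileGauge_renormalize_le (one_le_tileFactor (norm_nonneg lam))
    (levelGauge_mul_A h n) (levelGauge_mul_B h n) (b n) Y
  have e : levelGauge b lam E (n + 1) Y = tileGauge
      ((tileMat b lam E n).2 * (tileMat b lam E n).1 * (tileMat b lam E n).1 ^ b n)
      ((tileMat b lam E n).1 *
        ((tileMat b lam E n).2 * (tileMat b lam E n).1 * (tileMat b lam E n).1 ^ b n)) Y := by
    simp only [levelGauge, tileMat]
    rw [pow_succ', Matrix.mul_assoc]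
  rw [e]
  exact hren

end Level

/-- The transfer matrix from the site `i` to the site `p`, for `i ≤ p`. -/
def transferTo (V : ℤ → ℂ) (E : ℂ) (i p : ℤ) : Matrix (Fin 2) (Fin 2) ℂ :=
  transfer V E i (p - i).toNat

theorem transferTo_mul (V : ℤ → ℂ) (E : ℂ) {i j p : ℤ} (hij : i ≤ j) (hjp : j ≤ p) :
    transferTo V E i p = transferTo V E j p * transferTo V E i j := by
  unfold transferTo
  rw [show (p - i).toNat = (j - i).toNat + (p - j).toNat by omega, transfer_add,
    show i + ((j - i).toNat : ℤ) = j by omega]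

section Growth

variable {b : ℕ → ℕ} {θ : ℕ → ℝ} {F : ℤ → ℤ} {E : ℂ} {lam : ℂ}

theorem transferTo_tile {n : ℕ} (hch : SlopeChain b θ n) (hF : IsStaircase (θ 0) F) (k : ℤ) :
    transferTo (stairPotential lam F) E (tileStart b F n k) (tileStart b F n (k + 1))
      = (tileMat b lam E n).1 ∨
    transferTo (stairPotential lam F) E (tileStart b F n k) (tileStart b F n (k + 1))
      = (tileMat b lam E n).2 * (tileMat b lam E n).1 := by
  have h1 := hch.transfer_tile hF lam E k
  have h2 := hch.tileStart_succ hF k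
  unfold transferTo
  rcases hch.tileType_eq_or hF k with ht | ht
  · left
    rw [← h1.1 ht, h2, ht]
    congr 1
    omega
  · right
    rw [← h1.2 ht, h2, ht]
    congr 1
    omega

theorem levelGauge_transferTo_sub {n : ℕ} (hch : SlopeChain b θ n) (hF : IsStaircase (θ 0) F)
    (h : ∀ n k, ¬ Escapes b lam E n k) (p k : ℤ) (hk : tileStart b F n k ≤ p) (j : ℕ) :
    levelGauge b lam E n (transferTo (stairPotential lam F) E (tileStart b F n (k - j)) p)
      ≤ tileFactor ‖lam‖ ^ j *
        levelGauge b lam E n (transferTo (stairPotential lam F) E (tileStart b F n k) p) := by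
  have hmono := hch.tileStart_strictMono hF
  have hκ0 : 0 ≤ tileFactor ‖lam‖ := zero_le_one.trans (one_le_tileFactor (norm_nonneg _))
  induction j with
  | zero => simp
  | succ j ih =>
    have h1 : tileStart b F n (k - (j + 1 : ℕ)) ≤ tileStart b F n (k - j) :=
      hmono.monotone (by push_cast; omega)
    have h2 : tileStart b F n (k - j) ≤ p := (hmono.monotone (by omega)).trans hk
    rw [transferTo_mul _ _ h1 h2, pow_succ', mul_assoc]
    refine le_trans ?_ (mul_le_mul_of_nonneg_left ih hκ0)
    have ht := transferTo_tile (E := E) (lam := lam) hch hF (k - (j + 1 : ℕ))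
    rw [show k - ((j + 1 : ℕ) : ℤ) + 1 = k - j by push_cast; ring] at ht
    rcases ht with ht | ht <;> rw [ht]
    · exact levelGauge_mul_A h n _
    · exact levelGauge_mul_B h n _

/-- The growth factor of the gauge per unit of the partial quotients. -/
def levelFactor (r : ℝ) : ℝ := (4 * tileFactor r) ^ 4

theorem one_le_levelFactor {r : ℝ} (hr : 0 ≤ r) : 1 ≤ levelFactor r :=
  one_le_pow₀ (by linarith [one_le_tileFactor hr])

/-- From the start of the tile of level `n` containing `p` up to `p`, the gauge of the transfer
matrix grows at most exponentially in the sum of the partial quotients. -/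
theorem levelGauge_transferTo_le (hch : ∀ n, SlopeChain b θ n) (hF : IsStaircase (θ 0) F)
    (h : ∀ n k, ¬ Escapes b lam E n k) (p : ℤ) (n : ℕ) :
    ∃ k, tileStart b F n k ≤ p ∧ p < tileStart b F n (k + 1) ∧
      levelGauge b lam E n (transferTo (stairPotential lam F) E (tileStart b F n k) p)
        ≤ levelGauge b lam E 0 1 * levelFactor ‖lam‖ ^ (∑ i ∈ Finset.range n, (b i + 1)) := by
  set κ := tileFactor ‖lam‖ with hκ
  have hκ1 : 1 ≤ κ := one_le_tileFactor (norm_nonneg _)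
  have hκ0 : 0 ≤ κ := zero_le_one.trans hκ1
  induction n with
  | zero => exact ⟨p, le_rfl, by simp [tileStart], by simp [tileStart, transferTo, transfer]⟩
  | succ n ih =>
    obtain ⟨k, hk, hk', hW⟩ := ih
    have hc := hch (n + 1)
    have hmono := (hch n).tileStart_strictMono hF
    obtain ⟨k', hle, hlt⟩ := exists_mem_step (hc.tileIndex_strictMono hF) k
    refine ⟨k', (hmono.monotone hle).trans hk, hk'.trans_le (hmono.monotone (by omega)), ?_⟩
    refine (levelGauge_succ_le h n _).trans ?_
    have hcount : (k - tileIndex b F n k').toNat ≤ b n + 1 := by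
      rw [tileIndex_succ'] at hlt
      have := hc.tileType_eq_or hF k'
      omega
    have h1 := levelGauge_transferTo_sub (E := E) (hch n) hF h p k hk
      (k - tileIndex b F n k').toNat
    rw [show k - ((k - tileIndex b F n k').toNat : ℤ) = tileIndex b F n k' by omega] at h1
    have hw0 : 0 ≤ levelGauge b lam E 0 1 * levelFactor ‖lam‖ ^ (∑ i ∈ Finset.range n, (b i + 1)) :=
      (levelGauge_nonneg _ _).trans hW
    have h2 : (4 : ℝ) * κ ^ (2 * b n + 3) * κ ^ (b n + 1) ≤ levelFactor ‖lam‖ ^ (b n + 1) := by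
      rw [mul_assoc, ← pow_add, levelFactor, ← pow_mul, ← hκ, mul_pow]
      refine mul_le_mul ?_ (pow_le_pow_right₀ hκ1 (by omega)) (by positivity) (by positivity)
      calc (4 : ℝ) = 4 ^ 1 := by norm_num
        _ ≤ 4 ^ (4 * (b n + 1)) := pow_le_pow_right₀ (by norm_num) (by omega)
    set G := levelGauge b lam E 0 1 * levelFactor ‖lam‖ ^ (∑ i ∈ Finset.range n, (b i + 1)) with hG
    have h3 : levelGauge b lam E n
        (transferTo (stairPotential lam F) E (tileStart b F n (tileIndex b F n k')) p)
        ≤ κ ^ (b n + 1) * G :=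
      h1.trans (mul_le_mul (pow_le_pow_right₀ hκ1 hcount) hW (levelGauge_nonneg _ _)
        (by positivity))
    calc 4 * κ ^ (2 * b n + 3) * levelGauge b lam E n
          (transferTo (stairPotential lam F) E (tileStart b F n (tileIndex b F n k')) p)
        ≤ 4 * κ ^ (2 * b n + 3) * (κ ^ (b n + 1) * G) :=
          mul_le_mul_of_nonneg_left h3 (by positivity)
      _ = 4 * κ ^ (2 * b n + 3) * κ ^ (b n + 1) * G := by ring
      _ ≤ levelFactor ‖lam‖ ^ (b n + 1) * G := mul_le_mul_of_nonneg_right h2 hw0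
      _ = _ := by
          rw [hG, Finset.sum_range_succ, pow_add _ (∑ i ∈ Finset.range n, (b i + 1)) (b n + 1)]
          ring

/-- Transfer matrices over a distance shorter than the tiles of level `m`. -/
theorem entrySum_transferTo_le (hch : ∀ n, SlopeChain b θ n) (hF : IsStaircase (θ 0) F)
    (h : ∀ n k, ¬ Escapes b lam E n k) {j p : ℤ} (hjp : j ≤ p) (m : ℕ)
    (hm : p - j < (tileLen b m).1) :
    entrySum (transferTo (stairPotential lam F) E j p) ≤ tileFactor ‖lam‖ *
      (levelGauge b lam E 0 1 * levelFactor ‖lam‖ ^ (∑ i ∈ Finset.range m, (b i + 1))) ^ 2 := by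
  obtain ⟨k, hk, hk', hW⟩ := levelGauge_transferTo_le (E := E) hch hF h j m
  obtain ⟨l, hl, hl', hW'⟩ := levelGauge_transferTo_le (E := E) hch hF h p m
  set G := levelGauge b lam E 0 1 * levelFactor ‖lam‖ ^ (∑ i ∈ Finset.range m, (b i + 1))
  have hG : 0 ≤ G := (levelGauge_nonneg _ _).trans hW
  have hκ1 := one_le_tileFactor (norm_nonneg lam)
  have hmono := (hch m).tileStart_strictMono hF
  have hkl : k ≤ l := by
    have := hmono.lt_iff_lt.1 (hk.trans_lt (hjp.trans_lt hl'))
    omega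
  have hlk : l ≤ k + 1 := by
    have h1 := (hch m).tileStart_succ hF (k + 1)
    have h2 := tileLen_pos b m
    have h3 : (tileLen b m).1 ≤ tileStart b F m (k + 1 + 1) - tileStart b F m (k + 1) := by
      rcases (hch m).tileType_eq_or hF (k + 1) with ht | ht <;> rw [ht] at h1 <;> omega
    have := hmono.lt_iff_lt.1 (hl.trans_lt (show p < tileStart b F m (k + 1 + 1) by omega))
    omega
  have h1 := levelGauge_transferTo_sub (E := E) (hch m) hF h p l hl (l - k).toNat
  rw [show l - ((l - k).toNat : ℤ) = k by omega] at h1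
  have hsp : entrySum (transferTo (stairPotential lam F) E (tileStart b F m k) p)
      ≤ tileFactor ‖lam‖ * G := by
    refine (entrySum_le_tileGauge _ _ _).trans (h1.trans ?_)
    refine mul_le_mul ?_ hW' (levelGauge_nonneg _ _) (by linarith)
    calc _ ≤ tileFactor ‖lam‖ ^ 1 := pow_le_pow_right₀ hκ1 (by omega)
      _ = _ := pow_one _
  have hsj := (entrySum_le_tileGauge _ _ _).trans hW
  have hmul := transferTo_mul (stairPotential lam F) E hk hjp
  have hinv : transferTo (stairPotential lam F) E j p
      = transferTo (stairPotential lam F) E (tileStart b F m k) p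
        * (transferTo (stairPotential lam F) E (tileStart b F m k) j).adjugate := by
    rw [hmul, Matrix.mul_assoc, Matrix.mul_adjugate]
    unfold transferTo
    rw [det_transfer, one_smul, mul_one]
  rw [hinv]
  refine (entrySum_mul _ _).trans ?_
  rw [entrySum_adjugate, pow_two, ← mul_assoc]
  exact mul_le_mul hsp hsj (entrySum_nonneg _) (mul_nonneg (by linarith) hG)

end Growth

/-! ### Growth of the tile lengths -/

theorem tileLen_le_two_mul (b : ℕ → ℕ) (n : ℕ) : (tileLen b n).2 ≤ 2 * (tileLen b n).1 := by
  cases n with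
  | zero => simp [tileLen]
  | succ n => have := tileLen_pos b n; simp only [tileLen]; omega

theorem two_mul_tileLen_le (b : ℕ → ℕ) (n : ℕ) : 2 * (tileLen b n).1 ≤ (tileLen b (n + 2)).1 := by
  have := tileLen_pos b n
  simp only [tileLen]
  nlinarith [Nat.zero_le (b (n + 1) * (b n * (tileLen b n).1 + (tileLen b n).2)),
    Nat.zero_le (b n * (tileLen b n).1)]

theorem tileLen_mono (b : ℕ → ℕ) : Monotone fun n => (tileLen b n).1 :=
  monotone_nat_of_le_succ fun n => by have := tileLen_pos b n; simp only [tileLen]; omega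

theorem two_pow_le_tileLen (b : ℕ → ℕ) (n : ℕ) : 2 ^ (n / 2) ≤ (tileLen b n).1 := by
  induction n using Nat.strong_induction_on with
  | _ n ih =>
    rcases Nat.lt_or_ge n 2 with hn | hn
    · rw [Nat.div_eq_of_lt hn, pow_zero]; exact (tileLen_pos b n).1
    · obtain ⟨n, rfl⟩ : ∃ n', n = n' + 2 := ⟨n - 2, by omega⟩
      rw [show (n + 2) / 2 = n / 2 + 1 by omega, pow_succ']
      exact (Nat.mul_le_mul_left 2 (ih n (by omega))).trans (two_mul_tileLen_le b n)

theorem tileLen_le_two_pow (b : ℕ → ℕ) (n : ℕ) :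
    (tileLen b n).1 ≤ 2 ^ (∑ i ∈ Finset.range n, (b i + 1)) := by
  induction n with
  | zero => simp [tileLen]
  | succ n ih =>
    have h1 := tileLen_le_two_mul b n
    have h2 : b n + 2 ≤ 2 ^ (b n + 1) := by
      have := Nat.lt_two_pow_self (n := b n)
      have := Nat.lt_two_pow_self (n := b n + 1)
      omega
    rw [Finset.sum_range_succ, pow_add]
    calc (tileLen b (n + 1)).1 ≤ (tileLen b n).1 * (b n + 2) := by simp only [tileLen]; nlinarith
      _ ≤ _ := Nat.mul_le_mul ih h2

/-! ### The continued fraction expansion -/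

/-- The Gauss map. -/
def gaussMap (x : ℝ) : ℝ := Int.fract x⁻¹

theorem irrational_fract {x : ℝ} (hx : Irrational x) : Irrational (Int.fract x) := by
  rw [Int.fract]
  exact hx.sub_intCast _

theorem of_s_get?_eq {x : ℝ} (hx : Irrational x) (n : ℕ) : (GenContFract.of x).s.get? n
    = some ⟨1, ((⌊(gaussMap^[n] (Int.fract x))⁻¹⌋ : ℤ) : ℝ)⟩ := by
  induction n generalizing x with
  | zero => exact GenContFract.of_s_head (irrational_fract hx).ne_zero
  | succ n ih =>
    rw [GenContFract.of_s_succ, ih (irrational_fract hx).inv, Function.iterate_succ_apply]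
    rfl

theorem partialQuotient_succ {x : ℝ} (hx : Irrational x) (n : ℕ) :
    partialQuotient x (n + 1) = ((⌊(gaussMap^[n] (Int.fract x))⁻¹⌋ : ℤ) : ℝ) := by
  rw [partialQuotient, Nat.add_sub_cancel, GenContFract.partDen_eq_s_b (of_s_get?_eq hx n)]
  rfl

/-- The Gauss orbit of an irrational number of the unit interval. -/
theorem exists_slopeChain {x : ℝ} (hx : Irrational x) (h0 : 0 ≤ x) (h1 : x < 1) :
    ∃ (b : ℕ → ℕ) (θ : ℕ → ℝ), θ 0 = x ∧ (∀ n, SlopeChain b θ n) ∧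
      ∀ n, partialQuotient x (n + 1) = b n + 1 := by
  have hfr : Int.fract x = x := Int.fract_eq_self.2 ⟨h0, h1⟩
  have hirr : ∀ n, Irrational (gaussMap^[n] x) := by
    intro n
    induction n with
    | zero => exact hx
    | succ n ih => rw [Function.iterate_succ_apply']; exact irrational_fract ih.inv
  have hmem : ∀ n, 0 < gaussMap^[n] x ∧ gaussMap^[n] x < 1 := by
    intro n
    refine ⟨lt_of_le_of_ne ?_ (hirr n).ne_zero.symm, ?_⟩ <;> cases n with
    | zero => assumption
    | succ n =>
      rw [Function.iterate_succ_apply']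
      first | exact Int.fract_nonneg _ | exact Int.fract_lt_one _
  have hfl : ∀ n, 1 ≤ ⌊(gaussMap^[n] x)⁻¹⌋ := by
    intro n
    rw [Int.le_floor, Int.cast_one]
    exact (one_le_inv₀ (hmem n).1).2 (hmem n).2.le
  have hb : ∀ n, (((⌊(gaussMap^[n] x)⁻¹⌋ - 1).toNat : ℕ) : ℝ) + 1 = ⌊(gaussMap^[n] x)⁻¹⌋ := by
    intro n
    have : (((⌊(gaussMap^[n] x)⁻¹⌋ - 1).toNat : ℕ) : ℤ) + 1 = ⌊(gaussMap^[n] x)⁻¹⌋ := by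
      have := hfl n
      omega
    exact_mod_cast this
  refine ⟨fun n => (⌊(gaussMap^[n] x)⁻¹⌋ - 1).toNat, fun n => gaussMap^[n] x, rfl,
    fun n => ⟨fun i _ => (hmem i).1.le, fun i _ => (hmem i).2.le, fun i _ => ?_⟩, fun n => ?_⟩
  · rw [hb, Function.iterate_succ_apply', gaussMap, Int.floor_add_fract,
      mul_inv_cancel₀ (hmem i).1.ne']
  · rw [partialQuotient_succ hx, hfr, hb]

theorem exists_sum_le_of_boundedDensity {x : ℝ} (hbd : BoundedDensity x) {b : ℕ → ℕ}
    (hb : ∀ n, partialQuotient x (n + 1) = b n + 1) :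
    ∃ D : ℕ, 1 ≤ D ∧ ∀ n, ∑ i ∈ Finset.range n, (b i + 1) ≤ D * n := by
  obtain ⟨M, hM, -⟩ := EReal.lt_iff_exists_real_btwn.1 hbd
  obtain ⟨N, hN⟩ := eventually_atTop.1 (eventually_lt_of_limsup_lt hM)
  have hsum : ∀ n, ∑ i ∈ Finset.Icc 1 n, partialQuotient x i
      = ((∑ i ∈ Finset.range n, (b i + 1) : ℕ) : ℝ) := by
    intro n
    induction n with
    | zero => simp
    | succ n ih =>
      rw [Finset.sum_Icc_succ_top (by omega), ih, hb, Finset.sum_range_succ]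
      push_cast
      ring
  refine ⟨⌈M⌉₊ + ∑ i ∈ Finset.range N, (b i + 1) + 1, by omega, fun n => ?_⟩
  rcases Nat.eq_zero_or_pos n with rfl | hn
  · simp
  rcases le_total n N with h | h
  · calc ∑ i ∈ Finset.range n, (b i + 1) ≤ ∑ i ∈ Finset.range N, (b i + 1) :=
          Finset.sum_le_sum_of_subset (Finset.range_mono h)
      _ ≤ ⌈M⌉₊ + ∑ i ∈ Finset.range N, (b i + 1) + 1 := by omega
      _ ≤ _ := Nat.le_mul_of_pos_right _ hn
  · have h1 := hN n h
    rw [EReal.coe_lt_coe_iff, hsum, div_lt_iff₀ (by exact_mod_cast hn)] at h1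
    have h2 : M ≤ ⌈M⌉₊ := Nat.le_ceil M
    have h3 : ((∑ i ∈ Finset.range n, (b i + 1) : ℕ) : ℝ) ≤ ((⌈M⌉₊ * n : ℕ) : ℝ) := by
      refine h1.le.trans ?_
      push_cast
      gcongr
    have h4 : ∑ i ∈ Finset.range n, (b i + 1) ≤ ⌈M⌉₊ * n := by exact_mod_cast h3
    refine h4.trans (Nat.mul_le_mul_right n (by omega))

/-! ### Solutions of the difference equation -/

theorem IsSolution.mulVec_transfer {V : BddSeq} {E : ℂ} {u : ℤ → ℂ} (hu : IsSolution V E u)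
    (i : ℤ) (l : ℕ) : (![u (i + l), u (i + l - 1)] : Fin 2 → ℂ)
      = (transfer (fun n => (V n : ℂ)) E i l).mulVec ![u i, u (i - 1)] := by
  induction l with
  | zero => simp [transfer]
  | succ l ih =>
    rw [transfer, ← Matrix.mulVec_mulVec, ← ih]
    have := hu (i + l)
    push_cast
    rw [← add_assoc, add_sub_cancel_right]
    ext j
    fin_cases j
    · simp
      linear_combination this
    · simp

/-- The sum of the squared moduli of `u 1, …, u N`. -/
def mass (u : ℤ → ℂ) (N : ℕ) : ℝ := ∑ j ∈ Finset.Icc 1 N, ‖u (j : ℤ)‖ ^ 2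

theorem mass_mono (u : ℤ → ℂ) : Monotone (mass u) := fun _ _ h =>
  Finset.sum_le_sum_of_subset_of_nonneg (Finset.Icc_subset_Icc_right h) fun _ _ _ => by positivity

theorem mass_nonneg (u : ℤ → ℂ) (N : ℕ) : 0 ≤ mass u N :=
  Finset.sum_nonneg fun _ _ => by positivity

theorem truncNorm_natCast (u : ℤ → ℂ) (N : ℕ) : truncNorm u N = Real.sqrt (mass u N) := by
  simp [truncNorm, mass]

theorem sqrt_mass_le_truncNorm (u : ℤ → ℂ) {L : ℝ} (hL : 0 ≤ L) :
    Real.sqrt (mass u ⌊L⌋₊) ≤ truncNorm u L := by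
  refine Real.sqrt_le_sqrt (le_add_of_nonneg_right (mul_nonneg ?_ (by positivity)))
  linarith [Nat.floor_le hL]

theorem truncNorm_le_sqrt_mass (u : ℤ → ℂ) {L : ℝ} :
    truncNorm u L ≤ Real.sqrt (mass u (⌊L⌋₊ + 1)) := by
  refine Real.sqrt_le_sqrt ?_
  rw [mass, Finset.sum_Icc_succ_top (by omega)]
  refine add_le_add_right ?_ _
  push_cast
  refine mul_le_of_le_one_left (by positivity) ?_
  linarith [Nat.lt_floor_add_one L]

theorem sum_shift_le (u : ℤ → ℂ) {N M l : ℕ} (h1 : N ≤ l) (h2 : N + l ≤ M) :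
    ∑ j ∈ Finset.Icc 1 N, ‖u ((j : ℤ) + l)‖ ^ 2 ≤ mass u M - mass u N := by
  have hsplit : mass u M - mass u N = ∑ j ∈ Finset.Ioc N M, ‖u (j : ℤ)‖ ^ 2 := by
    have h := Finset.sum_Ioc_consecutive (fun j : ℕ => ‖u (j : ℤ)‖ ^ 2) (Nat.zero_le N)
      (show N ≤ M by omega)
    unfold mass
    change (∑ j ∈ Finset.Ioc 0 M, _) - (∑ j ∈ Finset.Ioc 0 N, _) = _
    rw [← h]
    ring
  rw [hsplit]
  have : ∑ j ∈ Finset.Icc 1 N, ‖u ((j : ℤ) + l)‖ ^ 2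
      = ∑ j ∈ (Finset.Icc 1 N).image (· + l), ‖u (j : ℤ)‖ ^ 2 := by
    rw [Finset.sum_image fun _ _ _ _ h => Nat.add_right_cancel h]
    push_cast
    rfl
  rw [this]
  refine Finset.sum_le_sum_of_subset_of_nonneg (fun j hj => ?_) fun _ _ _ => by positivity
  obtain ⟨i, hi, rfl⟩ := Finset.mem_image.1 hj
  rw [Finset.mem_Icc] at hi
  rw [Finset.mem_Ioc]
  omega

/-! ### The lower bound -/

section Lower

variable {b : ℕ → ℕ} {θ : ℕ → ℝ} {F : ℤ → ℤ} {E : ℂ} {lam : ℂ} {V : BddSeq}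

/-- The two-block Gordon argument: a solution at `j` is controlled by its values at distances
`l` and `2 l`, where `l` is one of the six tile lengths of three consecutive levels. -/
theorem exists_norm_le (hch : ∀ n, SlopeChain b θ n) (hF : IsStaircase (θ 0) F)
    (hV : ∀ n, (V n : ℂ) = stairPotential lam F n) (h : ∀ n k, ¬ Escapes b lam E n k)
    {u : ℤ → ℂ} (hu : IsSolution V E u) (n : ℕ) (j : ℤ) :
    ∃ m ∈ Finset.Icc (n + 1) (n + 3), ∃ l : ℕ, (l = (tileLen b m).1 ∨ l = (tileLen b m).2) ∧
      ‖u j‖ ≤ traceBound ‖lam‖ * (‖u (j + l)‖ + ‖u (j + (2 * l : ℕ))‖) := by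
  obtain ⟨m, hm1, hm2, k, hk, hk', hle⟩ := (hch (n + 3)).exists_square hF j
  have hcm := hch m
  have hs := hcm.tileStart_succ hF k
  have htile := hcm.transfer_tile hF lam E k
  have hT := trace_le_of_not_escapes h m
  set s := tileStart b F m k with hsdef
  obtain ⟨l, hl, hlen, htr⟩ : ∃ l : ℕ, (l = (tileLen b m).1 ∨ l = (tileLen b m).2) ∧
      tileStart b F m (k + 1) = s + l ∧
      ‖(transfer (stairPotential lam F) E s l).trace‖ ≤ traceBound ‖lam‖ := by
    rcases hcm.tileType_eq_or hF k with ht | ht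
    · refine ⟨_, Or.inl rfl, by rw [hs, ht]; ring, ?_⟩
      rw [htile.1 ht]
      exact hT.1
    · refine ⟨_, Or.inr rfl, by rw [hs, ht]; ring, ?_⟩
      rw [htile.2 ht]
      have := hT.2.1
      rwa [trC, pow_one] at this
  refine ⟨m, Finset.mem_Icc.2 ⟨hm1, hm2⟩, l, hl, ?_⟩
  obtain ⟨i, rfl⟩ : ∃ i : ℕ, j = s + i := ⟨(j - s).toNat, by omega⟩
  -- both `s` and `s + l` are tile starts, so the word at `s` repeats up to `|A| + |B| - 2` letters
  have hrep : ∀ r : ℤ, 0 ≤ r → r < i + l →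
      stairPotential lam F (s + r) = stairPotential lam F (s + l + r) := by
    intro r h0 hr
    have := (hcm.increment_eq hF).2 k (k + 1) r h0 (by omega)
    rw [hlen] at this
    simp only [tileType, stair] at this
    simp only [stairPotential]
    rw [this]
  have htr' : ‖(transfer (stairPotential lam F) E (s + i) l).trace‖ ≤ traceBound ‖lam‖ := by
    rwa [trace_transfer_add (by omega) fun r h0 hr => hrep r h0 (by omega)]
  have hsq : transfer (stairPotential lam F) E (s + i + l) l
      = transfer (stairPotential lam F) E (s + i) l :=
    transfer_congr fun r h0 hr => by
      rw [show s + i + l + r = s + l + (i + r) by ring, ← hrep (i + r) (by omega) (by omega),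
        add_assoc]
  have hVf : (fun n => (V n : ℂ)) = stairPotential lam F := funext hV
  have e1 := hu.mulVec_transfer (s + i) l
  have e2 := hu.mulVec_transfer (s + i + l) l
  rw [hVf] at e1 e2
  rw [hsq, e1, Matrix.mulVec_mulVec, mul_self_of_det_eq_one (det_transfer _ _ _ _),
    Matrix.sub_mulVec, Matrix.smul_mulVec, Matrix.one_mulVec, ← e1] at e2
  have e3 := congrFun e2 0
  simp at e3
  have e4 : u (s + i) = (transfer (stairPotential lam F) E (s + i) l).trace * u (s + i + l)
      - u (s + i + (2 * l : ℕ)) := by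
    push_cast
    rw [show s + (i : ℤ) + 2 * l = s + i + l + l by ring, e3]
    ring
  rw [e4]
  refine (norm_sub_le _ _).trans ?_
  rw [norm_mul, mul_add]
  refine add_le_add (by gcongr) (le_mul_of_one_le_left (norm_nonneg _)
    (one_le_traceBound (norm_nonneg _)))

/-- Mass reproduction over a bounded number of levels. -/
theorem mass_reproduction (hch : ∀ n, SlopeChain b θ n) (hF : IsStaircase (θ 0) F)
    (hV : ∀ n, (V n : ℂ) = stairPotential lam F n) (h : ∀ n k, ¬ Escapes b lam E n k)
    {u : ℤ → ℂ} (hu : IsSolution V E u) (n : ℕ) :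
    (1 + 1 / (24 * traceBound ‖lam‖ ^ 2)) * mass u (tileLen b (n + 1)).1
      ≤ mass u (tileLen b (n + 9)).1 := by
  set K := traceBound ‖lam‖ with hK
  have hK1 : 1 ≤ K := one_le_traceBound (norm_nonneg _)
  set N := (tileLen b (n + 1)).1 with hN
  set M := (tileLen b (n + 9)).1 with hM
  have hbase : ∀ j : ℤ, ‖u j‖ ^ 2 ≤ ∑ m ∈ Finset.Icc (n + 1) (n + 3), 2 * K ^ 2 *
      ((‖u (j + (tileLen b m).1)‖ ^ 2 + ‖u (j + (2 * (tileLen b m).1 : ℕ))‖ ^ 2) +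
        (‖u (j + (tileLen b m).2)‖ ^ 2 + ‖u (j + (2 * (tileLen b m).2 : ℕ))‖ ^ 2)) := by
    intro j
    obtain ⟨m, hm, l, hl, hle⟩ := exists_norm_le hch hF hV h hu n j
    refine le_trans ?_ (Finset.single_le_sum (f := fun m => 2 * K ^ 2 *
      ((‖u (j + (tileLen b m).1)‖ ^ 2 + ‖u (j + (2 * (tileLen b m).1 : ℕ))‖ ^ 2) +
        (‖u (j + (tileLen b m).2)‖ ^ 2 + ‖u (j + (2 * (tileLen b m).2 : ℕ))‖ ^ 2)))
      (fun _ _ => by positivity) hm)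
    have hsq : ‖u j‖ ^ 2 ≤ 2 * K ^ 2 * (‖u (j + l)‖ ^ 2 + ‖u (j + (2 * l : ℕ))‖ ^ 2) := by
      calc ‖u j‖ ^ 2 ≤ (K * (‖u (j + l)‖ + ‖u (j + (2 * l : ℕ))‖)) ^ 2 := by gcongr
        _ ≤ _ := by
          rw [mul_pow, mul_comm 2 (K ^ 2), mul_assoc]
          refine mul_le_mul_of_nonneg_left ?_ (by positivity)
          nlinarith [sq_nonneg (‖u (j + l)‖ - ‖u (j + (2 * l : ℕ))‖)]
    refine hsq.trans (mul_le_mul_of_nonneg_left ?_ (by positivity))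
    rcases hl with rfl | rfl
    · exact le_add_of_nonneg_right (by positivity)
    · exact le_add_of_nonneg_left (by positivity)
  have hgrow : 8 * (tileLen b (n + 3)).1 ≤ M := by
    have h1 := two_mul_tileLen_le b (n + 3)
    have h2 := two_mul_tileLen_le b (n + 5)
    have h3 := two_mul_tileLen_le b (n + 7)
    rw [show n + 3 + 2 = n + 5 by ring] at h1
    rw [show n + 5 + 2 = n + 7 by ring] at h2
    rw [show n + 7 + 2 = n + 9 by ring] at h3
    omega
  have hshift : ∀ m ∈ Finset.Icc (n + 1) (n + 3), ∀ l : ℕ,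
      (l = (tileLen b m).1 ∨ l = (tileLen b m).2) →
      ∑ j ∈ Finset.Icc 1 N, ‖u ((j : ℤ) + l)‖ ^ 2 ≤ mass u M - mass u N ∧
      ∑ j ∈ Finset.Icc 1 N, ‖u ((j : ℤ) + (2 * l : ℕ))‖ ^ 2 ≤ mass u M - mass u N := by
    intro m hm l hl
    rw [Finset.mem_Icc] at hm
    have h1 : N ≤ (tileLen b m).1 := tileLen_mono b hm.1
    have h2 : (tileLen b m).1 ≤ (tileLen b (n + 3)).1 := tileLen_mono b hm.2
    have h3 := tileLen_le_two_mul b m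
    have h4 := (tileLen_pos b m).2
    exact ⟨sum_shift_le u (by omega) (by omega), sum_shift_le u (by omega) (by omega)⟩
  have hsum : mass u N ≤ 24 * K ^ 2 * (mass u M - mass u N) := by
    calc mass u N ≤ ∑ j ∈ Finset.Icc 1 N, ∑ m ∈ Finset.Icc (n + 1) (n + 3), 2 * K ^ 2 *
          ((‖u ((j : ℤ) + (tileLen b m).1)‖ ^ 2 + ‖u (j + (2 * (tileLen b m).1 : ℕ))‖ ^ 2) +
          (‖u (j + (tileLen b m).2)‖ ^ 2 + ‖u (j + (2 * (tileLen b m).2 : ℕ))‖ ^ 2)) :=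
          Finset.sum_le_sum fun j _ => hbase j
      _ = ∑ m ∈ Finset.Icc (n + 1) (n + 3), 2 * K ^ 2 *
          ((∑ j ∈ Finset.Icc 1 N, ‖u ((j : ℤ) + (tileLen b m).1)‖ ^ 2
            + ∑ j ∈ Finset.Icc 1 N, ‖u ((j : ℤ) + (2 * (tileLen b m).1 : ℕ))‖ ^ 2) +
          (∑ j ∈ Finset.Icc 1 N, ‖u ((j : ℤ) + (tileLen b m).2)‖ ^ 2
            + ∑ j ∈ Finset.Icc 1 N, ‖u ((j : ℤ) + (2 * (tileLen b m).2 : ℕ))‖ ^ 2)) := by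
          rw [Finset.sum_comm]
          simp only [← Finset.mul_sum, Finset.sum_add_distrib]
      _ ≤ ∑ m ∈ Finset.Icc (n + 1) (n + 3), 2 * K ^ 2 * (4 * (mass u M - mass u N)) := by
          refine Finset.sum_le_sum fun m hm => mul_le_mul_of_nonneg_left ?_ (by positivity)
          have h1 := hshift m hm _ (Or.inl rfl)
          have h2 := hshift m hm _ (Or.inr rfl)
          linarith [h1.1, h1.2, h2.1, h2.2]
      _ = _ := by
          rw [Finset.sum_const, Nat.card_Icc, show n + 3 + 1 - (n + 1) = 3 by omega]
          ring
  have hKpos : 0 < 24 * K ^ 2 := by positivity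
  rw [add_mul, one_mul, one_div_mul_eq_div, ← le_sub_iff_add_le', div_le_iff₀ hKpos]
  linarith

theorem mass_lower_bound (hch : ∀ n, SlopeChain b θ n) (hF : IsStaircase (θ 0) F)
    (hV : ∀ n, (V n : ℂ) = stairPotential lam F n) (h : ∀ n k, ¬ Escapes b lam E n k)
    {u : ℤ → ℂ} (hu : IsSolution V E u) (k : ℕ) :
    (1 + 1 / (24 * traceBound ‖lam‖ ^ 2)) ^ k * mass u 2
      ≤ mass u (tileLen b (8 * k + 2)).1 := by
  obtain ⟨c, hc⟩ : ∃ c, c = 1 + 1 / (24 * traceBound ‖lam‖ ^ 2) := ⟨_, rfl⟩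
  have hc0 : 0 ≤ c := hc ▸ by positivity
  have hstep : ∀ k : ℕ, c * mass u (tileLen b (8 * k + 2)).1
      ≤ mass u (tileLen b (8 * (k + 1) + 2)).1 := by
    intro k
    have := mass_reproduction hch hF hV h hu (8 * k + 1)
    rwa [← hc, show 8 * k + 1 + 1 = 8 * k + 2 by ring,
      show 8 * k + 1 + 9 = 8 * (k + 1) + 2 by ring] at this
  rw [← hc]
  induction k with
  | zero =>
    rw [pow_zero, one_mul]
    refine mass_mono u ?_
    have := two_mul_tileLen_le b 0
    simpa [tileLen] using this
  | succ k ih =>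
    calc c ^ (k + 1) * mass u 2 = c * (c ^ k * mass u 2) := by ring
      _ ≤ c * mass u (tileLen b (8 * k + 2)).1 := mul_le_mul_of_nonneg_left ih hc0
      _ ≤ _ := hstep k

/-- A normalized solution has a definite amount of mass on `{1, 2}`. -/
theorem one_le_mul_mass_two {V : BddSeq} {E : ℂ} {u : ℤ → ℂ} (hu : IsSolution V E u)
    (hn : ‖u 0‖ ^ 2 + ‖u 1‖ ^ 2 = 1) : 1 ≤ (2 * (‖E‖ + ‖V‖) ^ 2 + 3) * mass u 2 := by
  have h1 := hu 1
  norm_num at h1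
  have h0 : u 0 = (E - V 1) * u 1 - u 2 := by linear_combination h1
  have hV : ‖E - V 1‖ ≤ ‖E‖ + ‖V‖ := by
    refine (norm_sub_le _ _).trans (add_le_add_right ?_ _)
    rw [Complex.norm_real]
    exact lp.norm_apply_le_norm ENNReal.top_ne_zero V 1
  have h2 : ‖u 0‖ ≤ (‖E‖ + ‖V‖) * ‖u 1‖ + ‖u 2‖ := by
    rw [h0]
    refine (norm_sub_le _ _).trans ?_
    rw [norm_mul]
    gcongr
  have hm : mass u 2 = ‖u 1‖ ^ 2 + ‖u 2‖ ^ 2 := by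
    simp [mass, Finset.sum_Icc_succ_top]
  have h3 : ‖u 0‖ ^ 2 ≤ ((‖E‖ + ‖V‖) * ‖u 1‖ + ‖u 2‖) ^ 2 := by gcongr
  rw [hm]
  nlinarith [sq_nonneg ((‖E‖ + ‖V‖) * ‖u 1‖ - ‖u 2‖), sq_nonneg ((‖E‖ + ‖V‖) * ‖u 2‖)]

end Lower

/-! ### Power-law bounds -/

section PowerLaw

variable {b : ℕ → ℕ} {θ : ℕ → ℝ} {F : ℤ → ℤ} {E : ℂ} {lam : ℂ} {V : BddSeq}

/-- Polynomial bound for the transfer matrices: the distance `N` is at least exponential in the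
number of levels needed to cover it, and the bound at most exponential. -/
theorem entrySum_transfer_le_pow (hch : ∀ n, SlopeChain b θ n) (hF : IsStaircase (θ 0) F)
    (h : ∀ n k, ¬ Escapes b lam E n k) {D g : ℕ}
    (hD : ∀ n, ∑ i ∈ Finset.range n, (b i + 1) ≤ D * n)
    (hg : levelFactor ‖lam‖ ^ (2 * D) ≤ 2 ^ g) (N : ℕ) :
    entrySum (transfer (stairPotential lam F) E 1 N)
      ≤ tileFactor ‖lam‖ * levelGauge b lam E 0 1 ^ 2 * (4 * ((N : ℝ) + 1) ^ 2) ^ g := by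
  have hex : ∃ m, N < (tileLen b m).1 := by
    refine ⟨2 * N, lt_of_lt_of_le Nat.lt_two_pow_self ?_⟩
    have := two_pow_le_tileLen b (2 * N)
    rwa [Nat.mul_div_cancel_left _ two_pos] at this
  classical
  obtain ⟨hm, hmin⟩ := And.intro (Nat.find_spec hex) (fun i => Nat.find_min hex (m := i))
  set m := Nat.find hex
  have hpow : (2 : ℝ) ^ m ≤ 4 * ((N : ℝ) + 1) ^ 2 := by
    have hN0 : (0 : ℝ) ≤ N := Nat.cast_nonneg N
    rcases Nat.eq_zero_or_pos m with h0 | hpos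
    · rw [h0, pow_zero]
      nlinarith
    · have h1 := hmin (m - 1) (by omega)
      have h2 : (2 : ℝ) ^ ((m - 1) / 2) ≤ N := by
        exact_mod_cast (two_pow_le_tileLen b (m - 1)).trans (not_lt.1 h1)
      calc (2 : ℝ) ^ m ≤ 2 ^ (2 + 2 * ((m - 1) / 2)) :=
            pow_le_pow_right₀ (by norm_num) (by omega)
        _ = 4 * (2 ^ ((m - 1) / 2)) ^ 2 := by rw [pow_add, mul_comm 2, pow_mul]; norm_num
        _ ≤ 4 * ((N : ℝ) + 1) ^ 2 := by
          gcongr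
          linarith
  have hκ := one_le_tileFactor (norm_nonneg lam)
  have hφ := one_le_levelFactor (norm_nonneg lam)
  have h1 := entrySum_transferTo_le hch hF h (j := 1) (p := 1 + N) (by omega) m (by omega)
  rw [transferTo, add_sub_cancel_left, Int.toNat_natCast] at h1
  refine h1.trans ?_
  rw [mul_pow, ← mul_assoc]
  refine mul_le_mul_of_nonneg_left ?_ (by positivity)
  calc (levelFactor ‖lam‖ ^ (∑ i ∈ Finset.range m, (b i + 1))) ^ 2
      = levelFactor ‖lam‖ ^ (2 * ∑ i ∈ Finset.range m, (b i + 1)) := by rw [← pow_mul, mul_comm]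
    _ ≤ levelFactor ‖lam‖ ^ (2 * D * m) := by
        refine pow_le_pow_right₀ hφ ?_
        have := hD m
        rw [mul_assoc]
        omega
    _ = (levelFactor ‖lam‖ ^ (2 * D)) ^ m := pow_mul _ _ _
    _ ≤ (2 ^ g) ^ m := by gcongr
    _ = (2 ^ m) ^ g := by rw [← pow_mul, ← pow_mul, mul_comm]
    _ ≤ _ := by gcongr

theorem truncNorm_le_rpow (hch : ∀ n, SlopeChain b θ n) (hF : IsStaircase (θ 0) F)
    (hV : ∀ n, (V n : ℂ) = stairPotential lam F n)
    (h : ∀ n k, ¬ Escapes b lam E n k) {D g : ℕ}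
    (hD : ∀ n, ∑ i ∈ Finset.range n, (b i + 1) ≤ D * n)
    (hg : levelFactor ‖lam‖ ^ (2 * D) ≤ 2 ^ g) :
    ∃ C > 0, ∀ u : ℤ → ℂ, IsSolution V E u → ‖u 0‖ ^ 2 + ‖u 1‖ ^ 2 = 1 → ∀ L : ℝ, 1 ≤ L →
      truncNorm u L ≤ C * L ^ ((2 * g + 1 : ℕ) : ℝ) := by
  set C₀ := tileFactor ‖lam‖ * levelGauge b lam E 0 1 ^ 2 * 4 ^ g with hC₀
  have hκ := one_le_tileFactor (norm_nonneg lam)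
  have hC₀nn : 0 ≤ C₀ := by positivity
  refine ⟨C₀ * 2 ^ (2 * g + 1) + 1, by positivity, fun u hu hn L hL => ?_⟩
  have hVf : (fun n => (V n : ℂ)) = stairPotential lam F := funext hV
  have hu0 : ‖u 0‖ ≤ 1 := by nlinarith [norm_nonneg (u 0), sq_nonneg ‖u 1‖]
  have hu1 : ‖u 1‖ ≤ 1 := by nlinarith [norm_nonneg (u 1), sq_nonneg ‖u 0‖]
  have hpt : ∀ N : ℕ, ‖u (1 + N)‖ ≤ C₀ * ((N : ℝ) + 1) ^ (2 * g) := by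
    intro N
    have h1 := entrySum_transfer_le_pow hch hF h hD hg N
    have h2 := congrFun (hu.mulVec_transfer 1 N) 0
    rw [hVf] at h2
    set T := transfer (stairPotential lam F) E 1 N
    simp [Matrix.mulVec, dotProduct, Fin.sum_univ_two] at h2
    have h3 : ‖u (1 + N)‖ ≤ entrySum T := by
      rw [h2]
      refine (norm_add_le _ _).trans ?_
      rw [norm_mul, norm_mul, entrySum]
      have := mul_le_of_le_one_right (norm_nonneg (T 0 0)) hu1
      have := mul_le_of_le_one_right (norm_nonneg (T 0 1)) hu0
      linarith [norm_nonneg (T 1 0), norm_nonneg (T 1 1)]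
    refine h3.trans (h1.trans_eq ?_)
    rw [hC₀, mul_pow, ← pow_mul]
    ring
  refine truncNorm_le_sqrt_mass u |>.trans ?_
  set M := ⌊L⌋₊ + 1 with hM
  have hM1 : (1 : ℝ) ≤ M := by rw [hM]; push_cast; linarith [Nat.cast_nonneg (α := ℝ) ⌊L⌋₊]
  have hM2 : (M : ℝ) ≤ 2 * L := by
    have := Nat.floor_le (show 0 ≤ L by linarith)
    rw [hM]; push_cast; linarith
  have hmass : mass u M ≤ (C₀ * (M : ℝ) ^ (2 * g + 1)) ^ 2 := by
    calc mass u M ≤ ∑ j ∈ Finset.Icc 1 M, (C₀ * (M : ℝ) ^ (2 * g)) ^ 2 := by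
          refine Finset.sum_le_sum fun j hj => ?_
          rw [Finset.mem_Icc] at hj
          obtain ⟨N, rfl⟩ : ∃ N, j = 1 + N := ⟨j - 1, by omega⟩
          have h1 := hpt N
          have h2 : ((N : ℝ) + 1) ≤ M := by exact_mod_cast (by omega : N + 1 ≤ M)
          push_cast
          have h3 : ‖u (1 + N)‖ ≤ C₀ * (M : ℝ) ^ (2 * g) := h1.trans (by gcongr)
          gcongr
      _ = M * (C₀ * (M : ℝ) ^ (2 * g)) ^ 2 := by simp
      _ ≤ (M : ℝ) ^ 2 * (C₀ * (M : ℝ) ^ (2 * g)) ^ 2 := by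
          gcongr
          nlinarith
      _ = _ := by ring
  refine (Real.sqrt_le_sqrt hmass).trans ?_
  rw [Real.sqrt_sq (by positivity), Real.rpow_natCast]
  calc C₀ * (M : ℝ) ^ (2 * g + 1) ≤ C₀ * (2 * L) ^ (2 * g + 1) := by gcongr
    _ = C₀ * 2 ^ (2 * g + 1) * L ^ (2 * g + 1) := by rw [mul_pow]; ring
    _ ≤ _ := by
      have : 0 ≤ L ^ (2 * g + 1) := by positivity
      linarith

theorem rpow_le_truncNorm (hch : ∀ n, SlopeChain b θ n) (hF : IsStaircase (θ 0) F)
    (hV : ∀ n, (V n : ℂ) = stairPotential lam F n)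
    (h : ∀ n k, ¬ Escapes b lam E n k) {D : ℕ} {γ : ℝ} (hγ : 0 < γ)
    (hD : ∀ n, ∑ i ∈ Finset.range n, (b i + 1) ≤ D * n)
    (hγD : (2 : ℝ) ^ (16 * D * γ) = 1 + 1 / (24 * traceBound ‖lam‖ ^ 2)) :
    ∃ C > 0, ∀ u : ℤ → ℂ, IsSolution V E u → ‖u 0‖ ^ 2 + ‖u 1‖ ^ 2 = 1 →
      ∀ L : ℝ, (tileLen b 2).1 ≤ L → C * L ^ γ ≤ truncNorm u L := by
  set Q := 2 * (‖E‖ + ‖V‖) ^ 2 + 3 with hQ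
  have hQpos : 0 < Q := by positivity
  refine ⟨Real.sqrt (1 / (Q * 2 ^ (20 * D * γ))), Real.sqrt_pos.2 (by positivity),
    fun u hu hn L hL => ?_⟩
  have hL0 : 0 ≤ L := (Nat.cast_nonneg _).trans hL
  refine le_trans ?_ (sqrt_mass_le_truncNorm u hL0)
  have hex : ∃ k, L < (tileLen b (8 * k + 2)).1 := by
    obtain ⟨k, hk⟩ := exists_nat_gt L
    refine ⟨k, hk.trans_le ?_⟩
    have h1 := two_pow_le_tileLen b (8 * k + 2)
    have h2 : k ≤ 2 ^ ((8 * k + 2) / 2) :=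
      (Nat.lt_two_pow_self (n := k)).le.trans (Nat.pow_le_pow_right two_pos (by omega))
    exact_mod_cast h2.trans h1
  classical
  obtain ⟨hk, hmin⟩ := And.intro (Nat.find_spec hex) (fun i => Nat.find_min hex (m := i))
  set k' := Nat.find hex
  obtain ⟨k, hkk⟩ : ∃ k, k' = k + 1 := by
    refine Nat.exists_eq_succ_of_ne_zero fun h0 => ?_
    rw [h0] at hk
    exact absurd hL (not_le.2 hk)
  rw [hkk] at hk
  have hkL : ((tileLen b (8 * k + 2)).1 : ℝ) ≤ L := not_lt.1 (hmin k (by omega))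
  have hLpow : L ≤ 2 ^ (D * (8 * k + 10)) := by
    refine hk.le.trans ?_
    have h1 := tileLen_le_two_pow b (8 * (k + 1) + 2)
    have h2 := hD (8 * (k + 1) + 2)
    rw [show 8 * (k + 1) + 2 = 8 * k + 10 by ring] at h1 h2 ⊢
    exact_mod_cast h1.trans (Nat.pow_le_pow_right two_pos h2)
  have hmass : (2 : ℝ) ^ (16 * D * γ * k) * (1 / Q) ≤ mass u ⌊L⌋₊ := by
    have h1 := mass_lower_bound hch hF hV h hu k
    have h2 : 1 / Q ≤ mass u 2 := by
      rw [div_le_iff₀ hQpos, mul_comm]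
      exact one_le_mul_mass_two hu hn
    rw [← hγD, ← Real.rpow_natCast, ← Real.rpow_mul (by norm_num)] at h1
    calc _ ≤ (2 : ℝ) ^ (16 * D * γ * k) * mass u 2 := by gcongr
      _ ≤ _ := h1.trans (mass_mono u (Nat.le_floor hkL))
  have hLγ : L ^ (2 * γ) ≤ 2 ^ (16 * D * γ * k) * 2 ^ (20 * D * γ) := by
    calc L ^ (2 * γ) ≤ ((2 : ℝ) ^ (D * (8 * k + 10))) ^ (2 * γ) := by gcongr
      _ = 2 ^ (16 * D * γ * k) * 2 ^ (20 * D * γ) := by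
        rw [← Real.rpow_natCast, ← Real.rpow_mul (by norm_num), ← Real.rpow_add (by norm_num)]
        congr 1
        push_cast
        ring
  refine Real.le_sqrt_of_sq_le (le_trans ?_ hmass)
  rw [mul_pow, Real.sq_sqrt (by positivity), ← Real.rpow_natCast (L ^ γ), ← Real.rpow_mul hL0,
    show γ * ((2 : ℕ) : ℝ) = 2 * γ by push_cast; ring, one_div, mul_inv]
  calc Q⁻¹ * (2 ^ (20 * D * γ))⁻¹ * L ^ (2 * γ)
      ≤ Q⁻¹ * (2 ^ (20 * D * γ))⁻¹ * (2 ^ (16 * D * γ * k) * 2 ^ (20 * D * γ)) := by gcongr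
    _ = _ := by
      have : (2 : ℝ) ^ (20 * D * γ) ≠ 0 := (Real.rpow_pos_of_pos two_pos _).ne'
      field_simp

end PowerLaw

theorem exists_hasPowerLawBounds {θ : ℝ} (hθ : θ ∈ Set.Ico (0 : ℝ) 1) (hirr : Irrational θ)
    (hbd : BoundedDensity θ) (lam : ℝ) :
    ∃ γ₁ γ₂ : ℝ, ∀ ρ, HasPowerLawBounds lam θ ρ γ₁ γ₂ := by
  obtain ⟨b, t, ht, hch, hb⟩ := exists_slopeChain hirr hθ.1 hθ.2
  obtain ⟨D, hD1, hD⟩ := exists_sum_le_of_boundedDensity hbd hb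
  obtain ⟨g, hg⟩ := pow_unbounded_of_one_lt (levelFactor ‖(lam : ℂ)‖ ^ (2 * D)) one_lt_two
  set c := 1 + 1 / (24 * traceBound ‖(lam : ℂ)‖ ^ 2) with hc
  have hK := one_le_traceBound (norm_nonneg (lam : ℂ))
  have hc1 : 1 < c := by rw [hc]; exact lt_add_of_pos_right _ (by positivity)
  have hDpos : (0 : ℝ) < D := by exact_mod_cast hD1
  have hγ : 0 < Real.logb 2 c / (16 * D) := div_pos (Real.logb_pos one_lt_two hc1) (by positivity)
  refine ⟨Real.logb 2 c / (16 * D), ((2 * g + 1 : ℕ) : ℝ), fun ρ =>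
    ⟨hγ, by positivity, fun E hE => ?_⟩⟩
  subst ht
  have hF : IsStaircase (t 0) (fun m : ℤ => ⌊(m : ℝ) * t 0 + ρ⌋) := isStaircase_floor _ _
  have hV : ∀ n, ((sturmianPotential lam (t 0) ρ n : ℝ) : ℂ)
      = stairPotential lam (fun m : ℤ => ⌊(m : ℝ) * t 0 + ρ⌋) n := fun n =>
    sturmianFun_eq hθ.1 hθ.2.le lam ρ n
  have hesc := not_escapes_of_mem_spectrum hch lam ρ hE
  obtain ⟨C₁, hC₁, h1⟩ := rpow_le_truncNorm hch hF hV hesc hγ hD (by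
    rw [mul_div_cancel₀ _ (by positivity), Real.rpow_logb two_pos (by norm_num) (by linarith)])
  obtain ⟨C₂, hC₂, h2⟩ := truncNorm_le_rpow hch hF hV hesc hD hg.le
  refine ⟨C₁, hC₁, C₂, hC₂, fun u hu hn => ?_⟩
  filter_upwards [eventually_ge_atTop 1, eventually_ge_atTop ((tileLen b 2).1 : ℝ)] with L hL1 hL2
  exact ⟨h1 u hu hn L hL2, h2 u hu hn L hL1⟩

/-! ### Decaying perturbations -/

section Solutions

variable (V : BddSeq) (E : ℂ)

/-- The values `(u n, u (n + 1))` of the solution with the data `(x, y)` at `(0, 1)`. -/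
def solRight (x y : ℂ) : ℕ → ℂ × ℂ
  | 0 => (x, y)
  | n + 1 => ((solRight x y n).2,
      (E - V ((n : ℤ) + 1)) * (solRight x y n).2 - (solRight x y n).1)

/-- The values `(u (-n), u (-n + 1))` of the solution with the data `(x, y)` at `(0, 1)`. -/
def solLeft (x y : ℂ) : ℕ → ℂ × ℂ
  | 0 => (x, y)
  | n + 1 => ((E - V (-(n : ℤ))) * (solLeft x y n).1 - (solLeft x y n).2, (solLeft x y n).1)

/-- The solution with the data `(x, y)` at `(0, 1)`. -/
def sol (x y : ℂ) : ℤ → ℂ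
  | Int.ofNat n => (solRight V E x y n).1
  | Int.negSucc n => (solLeft V E x y (n + 1)).1

theorem isSolution_sol (x y : ℂ) : IsSolution V E (sol V E x y) := by
  intro m
  match m with
  | Int.ofNat 0 =>
    change y + ((E - V 0) * x - y) + V 0 * x = E * x
    ring
  | Int.ofNat (n + 1) =>
    have h1 : Int.ofNat (n + 1) + 1 = Int.ofNat (n + 2) := rfl
    have h2 : Int.ofNat (n + 1) - 1 = Int.ofNat n := by simp
    rw [h1, h2]
    change (solRight V E x y (n + 2)).1 + (solRight V E x y n).1
      + V ((n : ℤ) + 1) * (solRight V E x y (n + 1)).1 = E * (solRight V E x y (n + 1)).1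
    simp only [solRight]
    ring
  | Int.negSucc 0 =>
    change x + ((E - V (-1)) * ((E - V 0) * x - y) - x) + V (-1) * ((E - V 0) * x - y)
      = E * ((E - V 0) * x - y)
    ring
  | Int.negSucc (n + 1) =>
    have h1 : Int.negSucc (n + 1) + 1 = Int.negSucc n := by omega
    have h2 : Int.negSucc (n + 1) - 1 = Int.negSucc (n + 2) := by omega
    have h3 : Int.negSucc (n + 1) = -((n + 2 : ℕ) : ℤ) := by omega
    rw [h1, h2]
    change (solLeft V E x y (n + 1)).1 + (solLeft V E x y (n + 3)).1
      + V (Int.negSucc (n + 1)) * (solLeft V E x y (n + 2)).1 = E * (solLeft V E x y (n + 2)).1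
    have h4 : (solLeft V E x y (n + 3)).1 = (E - V (-((n + 2 : ℕ) : ℤ)))
        * (solLeft V E x y (n + 2)).1 - (solLeft V E x y (n + 1)).1 := rfl
    rw [h3, h4]
    ring

variable {V E}

theorem IsSolution.eq_zero {u : ℤ → ℂ} (hu : IsSolution V E u) (h0 : u 0 = 0) (h1 : u 1 = 0)
    (n : ℤ) : u n = 0 := by
  have hr : ∀ n : ℕ, u n = 0 ∧ u (n + 1) = 0 := by
    intro n
    induction n with
    | zero => exact ⟨h0, h1⟩
    | succ n ih =>
      have := hu (n + 1)
      rw [add_sub_cancel_right, ih.1, ih.2] at this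
      push_cast
      exact ⟨ih.2, by simpa using this⟩
  have hl : ∀ n : ℕ, u (-n) = 0 ∧ u (-n + 1) = 0 := by
    intro n
    induction n with
    | zero => exact ⟨h0, h1⟩
    | succ n ih =>
      have := hu (-n)
      rw [ih.1, ih.2] at this
      push_cast
      rw [show -((n : ℤ) + 1) = -n - 1 by ring, sub_add_cancel]
      exact ⟨by simpa using this, ih.1⟩
  rcases Int.eq_nat_or_neg n with ⟨k, rfl | rfl⟩
  · exact (hr k).1
  · exact (hl k).1

theorem IsSolution.linear_comb {u v : ℤ → ℂ} (hu : IsSolution V E u) (hv : IsSolution V E v)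
    (a c : ℂ) : IsSolution V E fun n => a * u n + c * v n := fun n => by
  have h1 := hu n
  have h2 := hv n
  simp only
  linear_combination a * h1 + c * h2

end Solutions

/-- Abel summation in the form needed here: a sequence whose partial sums grow at most like `N ^ r`
is summable against every weight `n ^ (-s)` with `r < s`. -/
theorem summable_mul_rpow_of_sum_le {f : ℕ → ℝ} (hf : ∀ n, 0 ≤ f n) {r s C : ℝ} (hr : 0 < r)
    (hs : r < s) (h : ∀ᶠ N : ℕ in atTop, ∑ k ∈ Finset.Icc 1 N, f k ≤ C * (N : ℝ) ^ r) :
    Summable fun n : ℕ => f n * (n : ℝ) ^ (-s) := by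
  have hO : (fun n : ℕ => ∑ k ∈ Finset.Icc 1 n, f k) =O[atTop] fun n : ℕ => (n : ℝ) ^ r := by
    refine Asymptotics.IsBigO.of_bound C ?_
    filter_upwards [h] with N hN
    rw [Real.norm_of_nonneg (Finset.sum_nonneg fun _ _ => hf _),
      Real.norm_of_nonneg (by positivity)]
    exact hN
  have := LSeriesSummable_of_sum_norm_bigO_and_nonneg (s := (s : ℂ)) hO hf hr.le (by simpa using hs)
  refine this.norm.congr fun n => ?_
  rw [LSeries.norm_term_eq]
  split_ifs with hn
  · rw [hn, Nat.cast_zero, Real.zero_rpow (by linarith), mul_zero]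
  · rw [Complex.norm_real, Real.norm_of_nonneg (hf n), Complex.ofReal_re,
      Real.rpow_neg (Nat.cast_nonneg n), div_eq_mul_inv]

section VariationOfConstants

variable {V P : BddSeq} {E : ℂ} {φ u v : ℤ → ℂ}

/-- Discrete Gronwall estimate in both directions. -/
theorem gronwall_two_sided {s h : ℕ → ℝ} (hs : ∀ n, 0 ≤ s n) (hh : ∀ n, 0 ≤ h n)
    (hsum : Summable h) (h1 : ∀ n, s (n + 1) ≤ (1 + h n) * s n)
    (h2 : ∀ n, s n ≤ (1 + h n) * s (n + 1)) (n : ℕ) :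
    s n ≤ Real.exp (∑' i, h i) * s 0 ∧ s 0 ≤ Real.exp (∑' i, h i) * s n := by
  have hexp : ∀ n, 1 + h n ≤ Real.exp (h n) := fun n => by
    rw [add_comm]; exact Real.add_one_le_exp _
  have key : ∀ n, s n ≤ Real.exp (∑ i ∈ Finset.range n, h i) * s 0 ∧
      s 0 ≤ Real.exp (∑ i ∈ Finset.range n, h i) * s n := by
    intro n
    induction n with
    | zero => simp
    | succ n ih =>
      rw [Finset.sum_range_succ, Real.exp_add]
      have e := (Real.exp_pos (∑ i ∈ Finset.range n, h i)).le
      constructor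
      · calc s (n + 1) ≤ Real.exp (h n) * s n :=
              (h1 n).trans (mul_le_mul_of_nonneg_right (hexp n) (hs n))
          _ ≤ Real.exp (h n) * (Real.exp (∑ i ∈ Finset.range n, h i) * s 0) :=
              mul_le_mul_of_nonneg_left ih.1 (Real.exp_pos _).le
          _ = _ := by ring
      · calc s 0 ≤ Real.exp (∑ i ∈ Finset.range n, h i) * s n := ih.2
          _ ≤ Real.exp (∑ i ∈ Finset.range n, h i) * (Real.exp (h n) * s (n + 1)) :=
              mul_le_mul_of_nonneg_left
                ((h2 n).trans (mul_le_mul_of_nonneg_right (hexp n) (hs _))) e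
          _ = _ := by ring
  have hle : Real.exp (∑ i ∈ Finset.range n, h i) ≤ Real.exp (∑' i, h i) :=
    Real.exp_le_exp.2 (hsum.sum_le_tsum _ fun i _ => hh i)
  exact ⟨(key n).1.trans (mul_le_mul_of_nonneg_right hle (hs 0)),
    (key n).2.trans (mul_le_mul_of_nonneg_right hle (hs n))⟩

/-- Asymptotic integration on the right half-line: if `P (|u| + |v|) ^ 2` is summable, a solution of
the perturbed equation differs from a nontrivial combination of the unperturbed solutions `u`, `v`
by at most a multiple of the tail of that series times `|u| + |v|`. -/
theorem exists_asymptotic_solution (hφ : IsSolution (V + P) E φ) (hφ0 : φ 0 ≠ 0 ∨ φ 1 ≠ 0)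
    (hu : IsSolution V E u) (hv : IsSolution V E v) (hu0 : u 0 = 1) (hu1 : u 1 = 0)
    (hv0 : v 0 = 0) (hv1 : v 1 = 1)
    (hsum : Summable fun n : ℕ => |P ((n : ℤ) + 1)| * (‖u (n + 1)‖ + ‖v (n + 1)‖) ^ 2) :
    ∃ a c : ℂ, (a ≠ 0 ∨ c ≠ 0) ∧ ∃ S : ℝ, 0 ≤ S ∧ ∀ n : ℕ, ‖a * u n + c * v n - φ n‖ ≤
      S * (∑' m : ℕ, |P (((n + m : ℕ) : ℤ) + 1)|
        * (‖u ((n + m : ℕ) + 1)‖ + ‖v ((n + m : ℕ) + 1)‖) ^ 2) * (‖u n‖ + ‖v n‖) := by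
  set h : ℕ → ℝ := fun n => |P ((n : ℤ) + 1)| * (‖u (n + 1)‖ + ‖v (n + 1)‖) ^ 2 with hh
  have hhnn : ∀ n, 0 ≤ h n := fun n => by positivity
  have hW : ∀ n : ℕ, u n * v (n + 1) - u (n + 1) * v n = 1 := by
    intro n
    induction n with
    | zero => simp [hu0, hu1, hv0, hv1]
    | succ n ih =>
      have e1 := hu (n + 1)
      have e2 := hv (n + 1)
      rw [add_sub_cancel_right] at e1 e2
      push_cast
      linear_combination ih + u (n + 1) * e2 - v (n + 1) * e1
  set α : ℕ → ℂ := fun n => φ n * v (n + 1) - φ (n + 1) * v n with hα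
  set β : ℕ → ℂ := fun n => φ (n + 1) * u n - φ n * u (n + 1) with hβ
  have hφn : ∀ n : ℕ, φ n = α n * u n + β n * v n := fun n => by
    simp only [hα, hβ]; linear_combination -(φ n) * hW n
  have hφn1 : ∀ n : ℕ, φ (n + 1) = α n * u (n + 1) + β n * v (n + 1) := fun n => by
    simp only [hα, hβ]; linear_combination -(φ (n + 1)) * hW n
  have hPφ : ∀ n : ℕ, φ (n + 1 + 1) + φ n + (V (n + 1) + P (n + 1)) * φ (n + 1)
      = E * φ (n + 1) := fun n => by
    have := hφ (n + 1)
    rw [add_sub_cancel_right, lp.coeFn_add, Pi.add_apply] at this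
    exact_mod_cast this
  have hαs : ∀ n, α (n + 1) - α n = P ((n : ℤ) + 1) * φ (n + 1) * v (n + 1) := fun n => by
    have e1 := hPφ n
    have e2 := hv (n + 1)
    rw [add_sub_cancel_right] at e2
    simp only [hα]
    push_cast
    linear_combination φ (n + 1) * e2 - v (n + 1) * e1
  have hβs : ∀ n, β (n + 1) - β n = -(P ((n : ℤ) + 1) * φ (n + 1) * u (n + 1)) := fun n => by
    have e1 := hPφ n
    have e2 := hu (n + 1)
    rw [add_sub_cancel_right] at e2
    simp only [hβ]
    push_cast
    linear_combination u (n + 1) * e1 - φ (n + 1) * e2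
  set s : ℕ → ℝ := fun n => ‖α n‖ + ‖β n‖ with hs
  have hsnn : ∀ n, 0 ≤ s n := fun n => by positivity
  have hφle : ∀ n : ℕ, ‖φ (n + 1)‖ ≤ s n * (‖u (n + 1)‖ + ‖v (n + 1)‖) ∧
      ‖φ (n + 1)‖ ≤ s (n + 1) * (‖u (n + 1)‖ + ‖v (n + 1)‖) := by
    intro n
    have aux : ∀ x y z w : ℂ, ‖x * z + y * w‖ ≤ (‖x‖ + ‖y‖) * (‖z‖ + ‖w‖) := fun x y z w => by
      refine (norm_add_le _ _).trans ?_
      rw [norm_mul, norm_mul]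
      nlinarith [norm_nonneg x, norm_nonneg y, norm_nonneg z, norm_nonneg w,
        mul_nonneg (norm_nonneg x) (norm_nonneg w), mul_nonneg (norm_nonneg y) (norm_nonneg z)]
    refine ⟨by rw [hφn1]; exact aux _ _ _ _, ?_⟩
    have := hφn (n + 1)
    push_cast at this
    rw [this]
    exact aux _ _ _ _
  have hinc : ∀ n : ℕ, ∀ t : ℝ, ‖φ (n + 1)‖ ≤ t * (‖u (n + 1)‖ + ‖v (n + 1)‖) →
      ‖α (n + 1) - α n‖ + ‖β (n + 1) - β n‖ ≤ h n * t := by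
    intro n t ht
    rw [hαs, hβs, norm_neg, norm_mul, norm_mul, norm_mul, norm_mul, Complex.norm_real,
      Real.norm_eq_abs]
    calc _ = |P ((n : ℤ) + 1)| * ‖φ (n + 1)‖ * (‖u (n + 1)‖ + ‖v (n + 1)‖) := by ring
      _ ≤ |P ((n : ℤ) + 1)| * (t * (‖u (n + 1)‖ + ‖v (n + 1)‖)) * (‖u (n + 1)‖ + ‖v (n + 1)‖) := by
          gcongr
      _ = _ := by rw [hh]; ring
  have hstep1 : ∀ n, s (n + 1) ≤ (1 + h n) * s n := fun n => by
    have h1 := hinc n (s n) (hφle n).1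
    have h2 := norm_sub_norm_le (α (n + 1)) (α n)
    have h3 := norm_sub_norm_le (β (n + 1)) (β n)
    simp only [hs] at h1 ⊢
    linarith
  have hstep2 : ∀ n, s n ≤ (1 + h n) * s (n + 1) := fun n => by
    have h1 := hinc n (s (n + 1)) (hφle n).2
    have h2 := norm_sub_norm_le (α n) (α (n + 1))
    have h3 := norm_sub_norm_le (β n) (β (n + 1))
    rw [norm_sub_rev (α n)] at h2
    rw [norm_sub_rev (β n)] at h3
    simp only [hs] at h1 ⊢
    linarith
  have hgr := gronwall_two_sided hsnn hhnn hsum hstep1 hstep2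
  set S := Real.exp (∑' i, h i) * s 0 with hS
  have hS0 : 0 ≤ S := by have := hsnn 0; positivity
  have hd : Summable fun n => h n * S := hsum.mul_right S
  have hinc' : ∀ n, ‖α (n + 1) - α n‖ + ‖β (n + 1) - β n‖ ≤ h n * S := fun n =>
    (hinc n (s n) (hφle n).1).trans (mul_le_mul_of_nonneg_left (hgr n).1 (hhnn n))
  have hdα : ∀ n, dist (α n) (α n.succ) ≤ h n * S := fun n => by
    rw [dist_comm, dist_eq_norm]; linarith [hinc' n, norm_nonneg (β (n + 1) - β n)]
  have hdβ : ∀ n, dist (β n) (β n.succ) ≤ h n * S := fun n => by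
    rw [dist_comm, dist_eq_norm]; linarith [hinc' n, norm_nonneg (α (n + 1) - α n)]
  obtain ⟨a, ha⟩ := cauchySeq_tendsto_of_complete (cauchySeq_of_dist_le_of_summable _ hdα hd)
  obtain ⟨c, hc⟩ := cauchySeq_tendsto_of_complete (cauchySeq_of_dist_le_of_summable _ hdβ hd)
  refine ⟨a, c, ?_, S, hS0, fun n => ?_⟩
  · by_contra hcon
    push Not at hcon
    have hlim : Tendsto (fun n => Real.exp (∑' i, h i) * s n) atTop (nhds 0) := by
      have := (ha.norm.add hc.norm).const_mul (Real.exp (∑' i, h i))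
      simpa [hcon.1, hcon.2] using this
    have hs0 : s 0 ≤ 0 := ge_of_tendsto' hlim fun n => (hgr n).2
    simp only [hs, hα, hβ] at hs0
    simp [hu0, hu1, hv0, hv1] at hs0
    have h1 := norm_nonneg (φ 0)
    have h2 := norm_nonneg (φ 1)
    rcases hφ0 with h0 | h0
    · have := norm_pos_iff.2 h0; linarith
    · have := norm_pos_iff.2 h0; linarith
  · have t1 := dist_le_tsum_of_dist_le_of_tendsto _ hdα hd ha n
    have t2 := dist_le_tsum_of_dist_le_of_tendsto _ hdβ hd hc n
    rw [tsum_mul_right, dist_comm, dist_eq_norm] at t1 t2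
    rw [hφn n, show a * u n + c * v n - (α n * u n + β n * v n)
      = (a - α n) * u n + (c - β n) * v n by ring]
    refine (norm_add_le _ _).trans ?_
    rw [norm_mul, norm_mul, mul_comm S, mul_add]
    gcongr

end VariationOfConstants

section Eigenvectors

/-- Comparison of exponents for eventual inequalities between powers. -/
theorem not_eventually_rpow_le {c D K r s : ℝ} (hc : 0 < c) (hs : 0 ≤ s) (hsr : s < r) :
    ¬ ∀ᶠ N : ℕ in atTop, c * (N : ℝ) ^ r ≤ D * (N : ℝ) ^ s + K := by
  intro h
  have hlim : Tendsto (fun N : ℕ => c * (N : ℝ) ^ (r - s)) atTop atTop :=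
    ((tendsto_rpow_atTop (sub_pos.2 hsr)).comp tendsto_natCast_atTop_atTop).const_mul_atTop hc
  obtain ⟨N, hN, hN1, hN2⟩ := (h.and ((eventually_ge_atTop 1).and
    (hlim.eventually_gt_atTop (|D| + |K|)))).exists
  have hNpos : (0 : ℝ) < N := by exact_mod_cast hN1
  have h1 : (1 : ℝ) ≤ (N : ℝ) ^ s := Real.one_le_rpow (by exact_mod_cast hN1) hs
  rw [Real.rpow_sub hNpos, ← mul_div_assoc, lt_div_iff₀ (by positivity)] at hN2
  nlinarith [le_abs_self D, le_abs_self K, mul_le_mul_of_nonneg_right (le_abs_self D)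
    (zero_le_one.trans h1), mul_le_mul_of_nonneg_left h1 (abs_nonneg K)]

theorem eventually_mass_bounds {u : ℤ → ℂ} {C₁ C₂ γ₁ γ₂ : ℝ} (hC₁ : 0 < C₁)
    (h : ∀ᶠ L : ℝ in atTop, C₁ * L ^ γ₁ ≤ truncNorm u L ∧ truncNorm u L ≤ C₂ * L ^ γ₂) :
    ∀ᶠ N : ℕ in atTop, C₁ ^ 2 * (N : ℝ) ^ (2 * γ₁) ≤ mass u N ∧
      mass u N ≤ C₂ ^ 2 * (N : ℝ) ^ (2 * γ₂) := by
  filter_upwards [tendsto_natCast_atTop_atTop.eventually h] with N hN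
  rw [truncNorm_natCast] at hN
  have hsq : ∀ γ : ℝ, (N : ℝ) ^ (2 * γ) = ((N : ℝ) ^ γ) ^ 2 := fun γ => by
    rw [mul_comm, Real.rpow_mul (Nat.cast_nonneg N), Real.rpow_two]
  rw [hsq, hsq, ← mul_pow, ← mul_pow, ← Real.sq_sqrt (mass_nonneg u N)]
  exact ⟨pow_le_pow_left₀ (by positivity) hN.1 2,
    pow_le_pow_left₀ (Real.sqrt_nonneg _) hN.2 2⟩

theorem exists_mass_le (φ : L2Z) : ∃ K, ∀ N, mass φ N ≤ K := by
  have hs : Summable fun n : ℤ => ‖φ n‖ ^ 2 := by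
    have := (lp.memℓp φ).summable (by norm_num)
    simpa using this
  refine ⟨∑' n : ℕ, ‖φ (n : ℤ)‖ ^ 2, fun N => ?_⟩
  exact (hs.comp_injective Nat.cast_injective).sum_le_tsum _ fun _ _ => by positivity

variable {V P : BddSeq} {E : ℂ}

/-- Under power-law bounds for the unperturbed equation, a perturbation decaying faster than
`n ^ (γ₁ - 3 γ₂)` has no square summable solution: it would be asymptotic to a nontrivial
unperturbed solution, with an error whose mass grows more slowly than `N ^ (2 γ₁)`. -/
theorem eq_zero_of_isSolution_add {γ₁ γ₂ C₁ C₂ p C : ℝ} (hγ₁ : 0 < γ₁)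
    (hγ₂ : 0 < γ₂) (hC₁ : 0 < C₁) (hbd : ∀ u : ℤ → ℂ, IsSolution V E u → ‖u 0‖ ^ 2 + ‖u 1‖ ^ 2 = 1 →
      ∀ᶠ L : ℝ in atTop, C₁ * L ^ γ₁ ≤ truncNorm u L ∧ truncNorm u L ≤ C₂ * L ^ γ₂)
    (hp : 3 * γ₂ - γ₁ < p) (hP : ∀ n : ℕ, |P (n : ℤ)| ≤ C * (1 + (n : ℝ)) ^ (-p))
    (φ : L2Z) (hφ : IsSolution (V + P) E φ) : φ = 0 := by
  by_contra hne
  have hφ0 : φ 0 ≠ 0 ∨ φ 1 ≠ 0 := by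
    by_contra hcon
    push Not at hcon
    exact hne (lp.ext (funext fun n => hφ.eq_zero hcon.1 hcon.2 n))
  set u := sol V E 1 0
  set v := sol V E 0 1
  have hu : IsSolution V E u := isSolution_sol V E 1 0
  have hv : IsSolution V E v := isSolution_sol V E 0 1
  have hu0 : u 0 = 1 := rfl
  have hu1 : u 1 = 0 := rfl
  have hv0 : v 0 = 0 := rfl
  have hv1 : v 1 = 1 := rfl
  have hmu := eventually_mass_bounds hC₁ (hbd u hu (by simp [hu0, hu1]))
  have hmv := eventually_mass_bounds hC₁ (hbd v hv (by simp [hv0, hv1]))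
  have hγ : γ₁ ≤ γ₂ := by
    by_contra hlt
    push Not at hlt
    refine not_eventually_rpow_le (c := C₁ ^ 2) (D := C₂ ^ 2) (K := 0) (s := 2 * γ₂)
      (r := 2 * γ₁) (by positivity) (by linarith) (by linarith) ?_
    filter_upwards [hmu] with N hN
    linarith [hN.1, hN.2]
  have hC : 0 ≤ C := by
    have := (abs_nonneg _).trans (hP 0)
    simpa using this
  -- One `ε` of the surplus decay pays for the summability of `q`, another one for the gain in the
  -- exponent `2 γ₁ - ε` of the error; `ε ≤ γ₁` keeps this exponent nonnegative.
  set ε := min γ₁ ((p - (3 * γ₂ - γ₁)) / 2) with hε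
  have hεpos : 0 < ε := lt_min hγ₁ (by linarith)
  have hε1 : ε ≤ γ₁ := min_le_left _ _
  have hε2 : 3 * γ₂ - γ₁ + 2 * ε ≤ p := by
    have : ε ≤ (p - (3 * γ₂ - γ₁)) / 2 := min_le_right _ _
    linarith
  set w : ℕ → ℝ := fun n => ‖u n‖ + ‖v n‖ with hw
  have hwnn : ∀ n, 0 ≤ w n := fun n => by positivity
  set q : ℕ → ℝ := fun n => w n ^ 2 * (n : ℝ) ^ (-(2 * γ₂ + ε)) with hq
  have hqnn : ∀ n, 0 ≤ q n := fun n => by positivity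
  have hqs : Summable q := by
    refine summable_mul_rpow_of_sum_le (C := 4 * C₂ ^ 2) (r := 2 * γ₂) (fun n => sq_nonneg (w n))
      (by linarith) (by linarith) ?_
    filter_upwards [hmu, hmv] with N h1 h2
    have : ∑ k ∈ Finset.Icc 1 N, w k ^ 2 ≤ 2 * (mass u N + mass v N) := by
      rw [mass, mass, ← Finset.sum_add_distrib, Finset.mul_sum]
      refine Finset.sum_le_sum fun k _ => ?_
      simp only [hw]
      nlinarith [sq_nonneg (‖u k‖ - ‖v k‖)]
    linarith [h1.2, h2.2]
  set Q := ∑' n, q n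
  have hQnn : 0 ≤ Q := tsum_nonneg hqnn
  have hwq : ∀ n : ℕ, 1 ≤ n → w n ^ 2 = q n * (n : ℝ) ^ (2 * γ₂ + ε) := fun n hn => by
    have hn' : (0 : ℝ) < n := by exact_mod_cast hn
    rw [hq]
    simp only
    rw [mul_assoc, ← Real.rpow_add hn', neg_add_cancel, Real.rpow_zero, mul_one]
  set κ := γ₂ - γ₁ + ε with hκ
  set h : ℕ → ℝ := fun n => |P ((n : ℤ) + 1)| * (‖u (n + 1)‖ + ‖v (n + 1)‖) ^ 2 with hh
  have hhnn : ∀ n, 0 ≤ h n := fun n => by positivity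
  have hhle : ∀ n : ℕ, h n ≤ C * q (n + 1) * ((n + 1 : ℕ) : ℝ) ^ (-κ) := by
    intro n
    have e : h n = |P ((n + 1 : ℕ) : ℤ)| * w (n + 1) ^ 2 := by simp only [hh, hw]; push_cast; rfl
    have hn' : (0 : ℝ) < (n + 1 : ℕ) := by positivity
    have h1 : (1 : ℝ) ≤ (n + 1 : ℕ) := by exact_mod_cast Nat.le_add_left 1 n
    rw [e, hwq _ (Nat.le_add_left 1 n)]
    have hPn : |P ((n + 1 : ℕ) : ℤ)| ≤ C * ((n + 1 : ℕ) : ℝ) ^ (-p) :=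
      (hP (n + 1)).trans (mul_le_mul_of_nonneg_left
        (Real.rpow_le_rpow_of_nonpos hn' (by linarith) (by linarith)) hC)
    calc _ ≤ C * ((n + 1 : ℕ) : ℝ) ^ (-p) * (q (n + 1) * ((n + 1 : ℕ) : ℝ) ^ (2 * γ₂ + ε)) :=
          mul_le_mul_of_nonneg_right hPn (mul_nonneg (hqnn _) (by positivity))
      _ = C * q (n + 1) * ((n + 1 : ℕ) : ℝ) ^ (-p + (2 * γ₂ + ε)) := by
          rw [Real.rpow_add hn' (-p)]; ring
      _ ≤ _ := mul_le_mul_of_nonneg_left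
          (Real.rpow_le_rpow_of_exponent_le h1 (by linarith)) (mul_nonneg hC (hqnn _))
  have hqs1 : Summable fun n => q (n + 1) := (summable_nat_add_iff 1).2 hqs
  have hhs : Summable h := by
    refine Summable.of_nonneg_of_le hhnn (fun n => (hhle n).trans ?_) (hqs1.mul_left C)
    refine mul_le_of_le_one_right (mul_nonneg hC (hqnn _)) ?_
    exact Real.rpow_le_one_of_one_le_of_nonpos (by exact_mod_cast Nat.le_add_left 1 n)
      (by linarith)
  have htail : ∀ n : ℕ, 1 ≤ n → ∑' m, h (n + m) ≤ C * Q * (n : ℝ) ^ (-κ) := by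
    intro n hn
    have hn' : (0 : ℝ) < n := by exact_mod_cast hn
    have hinj : Function.Injective fun m : ℕ => n + m + 1 := fun a b hab => by
      simp only at hab; omega
    have hqs2 : Summable fun m : ℕ => q (n + m + 1) := hqs.comp_injective hinj
    calc ∑' m, h (n + m) ≤ ∑' m, C * (n : ℝ) ^ (-κ) * q (n + m + 1) := by
          refine Summable.tsum_le_tsum (fun m => (hhle _).trans ?_)
            (hhs.comp_injective (add_right_injective n)) (hqs2.mul_left _)
          have : ((n + m + 1 : ℕ) : ℝ) ^ (-κ) ≤ (n : ℝ) ^ (-κ) :=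
            Real.rpow_le_rpow_of_nonpos hn' (by exact_mod_cast (by omega : n ≤ n + m + 1))
              (by linarith)
          calc _ ≤ C * q (n + m + 1) * (n : ℝ) ^ (-κ) :=
                mul_le_mul_of_nonneg_left this (mul_nonneg hC (hqnn _))
            _ = _ := by ring
      _ = C * (n : ℝ) ^ (-κ) * ∑' m, q (n + m + 1) := tsum_mul_left
      _ ≤ C * (n : ℝ) ^ (-κ) * Q := mul_le_mul_of_nonneg_left
          (hqs2.tsum_le_tsum_of_inj _ hinj (fun _ _ => hqnn _) (fun _ => le_rfl) hqs)
          (by positivity)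
      _ = _ := by ring
  obtain ⟨a, c, hac, S, hS, herr⟩ :=
    exists_asymptotic_solution hφ hφ0 hu hv hu0 hu1 hv0 hv1 hhs
  set ψ : ℤ → ℂ := fun n => a * u n + c * v n with hψ
  have herr' : ∀ n : ℕ, 1 ≤ n →
      ‖ψ n - φ n‖ ^ 2 ≤ (S * (C * Q)) ^ 2 * q n * (n : ℝ) ^ (2 * γ₁ - ε) := by
    intro n hn
    have hn' : (0 : ℝ) < n := by exact_mod_cast hn
    have h1 : ‖ψ n - φ n‖ ≤ S * (C * Q * (n : ℝ) ^ (-κ)) * w n :=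
      (herr n).trans (mul_le_mul_of_nonneg_right
        (mul_le_mul_of_nonneg_left (htail n hn) hS) (hwnn n))
    calc ‖ψ n - φ n‖ ^ 2 ≤ (S * (C * Q * (n : ℝ) ^ (-κ)) * w n) ^ 2 :=
          pow_le_pow_left₀ (norm_nonneg _) h1 2
      _ = (S * (C * Q)) ^ 2 * ((n : ℝ) ^ (-κ) * (n : ℝ) ^ (-κ)) * w n ^ 2 := by ring
      _ = (S * (C * Q)) ^ 2 * q n
            * ((n : ℝ) ^ (-κ) * (n : ℝ) ^ (-κ) * (n : ℝ) ^ (2 * γ₂ + ε)) := by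
          rw [hwq n hn]; ring
      _ = _ := by
          rw [← Real.rpow_add hn', ← Real.rpow_add hn']
          congr 2
          rw [hκ]; ring
  obtain ⟨K, hK⟩ := exists_mass_le φ
  have hmass : ∀ N : ℕ, mass ψ N
      ≤ 2 * ((S * (C * Q)) ^ 2 * Q) * (N : ℝ) ^ (2 * γ₁ - ε) + 2 * K := by
    intro N
    have h1 : ∑ k ∈ Finset.Icc 1 N, ‖ψ k - φ k‖ ^ 2
        ≤ (S * (C * Q)) ^ 2 * Q * (N : ℝ) ^ (2 * γ₁ - ε) := by
      calc _ ≤ ∑ k ∈ Finset.Icc 1 N, (S * (C * Q)) ^ 2 * (N : ℝ) ^ (2 * γ₁ - ε) * q k := by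
            refine Finset.sum_le_sum fun k hk => ?_
            rw [Finset.mem_Icc] at hk
            refine (herr' k hk.1).trans ?_
            rw [mul_right_comm]
            gcongr
            · linarith
            · exact hk.2
        _ = (S * (C * Q)) ^ 2 * (N : ℝ) ^ (2 * γ₁ - ε) * ∑ k ∈ Finset.Icc 1 N, q k := by
            rw [Finset.mul_sum]
        _ ≤ (S * (C * Q)) ^ 2 * (N : ℝ) ^ (2 * γ₁ - ε) * Q := by
            gcongr
            exact hqs.sum_le_tsum _ fun _ _ => hqnn _
        _ = _ := by ring
    have h2 : mass ψ N ≤ 2 * ∑ k ∈ Finset.Icc 1 N, ‖ψ k - φ k‖ ^ 2 + 2 * mass φ N := by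
      rw [mass, mass, Finset.mul_sum, Finset.mul_sum, ← Finset.sum_add_distrib]
      refine Finset.sum_le_sum fun k _ => ?_
      have h3 : ‖ψ k‖ ≤ ‖ψ k - φ k‖ + ‖φ k‖ := by
        simpa using norm_add_le (ψ k - φ k) (φ k)
      nlinarith [norm_nonneg (ψ k), sq_nonneg (‖ψ k - φ k‖ - ‖φ k‖)]
    linarith [hK N]
  have hr2 : 0 < ‖a‖ ^ 2 + ‖c‖ ^ 2 := by
    rcases hac with h0 | h0
    · have := norm_pos_iff.2 h0; positivity
    · have := norm_pos_iff.2 h0; positivity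
  obtain ⟨r, hr, hrr⟩ : ∃ r : ℝ, 0 < r ∧ r ^ 2 = ‖a‖ ^ 2 + ‖c‖ ^ 2 :=
    ⟨_, Real.sqrt_pos.2 hr2, Real.sq_sqrt hr2.le⟩
  have hsol := hu.linear_comb hv ((r : ℂ)⁻¹ * a) ((r : ℂ)⁻¹ * c)
  have hnorm : ∀ z : ℂ, ‖(r : ℂ)⁻¹ * z‖ ^ 2 = ‖z‖ ^ 2 / r ^ 2 := fun z => by
    rw [norm_mul, norm_inv, Complex.norm_real, Real.norm_of_nonneg hr.le, mul_pow, inv_pow]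
    field_simp
  have hmψ := eventually_mass_bounds hC₁ (hbd _ hsol (by
    rw [hu0, hu1, hv0, hv1, mul_one, mul_zero, mul_one, mul_zero, add_zero, zero_add, hnorm, hnorm,
      ← add_div, ← hrr, div_self (by positivity)]))
  refine not_eventually_rpow_le (c := C₁ ^ 2 * r ^ 2) (s := 2 * γ₁ - ε) (r := 2 * γ₁)
    (by positivity) (by linarith) (by linarith) (hmψ.mono fun N hN => ?_)
    (D := 2 * ((S * (C * Q)) ^ 2 * Q)) (K := 2 * K)
  have e : mass (fun n => (r : ℂ)⁻¹ * a * u n + (r : ℂ)⁻¹ * c * v n) N = mass ψ N / r ^ 2 := by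
    rw [mass, mass, Finset.sum_div]
    refine Finset.sum_congr rfl fun k _ => ?_
    rw [← hnorm]
    simp only [hψ]
    ring_nf
  have h1 := hN.1
  rw [e, le_div_iff₀ (by positivity)] at h1
  linarith [hmass N]

end Eigenvectors

end Sturmian

end

theorem mainTheorem4 (θ : ℝ) (hθ : θ ∈ Set.Ico (0 : ℝ) 1) (hirr : Irrational θ)
    (hbd : Sturmian.BoundedDensity θ) (lam : ℝ) (hlam : lam ≠ 0) :
    (∃ γ₁ γ₂ : ℝ, ∀ ρ ∈ Set.Ico (0 : ℝ) 1, Sturmian.HasPowerLawBounds lam θ ρ γ₁ γ₂) ∧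
    ∀ ρ ∈ Set.Ico (0 : ℝ) 1, ∀ γ₁ γ₂ : ℝ, Sturmian.HasPowerLawBounds lam θ ρ γ₁ γ₂ →
      ∀ p : ℝ, 3 * γ₂ - γ₁ < p →
        ∀ P : Sturmian.BddSeq,
          (∃ C > 0, ∀ n : ℕ, |P (n : ℤ)| ≤ C * (1 + (n : ℝ)) ^ (-p)) →
            ∀ E ∈ spectrum ℂ (Sturmian.sturmianOp lam θ ρ),
              ¬ Module.End.HasEigenvalue
                (Sturmian.perturbedOp lam θ ρ P : Sturmian.L2Z →ₗ[ℂ] Sturmian.L2Z) E := by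
  obtain ⟨γ₁, γ₂, h⟩ := Sturmian.exists_hasPowerLawBounds hθ hirr hbd lam
  refine ⟨⟨γ₁, γ₂, fun ρ _ => h ρ⟩, ?_⟩
  rintro ρ - γ₁ γ₂ ⟨hγ₁, hγ₂, hpow⟩ p hp P ⟨C, -, hP⟩ E hE heig
  obtain ⟨C₁, hC₁, C₂, -, hb⟩ := hpow E hE
  obtain ⟨φ, hφ⟩ := heig.exists_hasEigenvector
  refine hφ.2 (Sturmian.eq_zero_of_isSolution_add hγ₁ hγ₂ hC₁ hb hp hP φ fun n => ?_)
  have := congrArg (fun f : Sturmian.L2Z => f n) hφ.apply_eq_smul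
  exact this
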